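/- Let $(\Omega,\mathcal F,\mathbb P)$ be a probability space carrying a standard Brownian motion $M$, let $\mu,x_0\in\mathbb R$, $T>0$ and $0<\rho\le 1/\sqrt2$. Let $$v(T,x)=\frac1{\sqrt{2\pi(1-\rho)T}}\exp\Big(-\frac{(x-x_0-\mu T-\sqrt\rho M_T)^2}{2(1-\rho)T}\Big)$$ be the solution at time $T$ of $\mathrm dv=-\mu\,\partial_xv\,\mathrm dt+\tfrac12\partial_{xx}v\,\mathrm dt-\sqrt\rho\,\partial_xv\,\mathrm dM_t$, $v(0,\cdot)=\delta_{x_0}$. For a mesh size $h>0$ with $x_0\in h\mathbb Z$ and a time step $k=T/N$, $N\ge1$, put $x_j=jh$, $Z_n=(M_{(n+1)k}-M_{nk})/\sqrt k$, $(D_1V)_j=V_{j+1}-V_{j-1}$, $(D_2V)_j=V_{j+1}-2V_j+V_{j-1}$, and let $V^0,\dots,V^N\in\ell_2(\mathbb Z)$ be the solution of either one of the implicit Milstein schemes $$V^{n+1}=V^n-\frac{\mu k}{2h}D_1V^{n+1}+\frac{k}{2h^2}D_2V^{n+1}-\frac{\sqrt{\rho k}Z_n}{2h}D_1V^n+\rho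 k(Z_n^2-1)\,\frac{D_1^2V^n}{8h^2},$$ $$V^{n+1}=V^n-\frac{\mu k}{2h}D_1V^{n+1}+\frac{k}{2h^2}D_2V^{n+1}-\frac{\sqrt{\rho k}Z_n}{2h}D_1V^n+\rho k(Z_n^2-1)\,\frac{D_2V^n}{2h^2},$$ with $V^0_j=h^{-1}$ if $jh=x_0$ and $V^0_j=0$ otherwise (such a solution exists). The ratio $k/h^2$ is not required to be fixed. Then there are a constant $\theta\in(0,1)$ independent of $h$ and $k$, real random variables $E_1(T,x)$ (independent of $h$, possibly depending on $k$), $E_2(T,x)$ (independent of $h$ and $k$), and $E_3(T,x)$, $R(T,x)$ (possibly depending on $h$ and $k$), all with first and second moments bounded uniformly in $x,h,k$, and a deterministic function $r(k,h)$ with $r(k,h)/(k+h^2)\to0$ as $k,h\to0^+$ independently of each other, such that for all such $h,k$ and all $j\in\mathbb Z$, almost surely: * if $h^2\ge k$, then $$V^N_j-v(T,x_j)=k\,E_1(T,x_j)+h^2E_2(T,x_j)+r(k,h)\,R(T,x_j);$$ * if $h^2<k$ and $\rho<1/\sqrt2$, then $$V^N_j-v(T,x_j)=k\,E_1(T,x_j)+h^2E_2(T,x_j)+\theta^Nh^{-1}E_3(T,x_j)+r(k,h)\,R(T,x_j).$$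 -/

import Mathlib

open MeasureTheory ProbabilityTheory Filter Asymptotics
open scoped NNReal Topology

noncomputable section

namespace ZakaiMilstein

/-- First central difference operator, `(D₁ V)_j = V_{j+1} - V_{j-1}`. -/
def D1 (V : ℤ → ℝ) (j : ℤ) : ℝ := V (j + 1) - V (j - 1)

/-- Second central difference operator, `(D₂ V)_j = V_{j+1} - 2 V_j + V_{j-1}`. -/
def D2 (V : ℤ → ℝ) (j : ℤ) : ℝ := V (j + 1) - 2 * V j + V (j - 1)

/-- The two implicit Milstein discretisations: space first (the second-order noise term carries
`D₁²/(8h²)`), or time first (it carries `D₂/(2h²)`). -/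
inductive Scheme
  | spaceFirst
  | timeFirst

/-- The difference quotient multiplying `ρ k (Z² - 1)` in each of the two schemes. -/
def Scheme.correction : Scheme → ℝ → (ℤ → ℝ) → ℤ → ℝ
  | .spaceFirst, h, V, j => D1 (D1 V) j / (8 * h ^ 2)
  | .timeFirst, h, V, j => D2 V j / (2 * h ^ 2)

/-- Discretised Dirac data: `h⁻¹` at the grid index closest to `x₀ / h`, zero elsewhere. -/
def diracGrid (h x₀ : ℝ) (j : ℤ) : ℝ := if j = round (x₀ / h) then h⁻¹ else 0

/-- `V 0, …, V N` is the square-summable solution of the implicit Milstein scheme `s` with mesh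
size `h` and time step `k`, driven by the noise values `Z 0, …, Z (N - 1)`. -/
structure IsMilsteinSolution (s : Scheme) (μ ρ x₀ h k : ℝ) (N : ℕ) (Z : ℕ → ℝ)
    (V : ℕ → ℤ → ℝ) : Prop where
  initial : V 0 = diracGrid h x₀
  summable_sq : ∀ n ≤ N, Summable fun j : ℤ => V n j ^ 2
  step : ∀ n < N, ∀ j : ℤ,
    V (n + 1) j = V n j - μ * k / (2 * h) * D1 (V (n + 1)) j
      + k / (2 * h ^ 2) * D2 (V (n + 1)) j
      - √(ρ * k) * Z n / (2 * h) * D1 (V n) j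
      + ρ * k * ((Z n) ^ 2 - 1) * s.correction h (V n) j

/-- The solution at time `T` of
`dv = -μ ∂ₓv dt + ½ ∂ₓₓv dt - √ρ ∂ₓv dM`, `v(0,·) = δ_{x₀}`, at a path with `M_T = m`. -/
def exactSolution (μ ρ x₀ T m x : ℝ) : ℝ :=
  1 / √(2 * Real.pi * (1 - ρ) * T) *
    Real.exp (-(x - x₀ - μ * T - √ρ * m) ^ 2 / (2 * (1 - ρ) * T))

variable {Ω : Type*}

/-- Normalised increment `Z_n = (M_{(n+1)k} - M_{nk}) / √k` of a path process `M`. -/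
def noise (M : ℝ≥0 → Ω → ℝ) (k : ℝ≥0) (ω : Ω) (n : ℕ) : ℝ :=
  (M ((n + 1) * k) ω - M (n * k) ω) / √(k : ℝ)

/-- A family of real random variables whose first and second moments are finite and bounded
uniformly in the index. -/
def HasBoundedMoments [MeasurableSpace Ω] (P : Measure Ω) {ι : Type*} (E : ι → Ω → ℝ) : Prop :=
  ∃ C : ℝ, ∀ i, MemLp (E i) 2 P ∧ |∫ ω, E i ω ∂P| ≤ C ∧ ∫ ω, E i ω ^ 2 ∂P ≤ C

end ZakaiMilstein

end

open scoped ENNReal ComplexConjugate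

namespace ZakaiMilstein

/-! The scheme is linear with constant coefficients, so on the wave number ξ one step acts as
multiplication by the random factor `ampl`. Hence V^N is an inverse Fourier integral over |ξ| ≤ π/h
of a product of N independent factors (`isMilsteinSolution_numSol`, with uniqueness from
`IsMilsteinSolution.unique`). The transform `exactFourier` of v(T, ·) is a product of N factors as
well. By weighted Cauchy–Schwarz and Tonelli (`hasBoundedMoments_of_fourier`) it suffices to bound
the second moment of the difference of the two products for each ξ separately.

Low wave numbers, (k + h²)L⁴ ≤ 1 with L = 1 + |ξ|. Divide each amplification factor by the exact
one; the quotient `fullRatio` is close to 1. Put s = √k L and y = h²L². Without space discretisation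
the quotient `baseRatio` differs from 1 by O(s³) in L² and by only O(s⁴) in mean. Positive h adds
`ratioLin`, of size sy with mean O(s²y), and smaller terms (`exists_stepMoments`). A sum of N
independent terms with mean d and second moment q has second moment at most Nq + N²d². So the sum of
the `baseRatio` errors is O(k) and yields E₁, while the sum of the `ratioLin` is exactly h² times a
function of M_T and yields E₂. The nonlinear part of the product
(`IsStdNormalSeq.integral_norm_prodRem_sq_le`) and the remaining terms have second moment O((k +
h²)³), whence r = (k + h²)^(3/2).

Other wave numbers. With x = k(1 - cos hξ)/h² one has E|ampl|² ≤ (1 + 2ρx + 2ρ²x²)/(1 + x)², which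
tends to 2ρ² ≤ 1 for large x. If x ≤ 2, this is at most exp(-cx), so the product decays like a
Gaussian in ξ, as do all leading terms; where (k + h²)L⁴ > 1, powers of (k + h²)L⁴ may be inserted
for free. If x > 2 and ρ < 1/√2, it is at most some θ² < 1; the product then has L² norm at most θ^N
on a band of length at most 2π/h, which is the term with E₃. Since x ≤ 2k/h², that band is empty
when k ≤ h². -/

/-! ### Gaussian moments and integration by parts. -/

lemma integrable_one_add_abs_pow_gaussianReal (n : ℕ) :
    Integrable (fun z : ℝ => (1 + |z|) ^ n) (gaussianReal 0 1) := by
  have h0 : MemLp (fun z : ℝ => ‖id z‖) n (gaussianReal 0 1) :=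
    (memLp_id_gaussianReal' (μ := 0) (v := 1) (n : ENNReal) (ENNReal.natCast_ne_top n)).norm
  have h1 : MemLp (fun _ : ℝ => (1 : ℝ)) n (gaussianReal 0 1) := memLp_const 1
  have h := h1.add h0
  refine (h.integrable_norm_pow').congr (ae_of_all _ fun z => ?_)
  have : 0 ≤ 1 + |z| := by positivity
  simp [abs_of_nonneg this]

lemma integrable_gaussianReal_of_bound {E : Type*} [NormedAddCommGroup E] {f : ℝ → E} {C : ℝ}
    {n : ℕ} (hf : AEStronglyMeasurable f (gaussianReal 0 1))
    (hb : ∀ z, ‖f z‖ ≤ C * (1 + |z|) ^ n) : Integrable f (gaussianReal 0 1) :=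
  ((integrable_one_add_abs_pow_gaussianReal n).const_mul C).mono' hf (ae_of_all _ hb)

lemma integrable_smul_of_integrable_gaussianReal {f : ℝ → ℂ}
    (hf : Integrable f (gaussianReal 0 1)) :
    Integrable fun z => gaussianPDFReal 0 1 z • f z := by
  rw [gaussianReal_of_var_ne_zero _ one_ne_zero,
    integrable_withDensity_iff_integrable_smul' (measurable_gaussianPDF _ _)
      (ae_of_all _ fun _ => gaussianPDF_lt_top)] at hf
  simpa [toReal_gaussianPDF] using hf

lemma hasDerivAt_gaussianPDFReal (z : ℝ) :
    HasDerivAt (gaussianPDFReal 0 1) (-z * gaussianPDFReal 0 1 z) z := by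
  unfold gaussianPDFReal
  have h : HasDerivAt (fun x : ℝ => -(x - 0) ^ 2 / (2 * ((1 : ℝ≥0) : ℝ))) (-z) z := by
    have := (((hasDerivAt_id' z).sub_const 0).fun_pow 2).fun_neg.div_const (2 * ((1 : ℝ≥0) : ℝ))
    refine this.congr_deriv ?_
    norm_num
    ring
  refine (h.exp.const_mul ((√(2 * Real.pi * ((1 : ℝ≥0) : ℝ)))⁻¹)).congr_deriv ?_
  ring

/-- Gaussian integration by parts. -/
lemma integral_mul_gaussianReal {f f' : ℝ → ℂ} {C : ℝ} {n : ℕ}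
    (hd : ∀ z, HasDerivAt f (f' z) z) (hc : Continuous f')
    (hf : ∀ z, ‖f z‖ ≤ C * (1 + |z|) ^ n) (hf' : ∀ z, ‖f' z‖ ≤ C * (1 + |z|) ^ n) :
    ∫ z, (z : ℂ) * f z ∂gaussianReal 0 1 = ∫ z, f' z ∂gaussianReal 0 1 := by
  have hfc : Continuous f := continuous_iff_continuousAt.2 fun z => (hd z).continuousAt
  have i0 := integrable_gaussianReal_of_bound hfc.aestronglyMeasurable hf
  have i1 := integrable_gaussianReal_of_bound hc.aestronglyMeasurable hf'
  have i2 : Integrable (fun z : ℝ => (z : ℂ) * f z) (gaussianReal 0 1) := by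
    refine integrable_gaussianReal_of_bound (C := C) (n := n + 1) (by fun_prop) fun z => ?_
    rw [norm_mul, Complex.norm_real, Real.norm_eq_abs, pow_succ]
    nlinarith [hf z, abs_nonneg z, norm_nonneg (f z)]
  have key : ∫ z, gaussianPDFReal 0 1 z • (f' z - (z : ℂ) * f z) = 0 := by
    refine integral_eq_zero_of_hasDerivAt_of_integrable
      (f := fun z => gaussianPDFReal 0 1 z • f z) (fun z => ?_)
      (integrable_smul_of_integrable_gaussianReal (i1.sub i2))
      (integrable_smul_of_integrable_gaussianReal i0)
    refine ((hasDerivAt_gaussianPDFReal z).fun_smul (hd z)).congr_deriv ?_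
    simp only [Complex.real_smul]
    push_cast
    ring
  rw [← integral_gaussianReal_eq_integral_smul one_ne_zero, integral_sub i1 i2] at key
  exact (sub_eq_zero.1 key).symm

lemma integral_sq_gaussianReal : ∫ z : ℝ, z ^ 2 ∂gaussianReal 0 1 = 1 := by
  have h := integral_mul_gaussianReal (f := fun z => (z : ℂ)) (f' := fun _ => 1) (C := 1) (n := 1)
    (fun z => (hasDerivAt_id z).ofReal_comp) continuous_const
    (fun z => by simp) (fun z => by simp)
  have h2 : ∫ z : ℝ, (z : ℂ) * z ∂gaussianReal 0 1 = ((∫ z : ℝ, z ^ 2 ∂gaussianReal 0 1 : ℝ) : ℂ) := by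
    rw [← integral_complex_ofReal]
    congr 1
    ext z
    push_cast
    ring
  rw [h2] at h
  have : ((∫ z : ℝ, z ^ 2 ∂gaussianReal 0 1 : ℝ) : ℂ) = 1 := by simpa using h
  exact_mod_cast this

lemma integral_pow_four_gaussianReal : ∫ z : ℝ, z ^ 4 ∂gaussianReal 0 1 = 3 := by
  have h := integral_mul_gaussianReal (f := fun z => (z : ℂ) ^ 3) (f' := fun z => 3 * (z : ℂ) ^ 2)
    (C := 3) (n := 3)
    (fun z => by simpa using ((hasDerivAt_id' z).ofReal_comp).fun_pow 3) (by fun_prop)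
    (fun z => by
      rw [norm_pow, Complex.norm_real, Real.norm_eq_abs]
      have : |z| ^ 3 ≤ (1 + |z|) ^ 3 := by gcongr; linarith
      have : 0 ≤ (1 + |z|) ^ 3 := by positivity
      linarith)
    (fun z => by
      rw [norm_mul, norm_pow, Complex.norm_real, Real.norm_eq_abs]
      have h1 : |z| ^ 2 ≤ (1 + |z|) ^ 3 := by nlinarith [abs_nonneg z, sq_nonneg (|z|)]
      simpa using h1)
  have h2 : ∫ z : ℝ, (z : ℂ) * (z : ℂ) ^ 3 ∂gaussianReal 0 1 =
      ((∫ z : ℝ, z ^ 4 ∂gaussianReal 0 1 : ℝ) : ℂ) := by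
    rw [← integral_complex_ofReal]
    congr 1
    ext z
    push_cast
    ring
  have h3 : ∫ z : ℝ, 3 * (z : ℂ) ^ 2 ∂gaussianReal 0 1 =
      ((3 * ∫ z : ℝ, z ^ 2 ∂gaussianReal 0 1 : ℝ) : ℂ) := by
    rw [← integral_const_mul, ← integral_complex_ofReal]
    congr 1
    ext z
    push_cast
    ring
  rw [h2, h3, integral_sq_gaussianReal] at h
  have := Complex.ofReal_injective h
  linarith

lemma integral_exp_gaussianReal (t : ℝ) :
    ∫ z : ℝ, Complex.exp (Complex.I * (t * z : ℝ)) ∂gaussianReal 0 1 =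
      Complex.exp ((-t ^ 2 / 2 : ℝ) : ℂ) := by
  have h := charFun_gaussianReal (μ := 0) (v := 1) t
  rw [charFun_apply_real] at h
  convert h using 1
  · congr 1
    ext z
    push_cast
    ring_nf
  · push_cast
    ring_nf

lemma norm_exp_I_mul (x : ℝ) : ‖Complex.exp (Complex.I * x)‖ = 1 := by
  rw [mul_comm]; exact Complex.norm_exp_ofReal_mul_I x

/-! ### Moments of the numerator of the amplification factor. -/

/-- Numerator of the amplification factor of a Milstein step, in dimensionless form. -/
noncomputable def stepNum (a c z : ℝ) : ℂ := ((1 - (z ^ 2 - 1) * c : ℝ) : ℂ) - Complex.I * (z * a : ℝ)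

lemma continuous_stepNum (a c : ℝ) : Continuous (stepNum a c) := by
  unfold stepNum; fun_prop

lemma norm_stepNum_sq (a c z : ℝ) :
    ‖stepNum a c z‖ ^ 2 = (1 - (z ^ 2 - 1) * c) ^ 2 + (z * a) ^ 2 := by
  rw [← Complex.normSq_eq_norm_sq, Complex.normSq_apply]
  simp [stepNum]
  norm_cast
  simp
  ring

/-- The polynomials 1, z and z² - 1 are orthogonal for the Gaussian law, with squared norms 1, 1 and
2. -/
lemma integral_norm_stepNum_sq (a c : ℝ) :
    ∫ z, ‖stepNum a c z‖ ^ 2 ∂gaussianReal 0 1 = 1 + a ^ 2 + 2 * c ^ 2 := by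
  have hi : ∀ n, Integrable (fun z : ℝ => z ^ n) (gaussianReal 0 1) := fun n =>
    integrable_gaussianReal_of_bound (C := 1) (n := n) (by fun_prop) fun z => by
      rw [norm_pow, Real.norm_eq_abs, one_mul]; gcongr; linarith
  have : ∀ z : ℝ, ‖stepNum a c z‖ ^ 2 =
      (1 + c) ^ 2 + (a ^ 2 - 2 * (1 + c) * c) * z ^ 2 + c ^ 2 * z ^ 4 := fun z => by
    rw [norm_stepNum_sq]; ring
  simp_rw [this]
  have i01 : Integrable (fun z : ℝ => (1 + c) ^ 2 + (a ^ 2 - 2 * (1 + c) * c) * z ^ 2)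
      (gaussianReal 0 1) := (integrable_const _).add ((hi 2).const_mul _)
  rw [integral_add i01 ((hi 4).const_mul _),
    integral_add (integrable_const _) ((hi 2).const_mul _), integral_const_mul, integral_const_mul,
    integral_sq_gaussianReal, integral_pow_four_gaussianReal]
  simp
  ring

/-- The Hermite polynomial of degree n integrates against exp(itz) to (it)^n exp(-t²/2). This closed
form is what shows that the means of the step errors are of higher order than the errors themselves.
-/
lemma integral_stepNum_mul_exp (a c t : ℝ) :
    ∫ z, stepNum a c z * Complex.exp (Complex.I * (t * z : ℝ)) ∂gaussianReal 0 1 =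
      ((1 + a * t + c * t ^ 2 : ℝ) : ℂ) * Complex.exp ((-t ^ 2 / 2 : ℝ) : ℂ) := by
  set e : ℝ → ℂ := fun z => Complex.exp (Complex.I * (t * z : ℝ)) with he
  have hen : ∀ z, ‖e z‖ = 1 := fun z => norm_exp_I_mul _
  have hec : Continuous e := by simp only [he]; fun_prop
  have hed : ∀ z, HasDerivAt e (Complex.I * t * e z) z := fun z => by
    have h0 : HasDerivAt (fun z : ℝ => Complex.I * ((t * z : ℝ) : ℂ)) (Complex.I * t) z := by
      have := ((hasDerivAt_id' z).const_mul t).ofReal_comp.const_mul Complex.I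
      simpa using this
    exact h0.cexp.congr_deriv (by simp only [he]; ring)
  have hi : ∀ n, Integrable (fun z : ℝ => (z : ℂ) ^ n * e z) (gaussianReal 0 1) := fun n =>
    integrable_gaussianReal_of_bound (C := 1) (n := n) (by fun_prop) fun z => by
      rw [norm_mul, hen, norm_pow, Complex.norm_real, Real.norm_eq_abs, one_mul, mul_one]
      gcongr; linarith
  have hie : Integrable e (gaussianReal 0 1) := by simpa using hi 0
  have h1 : ∫ z : ℝ, (z : ℂ) ^ 1 * e z ∂gaussianReal 0 1 =
      Complex.I * t * ∫ z, e z ∂gaussianReal 0 1 := by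
    simp_rw [pow_one]
    rw [integral_mul_gaussianReal (f := e) (f' := fun z => Complex.I * t * e z) (C := 1 + |t|)
      (n := 0) hed (by fun_prop) (fun z => by simp [hen]) (fun z => by simp [hen]),
      integral_const_mul]
  have h2 : ∫ z : ℝ, (z : ℂ) ^ 2 * e z ∂gaussianReal 0 1 =
      (1 - t ^ 2) * ∫ z, e z ∂gaussianReal 0 1 := by
    have := integral_mul_gaussianReal (f := fun z => (z : ℂ) * e z)
      (f' := fun z => e z + Complex.I * t * ((z : ℂ) ^ 1 * e z)) (C := 1 + |t|)
      (n := 1) (fun z => by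
        have := ((hasDerivAt_id' z).ofReal_comp).fun_mul (hed z)
        exact this.congr_deriv (by push_cast; ring)) (by fun_prop) (fun z => by
        rw [norm_mul, hen, Complex.norm_real, Real.norm_eq_abs]
        nlinarith [abs_nonneg z, abs_nonneg t, mul_nonneg (abs_nonneg z) (abs_nonneg t)])
        (fun z => by
        refine (norm_add_le _ _).trans ?_
        simp only [norm_mul, hen, Complex.norm_real, Real.norm_eq_abs, pow_one, Complex.norm_I]
        nlinarith [abs_nonneg z, abs_nonneg t, mul_nonneg (abs_nonneg z) (abs_nonneg t)])
    rw [integral_add hie ((hi 1).const_mul _), integral_const_mul, h1] at this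
    rw [show (fun z : ℝ => (z : ℂ) * ((z : ℂ) * e z)) = fun z : ℝ => (z : ℂ) ^ 2 * e z from
      funext fun z => by ring] at this
    rw [this]
    linear_combination ((t : ℂ) ^ 2 * ∫ z, e z ∂gaussianReal 0 1) * Complex.I_sq
  have hsplit : ∀ z, stepNum a c z * e z =
      (1 + c) * ((z : ℂ) ^ 0 * e z) - Complex.I * a * ((z : ℂ) ^ 1 * e z)
        - c * ((z : ℂ) ^ 2 * e z) := fun z => by
    simp only [stepNum]; push_cast; ring
  rw [show (fun z => stepNum a c z * Complex.exp (Complex.I * (t * z : ℝ))) = _ from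
    funext hsplit]
  have i01 : Integrable (fun z : ℝ => (1 + (c : ℂ)) * ((z : ℂ) ^ 0 * e z) -
      Complex.I * a * ((z : ℂ) ^ 1 * e z)) (gaussianReal 0 1) :=
    ((hi 0).const_mul _).sub ((hi 1).const_mul _)
  rw [integral_sub i01 ((hi 2).const_mul _),
    integral_sub ((hi 0).const_mul _) ((hi 1).const_mul _), integral_const_mul, integral_const_mul,
    integral_const_mul, h1, h2]
  simp only [pow_zero, one_mul, he]
  rw [integral_exp_gaussianReal]
  push_cast
  linear_combination (-(a : ℂ) * t * Complex.exp (-(t:ℂ) ^ 2 / 2)) * Complex.I_sq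

/-! ### Local error of the time discretisation alone. -/

section

lemma one_le_norm_one_add {D : ℂ} (hD : 0 ≤ D.re) : 1 ≤ ‖1 + D‖ := by
  have := Complex.re_le_norm (1 + D)
  simp only [Complex.add_re, Complex.one_re] at this
  linarith

lemma norm_exp_sub_one_le_mul_exp (w : ℂ) : ‖Complex.exp w - 1‖ ≤ ‖w‖ * Real.exp ‖w‖ := by
  simpa using Complex.norm_exp_sub_sum_le_norm_mul_exp w 1

lemma norm_exp_sub_one_sub_le_mul_exp (w : ℂ) :
    ‖Complex.exp w - 1 - w‖ ≤ ‖w‖ ^ 2 * Real.exp ‖w‖ := by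
  have := Complex.norm_exp_sub_sum_le_norm_mul_exp w 2
  simpa [Finset.sum_range_succ, sub_sub] using this

/-- Third order Taylor bound for `exp (-i w)` on the whole real line. -/
lemma norm_exp_neg_I_mul_sub_le (w : ℝ) :
    ‖Complex.exp (-(Complex.I * w)) - (1 - Complex.I * w - (w : ℂ) ^ 2 / 2)‖ ≤ 4 * |w| ^ 3 := by
  have hn : ‖-(Complex.I * (w : ℂ))‖ = |w| := by simp
  rcases le_total |w| 1 with h | h
  · have h1 := Complex.norm_exp_sub_sum_le_norm_mul_exp (-(Complex.I * (w : ℂ))) 3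
    rw [hn] at h1
    have h2 : ∑ m ∈ Finset.range 3, (-(Complex.I * (w : ℂ))) ^ m / (m.factorial : ℂ) =
        1 - Complex.I * w - (w : ℂ) ^ 2 / 2 := by
      simp [Finset.sum_range_succ, mul_pow, Nat.factorial]
      ring
    rw [h2] at h1
    have h3 : Real.exp |w| ≤ 4 := by
      have := Real.exp_le_exp.2 h
      have := Real.exp_one_lt_d9
      linarith
    have h4 : 0 ≤ |w| ^ 3 := by positivity
    nlinarith
  · have h1 : ‖Complex.exp (-(Complex.I * w))‖ = 1 := by
      rw [Complex.norm_exp]; simp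
    have h2 : ‖1 - Complex.I * (w : ℂ) - (w : ℂ) ^ 2 / 2‖ ≤ 1 + |w| + |w| ^ 2 / 2 := by
      refine (norm_sub_le _ _).trans (add_le_add ((norm_sub_le _ _).trans ?_) ?_) <;> simp
    have h3 := norm_sub_le (Complex.exp (-(Complex.I * w))) (1 - Complex.I * (w : ℂ) - (w : ℂ) ^ 2 / 2)
    have h4 : |w| ≤ |w| ^ 3 := by nlinarith [sq_nonneg (|w|)]
    have h5 : |w| ^ 2 ≤ |w| ^ 3 := by nlinarith [sq_nonneg (|w|)]
    linarith

/-- Ratio of the amplification factor of the scheme to the one of the exact solution. -/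
noncomputable def stepRatio (t a c : ℝ) (D D₀ : ℂ) (z : ℝ) : ℂ :=
  stepNum a c z / (1 + D) * Complex.exp (D₀ - (t ^ 2 / 2 : ℝ) + Complex.I * (t * z : ℝ))

lemma continuous_stepRatio (t a c : ℝ) (D D₀ : ℂ) : Continuous (stepRatio t a c D D₀) := by
  have := continuous_stepNum a c
  unfold stepRatio
  fun_prop

/-- Leading part of the difference between two step ratios. -/
noncomputable def stepLin (t γ : ℝ) (Δ : ℂ) (z : ℝ) : ℂ :=
  Δ - (γ * t : ℝ) + Complex.I * (γ * z : ℝ)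

/-- Smallness conditions on the dimensionless parameters of a step. -/
structure StepBounds (K s y t a c γ : ℝ) (D D₀ Δ : ℂ) : Prop where
  one_le : 1 ≤ K
  s_nonneg : 0 ≤ s
  s_le : s ≤ 1
  y_nonneg : 0 ≤ y
  y_le : y ≤ 1
  t_le : |t| ≤ s
  D0_le : ‖D₀‖ ≤ K * s ^ 2
  re_D0 : 0 ≤ D₀.re
  re_D : 0 ≤ D.re
  D_sub : ‖D - D₀‖ ≤ K * (s ^ 2 * y)
  Δ_le : ‖Δ‖ ≤ K * (s ^ 2 * y)
  D_sub_add : ‖D - D₀ + Δ‖ ≤ K * (s ^ 2 * y ^ 2)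
  γ_le : |γ| ≤ K * (s * y)
  a_sub_add : |a - t + γ| ≤ K * (s * y ^ 2)
  c_sub : |c - t ^ 2 / 2| ≤ K * (s ^ 2 * y)

section

variable {K s y t a c γ : ℝ} {D D₀ Δ : ℂ}

/-- Consistency of the implicit Euler factor: the terms of order up to one in `D₀` cancel, and the
denominator has modulus at least 1 because `D₀` has nonnegative real part. -/
lemma norm_exp_div_sub_one_le (hD : ‖D₀‖ ≤ K * s ^ 2) (hre : 0 ≤ D₀.re) (hK : 1 ≤ K)
    (hs0 : 0 ≤ s) (hs1 : s ≤ 1) :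
    ‖Complex.exp D₀ / (1 + D₀) - 1‖ ≤ K ^ 2 * Real.exp K * s ^ 4 := by
  have h1 := one_le_norm_one_add hre
  have hne : 1 + D₀ ≠ 0 := norm_pos_iff.1 (by linarith)
  have hs2 : s ^ 2 ≤ 1 := pow_le_one₀ hs0 hs1
  have hDK : ‖D₀‖ ≤ K := hD.trans (by nlinarith)
  have e : Complex.exp D₀ / (1 + D₀) - 1 = (Complex.exp D₀ - 1 - D₀) / (1 + D₀) := by
    field_simp; ring
  rw [e, norm_div]
  calc _ ≤ ‖Complex.exp D₀ - 1 - D₀‖ := div_le_self (norm_nonneg _) h1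
    _ ≤ ‖D₀‖ ^ 2 * Real.exp ‖D₀‖ := norm_exp_sub_one_sub_le_mul_exp _
    _ ≤ (K * s ^ 2) ^ 2 * Real.exp K := by gcongr
    _ = _ := by ring

lemma abs_exp_neg_mul_taylor_sub_one_le {u : ℝ} (hu0 : 0 ≤ u) (hu1 : u ≤ 1) :
    |Real.exp (-u) * (1 + u + u ^ 2 / 2) - 1| ≤ u ^ 2 := by
  have h1 := Real.quadratic_le_exp_of_nonneg hu0
  have h2 := Real.add_one_le_exp (-u)
  have h3 : Real.exp (-u) * Real.exp u = 1 := by rw [← Real.exp_add]; simp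
  have h4 : Real.exp (-u) * (1 + u + u ^ 2 / 2) ≤ 1 :=
    (mul_le_mul_of_nonneg_left h1 (Real.exp_nonneg _)).trans_eq h3
  have h5 : (-u + 1) * (1 + u + u ^ 2 / 2) ≤ Real.exp (-u) * (1 + u + u ^ 2 / 2) := by gcongr
  rw [abs_le]
  constructor
  · nlinarith [mul_nonneg (sq_nonneg u) (sub_nonneg.2 hu1)]
  · nlinarith [sq_nonneg u]

lemma integral_stepRatio (t a c : ℝ) (D D₀ : ℂ) :
    ∫ z, stepRatio t a c D D₀ z ∂gaussianReal 0 1 =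
      Complex.exp (D₀ - (t ^ 2 : ℝ)) * ((1 + a * t + c * t ^ 2 : ℝ) : ℂ) / (1 + D) := by
  have : ∀ z, stepRatio t a c D D₀ z = (Complex.exp (D₀ - (t ^ 2 / 2 : ℝ)) / (1 + D)) *
      (stepNum a c z * Complex.exp (Complex.I * (t * z : ℝ))) := fun z => by
    rw [stepRatio, Complex.exp_add]; ring
  simp_rw [this]
  rw [integral_const_mul, integral_stepNum_mul_exp]
  have e : Complex.exp (D₀ - (t ^ 2 : ℝ)) =
      Complex.exp (D₀ - (t ^ 2 / 2 : ℝ)) * Complex.exp ((-t ^ 2 / 2 : ℝ) : ℂ) := by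
    rw [← Complex.exp_add]; congr 1; push_cast; ring
  rw [e]; ring

/-- The mean factors into exp(D₀)/(1 + D₀) and exp(-t²)(1 + t² + t⁴/2), each of which is 1 + O(s⁴).
This is one power of s better than the pointwise error. -/
lemma norm_integral_stepRatio_self_sub_one_le (hD : ‖D₀‖ ≤ K * s ^ 2) (hre : 0 ≤ D₀.re)
    (hK : 1 ≤ K) (hs0 : 0 ≤ s) (hs1 : s ≤ 1) (ht : |t| ≤ s) :
    ‖∫ z, stepRatio t t (t ^ 2 / 2) D₀ D₀ z ∂gaussianReal 0 1 - 1‖ ≤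
      (K ^ 2 * Real.exp K + 1) * s ^ 4 := by
  have ht2 : t ^ 2 ≤ s ^ 2 := by rw [← sq_abs t]; gcongr
  have hs2 : s ^ 2 ≤ 1 := pow_le_one₀ hs0 hs1
  have hA := norm_exp_div_sub_one_le hD hre hK hs0 hs1
  have hB := abs_exp_neg_mul_taylor_sub_one_le (sq_nonneg t) (ht2.trans hs2)
  set B : ℝ := Real.exp (-t ^ 2) * (1 + t ^ 2 + (t ^ 2) ^ 2 / 2) with hBdef
  have hB1 : |B| ≤ 1 := by
    have : 0 ≤ B := by positivity
    rw [abs_of_nonneg this, hBdef]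
    have h1 := Real.quadratic_le_exp_of_nonneg (sq_nonneg t)
    have h3 : Real.exp (-t ^ 2) * Real.exp (t ^ 2) = 1 := by rw [← Real.exp_add]; simp
    exact (mul_le_mul_of_nonneg_left h1 (Real.exp_nonneg _)).trans_eq h3
  have e : ∫ z, stepRatio t t (t ^ 2 / 2) D₀ D₀ z ∂gaussianReal 0 1 - 1 =
      (Complex.exp D₀ / (1 + D₀) - 1) * (B : ℂ) + ((B - 1 : ℝ) : ℂ) := by
    rw [integral_stepRatio, hBdef]
    push_cast
    rw [sub_eq_add_neg D₀, Complex.exp_add]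
    ring
  rw [e]
  have hB2 : |B - 1| ≤ s ^ 4 := hB.trans (by nlinarith [sq_nonneg t])
  calc _ ≤ ‖Complex.exp D₀ / (1 + D₀) - 1‖ * |B| + |B - 1| := by
        refine (norm_add_le _ _).trans ?_
        rw [norm_mul, Complex.norm_real, Complex.norm_real, Real.norm_eq_abs, Real.norm_eq_abs]
    _ ≤ K ^ 2 * Real.exp K * s ^ 4 * 1 + s ^ 4 := by gcongr
    _ = _ := by ring

/-- With w = tz and u = t²/2 the Milstein numerator is 1 - iw - w²/2 + u, which agrees with exp(u -
iw) up to terms of order s³. The bound grows only polynomially in z, so all Gaussian moments of it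
are finite. -/
lemma norm_stepNum_mul_exp_sub_one_le (hs0 : 0 ≤ s) (hs1 : s ≤ 1) (ht : |t| ≤ s) (z : ℝ) :
    ‖stepNum t (t ^ 2 / 2) z * Complex.exp (-(t ^ 2 / 2 : ℝ) + Complex.I * (t * z : ℝ)) - 1‖ ≤
      6 * (1 + |z|) ^ 3 * s ^ 3 := by
  set w : ℝ := t * z with hw
  have hp : 1 ≤ 1 + |z| := by linarith [abs_nonneg z]
  set p := 1 + |z| with hpdef
  have hwp : |w| ≤ s * p := by
    rw [hw, abs_mul]; gcongr; linarith
  have ht2 : t ^ 2 ≤ s ^ 2 := by rw [← sq_abs t]; gcongr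
  have hs2 : s ^ 2 ≤ 1 := pow_le_one₀ hs0 hs1
  set u : ℝ := t ^ 2 / 2 with hu
  have hu0 : 0 ≤ u := by positivity
  have hE : Complex.exp (-(Complex.I * w)) * Complex.exp (u : ℂ) *
      Complex.exp (-(u : ℂ) + Complex.I * w) = 1 := by
    rw [← Complex.exp_add, ← Complex.exp_add]; simp
  have hEn : ‖Complex.exp (-(u : ℂ) + Complex.I * w)‖ ≤ 1 := by
    rw [Complex.norm_exp, Real.exp_le_one_iff]; simp [hu0]
  -- Factoring out exp(-u + iw), of modulus at most 1, leaves Taylor remainders of exp(-iw) and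
  -- exp(u) taken separately; no exponential growth in z appears.
  have e : stepNum t u z * Complex.exp (-(u : ℂ) + Complex.I * w) - 1 =
      (-(Complex.exp (-(Complex.I * w)) - (1 - Complex.I * w - (w : ℂ) ^ 2 / 2)) +
        -(Complex.exp (-(Complex.I * w)) - 1) * u -
        Complex.exp (-(Complex.I * w)) * (Complex.exp u - 1 - u)) *
        Complex.exp (-(u : ℂ) + Complex.I * w) := by
    have : stepNum t u z = 1 - Complex.I * w - (w : ℂ) ^ 2 / 2 + u := by
      rw [stepNum, hu, hw]; push_cast; ring
    rw [this]
    linear_combination hE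
  rw [e, norm_mul]
  have h1 := norm_exp_neg_I_mul_sub_le w
  have h2 : ‖Complex.exp (-(Complex.I * w)) - 1‖ ≤ |w| := by
    have := @Real.norm_exp_I_mul_ofReal_sub_one_le (-w)
    simpa using this
  have h3 : ‖Complex.exp (u : ℂ) - 1 - u‖ ≤ u ^ 2 := by
    have hun : ‖(u : ℂ)‖ = u := by rw [Complex.norm_real, Real.norm_of_nonneg hu0]
    have := Complex.norm_exp_sub_one_sub_id_le (x := (u : ℂ)) (by rw [hun]; linarith)
    rwa [hun] at this
  have h4 : ‖Complex.exp (-(Complex.I * w))‖ = 1 := by rw [Complex.norm_exp]; simp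
  have hw3 : |w| ^ 3 ≤ (s * p) ^ 3 := by gcongr
  have hsp : s ^ 3 ≤ (s * p) ^ 3 := by gcongr; nlinarith
  have h5 : |w| * u ≤ (s * p) ^ 3 := by
    calc |w| * u ≤ (s * p) * (s * p) ^ 2 := by
          gcongr
          nlinarith [mul_nonneg hs0 hs0, mul_nonneg (mul_nonneg hs0 hs0) (by linarith : 0 ≤ p - 1)]
      _ = _ := by ring
  have h6 : u ^ 2 ≤ s ^ 3 := by
    have : u ≤ s ^ 2 := by nlinarith
    calc u ^ 2 ≤ (s ^ 2) ^ 2 := by gcongr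
      _ = s ^ 3 * s := by ring
      _ ≤ s ^ 3 * 1 := by gcongr
      _ = _ := by ring
  calc _ ≤ (4 * |w| ^ 3 + |w| * u + 1 * u ^ 2) * 1 := by
        gcongr
        refine (norm_sub_le _ _).trans (add_le_add ((norm_add_le _ _).trans (add_le_add ?_ ?_)) ?_)
        · rwa [norm_neg]
        · rw [norm_mul, norm_neg, Complex.norm_real, Real.norm_of_nonneg hu0]; gcongr
        · rw [norm_mul, h4]; gcongr
    _ ≤ 6 * (s * p) ^ 3 := by linarith
    _ = _ := by ring

lemma norm_stepRatio_self_sub_one_le (hD : ‖D₀‖ ≤ K * s ^ 2) (hre : 0 ≤ D₀.re)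
    (hK : 1 ≤ K) (hs0 : 0 ≤ s) (hs1 : s ≤ 1) (ht : |t| ≤ s) (z : ℝ) :
    ‖stepRatio t t (t ^ 2 / 2) D₀ D₀ z - 1‖ ≤
      (6 + 7 * (K ^ 2 * Real.exp K)) * s ^ 3 * (1 + |z|) ^ 3 := by
  have hA := norm_exp_div_sub_one_le hD hre hK hs0 hs1
  have hX := norm_stepNum_mul_exp_sub_one_le hs0 hs1 ht z
  set A := Complex.exp D₀ / (1 + D₀) with hAd
  set X := stepNum t (t ^ 2 / 2) z * Complex.exp (-(t ^ 2 / 2 : ℝ) + Complex.I * (t * z : ℝ)) with hXd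
  set M := K ^ 2 * Real.exp K
  have hM : 0 ≤ M := by positivity
  have e : stepRatio t t (t ^ 2 / 2) D₀ D₀ z - 1 = (A - 1) * (X - 1) + (X - 1) + (A - 1) := by
    have : stepRatio t t (t ^ 2 / 2) D₀ D₀ z = A * X := by
      rw [stepRatio, hAd, hXd, sub_add, sub_eq_add_neg D₀, Complex.exp_add, neg_sub,
        sub_eq_add_neg _ ((t ^ 2 / 2 : ℝ) : ℂ), add_comm (Complex.I * _)]
      ring
    rw [this]; ring
  have hs4 : s ^ 4 ≤ s ^ 3 := pow_le_pow_of_le_one hs0 hs1 (by norm_num)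
  have hs4' : s ^ 4 ≤ 1 := pow_le_one₀ hs0 hs1
  have hp : 1 ≤ (1 + |z|) ^ 3 := one_le_pow₀ (by linarith [abs_nonneg z])
  have hs3 : 0 ≤ s ^ 3 := by positivity
  rw [e]
  calc _ ≤ ‖A - 1‖ * ‖X - 1‖ + ‖X - 1‖ + ‖A - 1‖ := by
        rw [← norm_mul]
        exact (norm_add_le _ _).trans (add_le_add (norm_add_le _ _) le_rfl)
    _ ≤ M * 1 * (6 * (1 + |z|) ^ 3 * s ^ 3) + 6 * (1 + |z|) ^ 3 * s ^ 3 +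
        M * (s ^ 3 * (1 + |z|) ^ 3) := by
        gcongr
        · exact hA.trans (by gcongr)
        · exact hA.trans (by gcongr; nlinarith)
    _ = _ := by ring

end

end

/-! ### Effect of the space discretisation on one step. -/

section

section

variable {K s y t a c γ : ℝ} {D D₀ Δ : ℂ}

lemma StepBounds.norm_D_le (H : StepBounds K s y t a c γ D D₀ Δ) : ‖D‖ ≤ 2 * K * s ^ 2 := by
  have h1 := H.D_sub
  have h2 := H.D0_le
  have h3 : ‖D‖ ≤ ‖D - D₀‖ + ‖D₀‖ := by simpa using norm_add_le (D - D₀) D₀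
  have h4 : s ^ 2 * y ≤ s ^ 2 := by nlinarith [sq_nonneg s, H.y_le, H.y_nonneg]
  have : K * (s ^ 2 * y) ≤ K * s ^ 2 := by have := H.one_le; gcongr
  linarith

/-- The Milstein correction enters through `c` only, at order s²y, hence in the error and not in the
linear part. This is why both schemes share the same leading terms. -/
lemma StepBounds.norm_stepNum_sub_le (H : StepBounds K s y t a c γ D D₀ Δ) (z : ℝ) :
    ‖stepNum a c z - stepNum t (t ^ 2 / 2) z - Complex.I * (γ * z : ℝ)‖ ≤
      2 * K * (1 + |z|) ^ 2 * (s ^ 2 * y + s * y ^ 2) := by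
  have e : stepNum a c z - stepNum t (t ^ 2 / 2) z - Complex.I * (γ * z : ℝ) =
      ((-((z ^ 2 - 1) * (c - t ^ 2 / 2)) : ℝ) : ℂ) - Complex.I * (z * (a - t + γ) : ℝ) := by
    simp only [stepNum]; push_cast; ring
  rw [e]
  have hz := abs_nonneg z
  have hz2 : |z ^ 2 - 1| ≤ (1 + |z|) ^ 2 := by
    rw [abs_le]; constructor <;> nlinarith [sq_abs z]
  have hz1 : |z| ≤ (1 + |z|) ^ 2 := by nlinarith
  have hs := H.s_nonneg
  have hy := H.y_nonneg
  have hK := H.one_le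
  have hp : 0 ≤ K * (1 + |z|) ^ 2 * (s ^ 2 * y + s * y ^ 2) := by positivity
  calc _ ≤ |z ^ 2 - 1| * |c - t ^ 2 / 2| + |z| * |a - t + γ| := by
        refine (norm_sub_le _ _).trans_eq ?_
        rw [norm_mul, Complex.norm_I, Complex.norm_real, Complex.norm_real, norm_neg, norm_mul,
          norm_mul, one_mul]
        rfl
    _ ≤ (1 + |z|) ^ 2 * (K * (s ^ 2 * y)) + (1 + |z|) ^ 2 * (K * (s * y ^ 2)) := by
        gcongr
        · exact H.c_sub
        · exact H.a_sub_add
    _ ≤ _ := by linarith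

lemma norm_stepNum_self_le (hs1 : s ≤ 1) (ht : |t| ≤ s) (z : ℝ) :
    ‖stepNum t (t ^ 2 / 2) z‖ ≤ 3 * (1 + |z|) ^ 2 := by
  have hz := abs_nonneg z
  have hz2 : |z ^ 2 - 1| ≤ (1 + |z|) ^ 2 := by
    rw [abs_le]; constructor <;> nlinarith [sq_abs z]
  have ht2 : t ^ 2 ≤ 1 := by rw [← sq_abs t]; exact pow_le_one₀ (abs_nonneg t) (ht.trans hs1)
  have h1 : ‖stepNum t (t ^ 2 / 2) z‖ ≤ 1 + |z ^ 2 - 1| * (t ^ 2 / 2) + |z| * |t| := by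
    rw [stepNum]
    refine (norm_sub_le _ _).trans (add_le_add ?_ ?_)
    · rw [Complex.norm_real]
      refine (norm_sub_le _ _).trans ?_
      rw [norm_mul, Real.norm_eq_abs, Real.norm_eq_abs, Real.norm_eq_abs, abs_one,
        abs_of_nonneg (by positivity : 0 ≤ t ^ 2 / 2)]
    · rw [norm_mul, Complex.norm_I, Complex.norm_real, one_mul, norm_mul]; rfl
  have h2 : |z ^ 2 - 1| * (t ^ 2 / 2) ≤ (1 + |z|) ^ 2 * 1 := by gcongr; linarith
  have h3 : |z| * |t| ≤ |z| * 1 := by gcongr; linarith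
  nlinarith

lemma StepBounds.norm_stepLin_le (H : StepBounds K s y t a c γ D D₀ Δ) (z : ℝ) :
    ‖stepLin t γ Δ z‖ ≤ 3 * K * (s * y) * (1 + |z|) := by
  have hs := H.s_nonneg
  have hy := H.y_nonneg
  have hK := H.one_le
  have hz := abs_nonneg z
  have hsy : 0 ≤ K * (s * y) := by positivity
  have h1 : ‖stepLin t γ Δ z‖ ≤ ‖Δ‖ + |γ| * |t| + |γ| * |z| := by
    rw [stepLin]
    refine (norm_add_le _ _).trans (add_le_add ((norm_sub_le _ _).trans (add_le_add le_rfl ?_)) ?_)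
    · rw [Complex.norm_real, norm_mul]; rfl
    · rw [norm_mul, Complex.norm_I, Complex.norm_real, one_mul, norm_mul]; rfl
  have h2 : ‖Δ‖ ≤ K * (s * y) := H.Δ_le.trans (by
    gcongr; nlinarith [H.s_le])
  have h3 : |γ| * |t| ≤ K * (s * y) * 1 := by
    gcongr
    · exact H.γ_le
    · exact H.t_le.trans H.s_le
  have h4 : |γ| * |z| ≤ K * (s * y) * |z| := by gcongr; exact H.γ_le
  nlinarith [mul_nonneg hsy hz]

/-- Bracket in the difference of two step ratios, minus its linear part. -/
lemma StepBounds.norm_bracket_sub_le (H : StepBounds K s y t a c γ D D₀ Δ) (z : ℝ) :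
    ‖(stepNum a c z - stepNum t (t ^ 2 / 2) z) * (1 + D₀) - stepNum t (t ^ 2 / 2) z * (D - D₀)
      - stepLin t γ Δ z‖ ≤ 18 * K ^ 2 * (1 + |z|) ^ 2 * (s ^ 2 * y + s * y ^ 2) := by
  have hs := H.s_nonneg
  have hy := H.y_nonneg
  have hK := H.one_le
  have hs1 := H.s_le
  have hz := abs_nonneg z
  set p := 1 + |z| with hp
  have hp1 : 1 ≤ p := by linarith
  set n₁ := stepNum a c z
  set n₀ := stepNum t (t ^ 2 / 2) z
  set δ := n₁ - n₀ - Complex.I * (γ * z : ℝ) with hδ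
  have hδn : ‖δ‖ ≤ 2 * K * p ^ 2 * (s ^ 2 * y + s * y ^ 2) := H.norm_stepNum_sub_le z
  have hn₀ : ‖n₀‖ ≤ 3 * p ^ 2 := norm_stepNum_self_le hs1 H.t_le z
  -- The term γt is itself O(s²y) and is absorbed here. It belongs to `stepLin` only because of the
  -- mean.
  have e : (n₁ - n₀) * (1 + D₀) - n₀ * (D - D₀) - stepLin t γ Δ z =
      δ + δ * D₀ + Complex.I * (γ * z : ℝ) * D₀ - n₀ * (D - D₀) - Δ + (γ * t : ℝ) := by
    rw [hδ, stepLin]; ring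
  have hD1 : ‖D₀‖ ≤ K := H.D0_le.trans (by
    have : s ^ 2 ≤ 1 := pow_le_one₀ hs hs1
    nlinarith)
  set X := s ^ 2 * y + s * y ^ 2 with hX
  have hX0 : 0 ≤ X := by positivity
  have hsX : s ^ 2 * y ≤ X := by simp only [hX]; nlinarith [mul_nonneg hs (sq_nonneg y)]
  have b2 : ‖δ * D₀‖ ≤ 2 * K ^ 2 * p ^ 2 * X := by
    rw [norm_mul]
    calc _ ≤ (2 * K * p ^ 2 * X) * K := by gcongr
      _ = _ := by ring
  have b3 : ‖Complex.I * (γ * z : ℝ) * D₀‖ ≤ K ^ 2 * p ^ 2 * X := by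
    rw [norm_mul, norm_mul, Complex.norm_I, one_mul, Complex.norm_real, norm_mul]
    calc _ ≤ (K * (s * y) * p ^ 2) * (K * s ^ 2) := by
          gcongr
          · exact H.γ_le
          · rw [Real.norm_eq_abs]; nlinarith
          · exact H.D0_le
      _ = K ^ 2 * p ^ 2 * (s * (s ^ 2 * y)) := by ring
      _ ≤ K ^ 2 * p ^ 2 * (1 * X) := by gcongr
      _ = _ := by ring
  have b4 : ‖n₀ * (D - D₀)‖ ≤ 3 * K * p ^ 2 * X := by
    rw [norm_mul]
    calc _ ≤ (3 * p ^ 2) * (K * (s ^ 2 * y)) := by gcongr; exact H.D_sub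
      _ ≤ (3 * p ^ 2) * (K * X) := by gcongr
      _ = _ := by ring
  have b5 : ‖Δ‖ ≤ K * X := H.Δ_le.trans (by gcongr)
  have b6 : ‖((γ * t : ℝ) : ℂ)‖ ≤ K * X := by
    rw [Complex.norm_real, norm_mul]
    calc _ ≤ (K * (s * y)) * s := by
          gcongr
          · exact H.γ_le
          · exact H.t_le
      _ = K * (s ^ 2 * y) := by ring
      _ ≤ _ := by gcongr
  have hKX : K * X ≤ K ^ 2 * p ^ 2 * X := by
    have : 1 ≤ K * p ^ 2 := by nlinarith [one_le_pow₀ hp1 (n := 2)]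
    calc K * X = K * X * 1 := by ring
      _ ≤ K * X * (K * p ^ 2) := by gcongr
      _ = _ := by ring
  have hKX2 : K * p ^ 2 * X ≤ K ^ 2 * p ^ 2 * X := by gcongr; nlinarith
  rw [e]
  calc _ ≤ ‖δ‖ + ‖δ * D₀‖ + ‖Complex.I * (γ * z : ℝ) * D₀‖ + ‖n₀ * (D - D₀)‖ + ‖Δ‖ +
        ‖((γ * t : ℝ) : ℂ)‖ := by
        refine (norm_add_le _ _).trans (add_le_add ((norm_sub_le _ _).trans (add_le_add
          ((norm_sub_le _ _).trans (add_le_add ((norm_add_le _ _).trans (add_le_add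
          (norm_add_le _ _) le_rfl)) le_rfl)) le_rfl)) le_rfl)
    _ ≤ _ := by
        have hnn : 0 ≤ K ^ 2 * p ^ 2 * X := by positivity
        nlinarith

lemma StepBounds.norm_exp_sub_one_le (H : StepBounds K s y t a c γ D D₀ Δ) {u : ℝ}
    (hu : |u| ≤ s ^ 2) :
    ‖Complex.exp (D₀ - u) - 1‖ ≤ (K + 1) * Real.exp (K + 1) * s ^ 2 := by
  have hs2 : s ^ 2 ≤ 1 := pow_le_one₀ H.s_nonneg H.s_le
  have h1 : ‖D₀ - u‖ ≤ (K + 1) * s ^ 2 := by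
    refine (norm_sub_le _ _).trans ?_
    rw [Complex.norm_real, Real.norm_eq_abs]
    linarith [H.D0_le]
  have h2 : (K + 1) * s ^ 2 ≤ K + 1 := by nlinarith [H.one_le]
  have h0 : 0 ≤ (K + 1) * s ^ 2 := (norm_nonneg _).trans h1
  calc _ ≤ ‖D₀ - u‖ * Real.exp ‖D₀ - u‖ := norm_exp_sub_one_le_mul_exp _
    _ ≤ (K + 1) * s ^ 2 * Real.exp (K + 1) := by gcongr; linarith
    _ = _ := by ring

lemma StepBounds.norm_div_sub_one_le (H : StepBounds K s y t a c γ D D₀ Δ) {E : ℂ} :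
    ‖E / ((1 + D) * (1 + D₀)) - 1‖ ≤ ‖E - 1‖ + 5 * K ^ 2 * s ^ 2 := by
  have h1 := one_le_norm_one_add H.re_D
  have h2 := one_le_norm_one_add H.re_D0
  have n1 : 1 + D ≠ 0 := norm_pos_iff.1 (by linarith)
  have n2 : 1 + D₀ ≠ 0 := norm_pos_iff.1 (by linarith)
  have hs2 : s ^ 2 ≤ 1 := pow_le_one₀ H.s_nonneg H.s_le
  have hK := H.one_le
  have e : E / ((1 + D) * (1 + D₀)) - 1 = (E - 1 - (D + D₀ + D * D₀)) / ((1 + D) * (1 + D₀)) := by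
    field_simp; ring
  have h3 : 1 ≤ ‖(1 + D) * (1 + D₀)‖ := by rw [norm_mul]; nlinarith
  rw [e, norm_div]
  refine (div_le_self (norm_nonneg _) h3).trans ((norm_sub_le _ _).trans (add_le_add le_rfl ?_))
  have hD := H.norm_D_le
  have hD0 := H.D0_le
  calc _ ≤ ‖D‖ + ‖D₀‖ + ‖D‖ * ‖D₀‖ := by
        rw [← norm_mul]; exact (norm_add_le _ _).trans (add_le_add (norm_add_le _ _) le_rfl)
    _ ≤ 2 * K * s ^ 2 + K * s ^ 2 + 2 * K * s ^ 2 * (K * 1) := by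
        gcongr
        exact hD0.trans (by gcongr)
    _ ≤ _ := by nlinarith [mul_nonneg (sub_nonneg.2 hK) (sq_nonneg s), mul_nonneg (mul_nonneg (by linarith : 0 ≤ K) (sub_nonneg.2 hK)) (sq_nonneg s)]

/-- Over the common denominator the difference is a prefactor 1 + O(s(1 + |z|)) times a bracket
whose leading part is `stepLin`. -/
lemma StepBounds.stepRatio_sub (H : StepBounds K s y t a c γ D D₀ Δ) (z : ℝ) :
    stepRatio t a c D D₀ z - stepRatio t t (t ^ 2 / 2) D₀ D₀ z =
      Complex.exp (D₀ - (t ^ 2 / 2 : ℝ) + Complex.I * (t * z : ℝ)) / ((1 + D) * (1 + D₀)) *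
      ((stepNum a c z - stepNum t (t ^ 2 / 2) z) * (1 + D₀) -
        stepNum t (t ^ 2 / 2) z * (D - D₀)) := by
  have h1 := one_le_norm_one_add H.re_D
  have h2 := one_le_norm_one_add H.re_D0
  have n1 : 1 + D ≠ 0 := norm_pos_iff.1 (by linarith)
  have n2 : 1 + D₀ ≠ 0 := norm_pos_iff.1 (by linarith)
  simp only [stepRatio]
  field_simp
  ring

lemma exists_norm_stepRatio_sub_le (K : ℝ) : ∃ C, 0 ≤ C ∧ ∀ {s y t a c γ : ℝ} {D D₀ Δ : ℂ},
    StepBounds K s y t a c γ D D₀ Δ → ∀ z : ℝ,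
    ‖stepRatio t a c D D₀ z - stepRatio t t (t ^ 2 / 2) D₀ D₀ z - stepLin t γ Δ z‖ ≤
      C * (s ^ 2 * y + s * y ^ 2) * (1 + |z|) ^ 3 := by
  set M := (|K| + 1) * Real.exp (|K| + 1) with hM
  have hM0 : 0 ≤ M := by positivity
  refine ⟨(M + 1 + 5 * K ^ 2) * (39 * K ^ 2) + 18 * K ^ 2, by positivity, ?_⟩
  intro s y t a c γ D D₀ Δ H z
  have hs := H.s_nonneg
  have hy := H.y_nonneg
  have hK := H.one_le
  have hs1 := H.s_le
  have hy1 := H.y_le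
  have hz := abs_nonneg z
  have hBr := H.norm_bracket_sub_le z
  have hlin := H.norm_stepLin_le z
  rw [H.stepRatio_sub z]
  set Br := (stepNum a c z - stepNum t (t ^ 2 / 2) z) * (1 + D₀) -
        stepNum t (t ^ 2 / 2) z * (D - D₀)
  set E := Complex.exp (D₀ - (t ^ 2 / 2 : ℝ) + Complex.I * (t * z : ℝ)) with hE
  set p := 1 + |z| with hp
  have hp1 : 1 ≤ p := by linarith
  set X := s ^ 2 * y + s * y ^ 2 with hX
  have hX0 : 0 ≤ X := by positivity
  have hKabs : |K| = K := abs_of_nonneg (by linarith)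
  have hE1 : ‖E - 1‖ ≤ M * s ^ 2 + s * p := by
    have hu : |t ^ 2 / 2| ≤ s ^ 2 := by
      rw [abs_of_nonneg (by positivity)]
      have : t ^ 2 ≤ s ^ 2 := by rw [← sq_abs t]; gcongr; exact H.t_le
      nlinarith
    have h1 := H.norm_exp_sub_one_le hu
    have h2 := @Real.norm_exp_I_mul_ofReal_sub_one_le (t * z)
    have h3 : ‖Complex.exp (Complex.I * (t * z : ℝ))‖ = 1 := norm_exp_I_mul _
    have e : E - 1 = (Complex.exp (D₀ - (t ^ 2 / 2 : ℝ)) - 1) * Complex.exp (Complex.I * (t * z : ℝ)) +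
        (Complex.exp (Complex.I * (t * z : ℝ)) - 1) := by
      rw [hE, Complex.exp_add]; ring
    rw [e]
    refine (norm_add_le _ _).trans (add_le_add ?_ (h2.trans ?_))
    · rw [norm_mul, h3, mul_one, hM, hKabs]; exact h1
    · rw [norm_mul, Real.norm_eq_abs, Real.norm_eq_abs]
      gcongr
      · exact H.t_le
      · linarith
  have hQ : ‖E / ((1 + D) * (1 + D₀)) - 1‖ ≤ (M + 1 + 5 * K ^ 2) * (s * p) := by
    refine H.norm_div_sub_one_le.trans ?_
    have : s ^ 2 ≤ s * p := by nlinarith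
    have : (M + 5 * K ^ 2) * s ^ 2 ≤ (M + 5 * K ^ 2) * (s * p) := by gcongr
    linarith
  have hX2 : X ≤ 2 * (s * y) := by
    simp only [hX]
    nlinarith [mul_nonneg hs hy, mul_nonneg (mul_nonneg hs hy) (sub_nonneg.2 hs1),
      mul_nonneg (mul_nonneg hs hy) (sub_nonneg.2 hy1)]
  have hBr2 : ‖Br‖ ≤ 39 * K ^ 2 * p ^ 2 * (s * y) := by
    have h1 : ‖Br‖ ≤ ‖Br - stepLin t γ Δ z‖ + ‖stepLin t γ Δ z‖ := by
      simpa using norm_add_le (Br - stepLin t γ Δ z) (stepLin t γ Δ z)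
    have h2 : 18 * K ^ 2 * p ^ 2 * X ≤ 18 * K ^ 2 * p ^ 2 * (2 * (s * y)) := by gcongr
    have h3 : 3 * K * (s * y) * p ≤ 3 * K ^ 2 * (s * y) * p ^ 2 := by
      gcongr
      · nlinarith
      · nlinarith
    linarith
  have e : E / ((1 + D) * (1 + D₀)) * Br - stepLin t γ Δ z =
      (E / ((1 + D) * (1 + D₀)) - 1) * Br + (Br - stepLin t γ Δ z) := by ring
  rw [e]
  calc _ ≤ ‖E / ((1 + D) * (1 + D₀)) - 1‖ * ‖Br‖ + ‖Br - stepLin t γ Δ z‖ := by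
        rw [← norm_mul]; exact norm_add_le _ _
    _ ≤ ((M + 1 + 5 * K ^ 2) * (s * p)) * (39 * K ^ 2 * p ^ 2 * (s * y)) +
        18 * K ^ 2 * p ^ 2 * X := by gcongr
    _ = (M + 1 + 5 * K ^ 2) * (39 * K ^ 2) * (s ^ 2 * y) * p ^ 3 + 18 * K ^ 2 * X * p ^ 2 := by ring
    _ ≤ (M + 1 + 5 * K ^ 2) * (39 * K ^ 2) * X * p ^ 3 + 18 * K ^ 2 * X * p ^ 3 := by
        gcongr
        · simp only [hX]; nlinarith [mul_nonneg hs (sq_nonneg y)]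
        norm_num
    _ = _ := by ring

lemma integral_stepLin (t γ : ℝ) (Δ : ℂ) :
    ∫ z, stepLin t γ Δ z ∂gaussianReal 0 1 = Δ - (γ * t : ℝ) := by
  have hz : ∫ z : ℝ, (z : ℂ) ∂gaussianReal 0 1 = 0 := by
    rw [integral_complex_ofReal, integral_id_gaussianReal]; simp
  have hi : Integrable (fun z : ℝ => (z : ℂ)) (gaussianReal 0 1) :=
    integrable_gaussianReal_of_bound (C := 1) (n := 1) (by fun_prop) fun z => by simp
  have : ∀ z, stepLin t γ Δ z = (Δ - (γ * t : ℝ)) + (Complex.I * γ) * z := fun z => by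
    rw [stepLin]; push_cast; ring
  simp_rw [this]
  rw [integral_add (integrable_const _) (hi.const_mul _), integral_const_mul, hz]
  simp

set_option maxHeartbeats 1000000 in
-- The mean of the difference is closer to that of the linear part than the pointwise bound gives:
-- z² - 1 averages out, and the correlation of iγz with the phase itz has mean -γt, which is the
-- term built into `stepLin`. All contributions of order s²y then cancel.
lemma exists_norm_integral_stepRatio_sub_le (K : ℝ) :
    ∃ C, 0 ≤ C ∧ ∀ {s y t a c γ : ℝ} {D D₀ Δ : ℂ}, StepBounds K s y t a c γ D D₀ Δ →
    ‖∫ z, stepRatio t a c D D₀ z ∂gaussianReal 0 1 -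
      ∫ z, stepRatio t t (t ^ 2 / 2) D₀ D₀ z ∂gaussianReal 0 1 -
      ∫ z, stepLin t γ Δ z ∂gaussianReal 0 1‖ ≤ C * (s ^ 2 * y ^ 2 + s ^ 4 * y) := by
  set M := (|K| + 1) * Real.exp (|K| + 1) with hM
  have hM0 : 0 ≤ M := by positivity
  refine ⟨(M + 5 * K ^ 2) * (20 * K ^ 2) + 9 * K ^ 2, by positivity, ?_⟩
  intro s y t a c γ D D₀ Δ H
  have hs := H.s_nonneg
  have hy := H.y_nonneg
  have hK := H.one_le
  have hs1 := H.s_le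
  have hy1 := H.y_le
  have hs2 : s ^ 2 ≤ 1 := pow_le_one₀ hs hs1
  have hKabs : |K| = K := abs_of_nonneg (by linarith)
  have hts : t ^ 2 ≤ s ^ 2 := by rw [← sq_abs t]; gcongr; exact H.t_le
  have h1 := one_le_norm_one_add H.re_D
  have h2 := one_le_norm_one_add H.re_D0
  have n1 : 1 + D ≠ 0 := norm_pos_iff.1 (by linarith)
  have n2 : 1 + D₀ ≠ 0 := norm_pos_iff.1 (by linarith)
  rw [integral_stepRatio, integral_stepRatio, integral_stepLin]
  set E := Complex.exp (D₀ - (t ^ 2 : ℝ))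
  set n₀ : ℂ := ((1 + t * t + t ^ 2 / 2 * t ^ 2 : ℝ) : ℂ) with hn₀
  set dn : ℝ := (a - t) * t + (c - t ^ 2 / 2) * t ^ 2 with hdn
  set Br : ℂ := dn * (1 + D₀) - n₀ * (D - D₀) with hBr
  set Y := s ^ 2 * y ^ 2 + s ^ 4 * y with hY
  have hY0 : 0 ≤ Y := by positivity
  have e1 : E * ((1 + a * t + c * t ^ 2 : ℝ) : ℂ) / (1 + D) - E * n₀ / (1 + D₀) -
      (Δ - (γ * t : ℝ)) = (E / ((1 + D) * (1 + D₀)) - 1) * Br + (Br - (Δ - (γ * t : ℝ))) := by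
    have : ((1 + a * t + c * t ^ 2 : ℝ) : ℂ) = n₀ + dn := by
      rw [hn₀, hdn]; push_cast; ring
    rw [this, hBr]
    field_simp
    ring
  have hE1 : ‖E - 1‖ ≤ M * s ^ 2 := by
    rw [hM, hKabs]
    exact H.norm_exp_sub_one_le (by rwa [abs_of_nonneg (sq_nonneg t)])
  have hQ : ‖E / ((1 + D) * (1 + D₀)) - 1‖ ≤ (M + 5 * K ^ 2) * s ^ 2 := by
    refine H.norm_div_sub_one_le.trans ?_
    linarith
  have hs4 : s ^ 4 * y ≤ Y := by simp only [hY]; nlinarith [mul_nonneg (sq_nonneg s) (sq_nonneg y)]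
  have hsy : s ^ 2 * y ^ 2 ≤ Y := by
    have : 0 ≤ s ^ 4 * y := by positivity
    simp only [hY]; linarith
  have hct : |(c - t ^ 2 / 2) * t ^ 2| ≤ K * (s ^ 4 * y) := by
    rw [abs_mul, abs_of_nonneg (sq_nonneg t)]
    calc _ ≤ (K * (s ^ 2 * y)) * s ^ 2 := by gcongr; exact H.c_sub
      _ = _ := by ring
  have hγt : |γ * t| ≤ K * (s ^ 2 * y) := by
    rw [abs_mul]
    calc _ ≤ (K * (s * y)) * s := by
          gcongr
          · exact H.γ_le
          · exact H.t_le
      _ = _ := by ring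
  have hat : |(a - t + γ) * t| ≤ K * (s ^ 2 * y ^ 2) := by
    rw [abs_mul]
    calc _ ≤ (K * (s * y ^ 2)) * s := by
          gcongr
          · exact H.a_sub_add
          · exact H.t_le
      _ = _ := by ring
  have hs2y : s ^ 4 * y ≤ s ^ 2 * y := by
    calc s ^ 4 * y = s ^ 2 * (s ^ 2 * y) := by ring
      _ ≤ 1 * (s ^ 2 * y) := by gcongr
      _ = _ := by ring
  have hs2y2 : s ^ 2 * y ^ 2 ≤ s ^ 2 * y := by gcongr; nlinarith
  have hdn1 : |dn| ≤ 3 * K * (s ^ 2 * y) := by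
    have : dn = (a - t + γ) * t + (c - t ^ 2 / 2) * t ^ 2 - γ * t := by rw [hdn]; ring
    rw [this]
    refine ((abs_sub _ _).trans (add_le_add (abs_add_le _ _) le_rfl)).trans ?_
    have h5 : K * (s ^ 4 * y) ≤ K * (s ^ 2 * y) := by gcongr
    have h6 : K * (s ^ 2 * y ^ 2) ≤ K * (s ^ 2 * y) := by gcongr
    linarith
  have hn01 : ‖n₀ - 1‖ ≤ 2 * s ^ 2 := by
    have : n₀ - 1 = ((t ^ 2 + t ^ 2 / 2 * t ^ 2 : ℝ) : ℂ) := by rw [hn₀]; push_cast; ring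
    rw [this, Complex.norm_real, Real.norm_of_nonneg (by positivity)]
    nlinarith [mul_nonneg (sq_nonneg t) (sub_nonneg.2 (hts.trans hs2))]
  have hd0 : ‖(dn : ℂ) * D₀‖ ≤ 3 * K ^ 2 * Y := by
    rw [norm_mul, Complex.norm_real, Real.norm_eq_abs]
    calc _ ≤ (3 * K * (s ^ 2 * y)) * (K * s ^ 2) := by gcongr; exact H.D0_le
      _ = 3 * K ^ 2 * (s ^ 4 * y) := by ring
      _ ≤ _ := by gcongr
  have hn0D : ‖(n₀ - 1) * (D - D₀)‖ ≤ 2 * K * Y := by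
    rw [norm_mul]
    calc _ ≤ (2 * s ^ 2) * (K * (s ^ 2 * y)) := by gcongr; exact H.D_sub
      _ = 2 * K * (s ^ 4 * y) := by ring
      _ ≤ _ := by gcongr
  have hK2 : K ≤ K ^ 2 := by nlinarith
  have hKY : K * Y ≤ K ^ 2 * Y := by gcongr
  have hBr1 : ‖Br - (Δ - (γ * t : ℝ))‖ ≤ 9 * K ^ 2 * Y := by
    have e : Br - (Δ - (γ * t : ℝ)) = (((a - t + γ) * t : ℝ) : ℂ) +
        (((c - t ^ 2 / 2) * t ^ 2 : ℝ) : ℂ) + (dn : ℂ) * D₀ - (n₀ - 1) * (D - D₀) -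
        (D - D₀ + Δ) := by
      rw [hBr, hdn]; push_cast; ring
    rw [e]
    calc _ ≤ |(a - t + γ) * t| + |(c - t ^ 2 / 2) * t ^ 2| + ‖(dn : ℂ) * D₀‖ +
          ‖(n₀ - 1) * (D - D₀)‖ + ‖D - D₀ + Δ‖ := by
          refine (norm_sub_le _ _).trans (add_le_add ((norm_sub_le _ _).trans (add_le_add
            ((norm_add_le _ _).trans (add_le_add ((norm_add_le _ _).trans ?_) le_rfl)) le_rfl))
            le_rfl)
          rw [Complex.norm_real, Complex.norm_real]; rfl
      _ ≤ K * Y + K * Y + 3 * K ^ 2 * Y + 2 * K * Y + K * Y := by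
          gcongr
          · exact hat.trans (by gcongr)
          · exact hct.trans (by gcongr)
          · exact H.D_sub_add.trans (by gcongr)
      _ ≤ _ := by nlinarith
  have hY2 : Y ≤ 2 * (s ^ 2 * y) := by simp only [hY]; linarith
  have hBr2 : ‖Br‖ ≤ 20 * K ^ 2 * (s ^ 2 * y) := by
    have h1 : ‖Br‖ ≤ ‖Br - (Δ - (γ * t : ℝ))‖ + ‖Δ - (γ * t : ℝ)‖ := by
      simpa using norm_add_le (Br - (Δ - (γ * t : ℝ))) (Δ - (γ * t : ℝ))
    have h2 : ‖Δ - (γ * t : ℝ)‖ ≤ K * (s ^ 2 * y) + K * (s ^ 2 * y) := by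
      refine (norm_sub_le _ _).trans (add_le_add H.Δ_le ?_)
      rwa [Complex.norm_real]
    have h3 : 9 * K ^ 2 * Y ≤ 9 * K ^ 2 * (2 * (s ^ 2 * y)) := by gcongr
    have h4 : K * (s ^ 2 * y) ≤ K ^ 2 * (s ^ 2 * y) := by gcongr
    linarith
  rw [e1]
  calc _ ≤ ‖E / ((1 + D) * (1 + D₀)) - 1‖ * ‖Br‖ + ‖Br - (Δ - (γ * t : ℝ))‖ := by
        rw [← norm_mul]; exact norm_add_le _ _
    _ ≤ ((M + 5 * K ^ 2) * s ^ 2) * (20 * K ^ 2 * (s ^ 2 * y)) + 9 * K ^ 2 * Y := by gcongr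
    _ = (M + 5 * K ^ 2) * (20 * K ^ 2) * (s ^ 4 * y) + 9 * K ^ 2 * Y := by ring
    _ ≤ (M + 5 * K ^ 2) * (20 * K ^ 2) * Y + 9 * K ^ 2 * Y := by gcongr
    _ = _ := by ring

end

end

/-! ### One-step moments, and sums and products of independent step errors. -/

section

lemma memLp_two_gaussianReal_of_bound {f : ℝ → ℂ} {C : ℝ} {n : ℕ} (hf : Continuous f)
    (hb : ∀ z, ‖f z‖ ≤ C * (1 + |z|) ^ n) : MemLp f 2 (gaussianReal 0 1) := by
  rw [memLp_two_iff_integrable_sq_norm hf.aestronglyMeasurable]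
  refine integrable_gaussianReal_of_bound (C := C ^ 2) (n := 2 * n) (by fun_prop) fun z => ?_
  rw [norm_pow, norm_norm]
  refine (pow_le_pow_left₀ (norm_nonneg _) (hb z) 2).trans_eq ?_
  ring

lemma integral_norm_sq_gaussianReal_le {f : ℝ → ℂ} {C : ℝ} {n : ℕ}
    (hb : ∀ z, ‖f z‖ ≤ C * (1 + |z|) ^ n) :
    ∫ z, ‖f z‖ ^ 2 ∂gaussianReal 0 1 ≤ C ^ 2 * ∫ z, (1 + |z|) ^ (2 * n) ∂gaussianReal 0 1 := by
  rw [← integral_const_mul]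
  refine integral_mono_of_nonneg (ae_of_all _ fun z => by positivity)
    ((integrable_one_add_abs_pow_gaussianReal _).const_mul _) (ae_of_all _ fun z => ?_)
  refine (pow_le_pow_left₀ (norm_nonneg _) (hb z) 2).trans_eq ?_
  ring

lemma continuous_stepLin (t γ : ℝ) (Δ : ℂ) : Continuous (stepLin t γ Δ) := by
  unfold stepLin; fun_prop

/-- Moments of the relative one-step errors, in terms of the dimensionless step parameters. -/
structure StepMoments (C s y t a c γ : ℝ) (D D₀ Δ : ℂ) : Prop where
  memLp_base : MemLp (fun z => stepRatio t t (t ^ 2 / 2) D₀ D₀ z - 1) 2 (gaussianReal 0 1)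
  memLp_full : MemLp (fun z => stepRatio t a c D D₀ z - 1) 2 (gaussianReal 0 1)
  memLp_diff : MemLp (fun z => stepRatio t a c D D₀ z - stepRatio t t (t ^ 2 / 2) D₀ D₀ z -
    stepLin t γ Δ z) 2 (gaussianReal 0 1)
  mean_base : ‖∫ z, (stepRatio t t (t ^ 2 / 2) D₀ D₀ z - 1) ∂gaussianReal 0 1‖ ≤ C * s ^ 4
  sq_base : ∫ z, ‖stepRatio t t (t ^ 2 / 2) D₀ D₀ z - 1‖ ^ 2 ∂gaussianReal 0 1 ≤ C * s ^ 6
  mean_full : ‖∫ z, (stepRatio t a c D D₀ z - 1) ∂gaussianReal 0 1‖ ≤ C * (s ^ 2 * (s ^ 2 + y))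
  sq_full : ∫ z, ‖stepRatio t a c D D₀ z - 1‖ ^ 2 ∂gaussianReal 0 1 ≤
    C * (s ^ 2 * (s ^ 2 + y) ^ 2)
  mean_diff : ‖∫ z, (stepRatio t a c D D₀ z - stepRatio t t (t ^ 2 / 2) D₀ D₀ z -
    stepLin t γ Δ z) ∂gaussianReal 0 1‖ ≤ C * (s ^ 2 * y ^ 2 + s ^ 4 * y)
  sq_diff : ∫ z, ‖stepRatio t a c D D₀ z - stepRatio t t (t ^ 2 / 2) D₀ D₀ z -
    stepLin t γ Δ z‖ ^ 2 ∂gaussianReal 0 1 ≤ C * (s ^ 2 * y + s * y ^ 2) ^ 2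

/-- The constant depends on `K` alone, so the bounds are uniform in the wave number, the mesh and
the time step. -/
lemma exists_stepMoments (K : ℝ) : ∃ C, 0 ≤ C ∧ ∀ {s y t a c γ : ℝ} {D D₀ Δ : ℂ},
    StepBounds K s y t a c γ D D₀ Δ → StepMoments C s y t a c γ D D₀ Δ := by
  obtain ⟨C₁, hC₁, h₁⟩ := exists_norm_stepRatio_sub_le K
  obtain ⟨C₂, hC₂, h₂⟩ := exists_norm_integral_stepRatio_sub_le K
  set B := K ^ 2 * Real.exp K
  have hB : 0 ≤ B := by positivity
  set G := ∫ z, (1 + |z|) ^ (2 * 3) ∂gaussianReal 0 1 with hG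
  have hG0 : 0 ≤ G := integral_nonneg fun z => by positivity
  set C₃ := 6 + 7 * B with hC₃
  have hC₃0 : 0 ≤ C₃ := by positivity
  set C₄ := C₃ + 2 * C₁ + 3 * |K| with hC₄
  refine ⟨(B + 1) + C₃ ^ 2 * G + (B + 1 + C₂ + 2 * |K|) + C₄ ^ 2 * G + C₂ + C₁ ^ 2 * G,
    by positivity, ?_⟩
  intro s y t a c γ D D₀ Δ H
  have hs := H.s_nonneg
  have hy := H.y_nonneg
  have hK := H.one_le
  have hs1 := H.s_le
  have hy1 := H.y_le
  have hKabs : |K| = K := abs_of_nonneg (by linarith)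
  have hs2 : s ^ 2 ≤ 1 := pow_le_one₀ hs hs1
  set Y := stepRatio t a c D D₀
  set Y₀ := stepRatio t t (t ^ 2 / 2) D₀ D₀
  set l := stepLin t γ Δ
  have cY : Continuous Y := continuous_stepRatio _ _ _ _ _
  have cY₀ : Continuous Y₀ := continuous_stepRatio _ _ _ _ _
  have cl : Continuous l := continuous_stepLin _ _ _
  have b₀ : ∀ z, ‖Y₀ z - 1‖ ≤ C₃ * s ^ 3 * (1 + |z|) ^ 3 := fun z =>
    norm_stepRatio_self_sub_one_le H.D0_le H.re_D0 hK hs hs1 H.t_le z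
  have b₁ : ∀ z, ‖Y z - Y₀ z - l z‖ ≤ C₁ * (s ^ 2 * y + s * y ^ 2) * (1 + |z|) ^ 3 := fun z =>
    h₁ H z
  have bl : ∀ z, ‖l z‖ ≤ 3 * K * (s * y) * (1 + |z|) ^ 3 := fun z =>
    (H.norm_stepLin_le z).trans (by
      have h : 1 ≤ 1 + |z| := by linarith [abs_nonneg z]
      gcongr
      exact le_self_pow₀ h (by norm_num))
  have b₂ : ∀ z, ‖Y z - 1‖ ≤ C₄ * (s * (s ^ 2 + y)) * (1 + |z|) ^ 3 := fun z => by
    have e : Y z - 1 = (Y z - Y₀ z - l z) + (Y₀ z - 1) + l z := by ring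
    rw [e]
    have hp : 0 ≤ (1 + |z|) ^ 3 := by positivity
    have q0 : 0 ≤ s * y := by positivity
    have q1 : s ^ 3 ≤ s * (s ^ 2 + y) := by nlinarith
    have q2 : s ^ 2 * y + s * y ^ 2 ≤ 2 * (s * (s ^ 2 + y)) := by
      nlinarith [mul_nonneg q0 (sub_nonneg.2 hs1), mul_nonneg q0 (sub_nonneg.2 hy1),
        pow_nonneg hs 3]
    have q3 : s * y ≤ s * (s ^ 2 + y) := by nlinarith [pow_nonneg hs 3]
    calc _ ≤ ‖Y z - Y₀ z - l z‖ + ‖Y₀ z - 1‖ + ‖l z‖ :=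
          (norm_add_le _ _).trans (add_le_add (norm_add_le _ _) le_rfl)
      _ ≤ C₁ * (2 * (s * (s ^ 2 + y))) * (1 + |z|) ^ 3 + C₃ * (s * (s ^ 2 + y)) * (1 + |z|) ^ 3 +
          3 * K * (s * (s ^ 2 + y)) * (1 + |z|) ^ 3 := by
          gcongr
          · exact (b₁ z).trans (by gcongr)
          · exact (b₀ z).trans (by gcongr)
          · exact (bl z).trans (by gcongr)
      _ = _ := by rw [hC₄, hKabs]; ring
  have m₀ : MemLp (fun z => Y₀ z - 1) 2 (gaussianReal 0 1) :=
    memLp_two_gaussianReal_of_bound (by fun_prop) b₀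
  have m₁ : MemLp (fun z => Y z - Y₀ z - l z) 2 (gaussianReal 0 1) :=
    memLp_two_gaussianReal_of_bound (by fun_prop) b₁
  have m₂ : MemLp (fun z => Y z - 1) 2 (gaussianReal 0 1) :=
    memLp_two_gaussianReal_of_bound (by fun_prop) b₂
  have ml : MemLp l 2 (gaussianReal 0 1) := memLp_two_gaussianReal_of_bound cl bl
  have i₀ : Integrable (fun z => Y₀ z - 1) (gaussianReal 0 1) := m₀.integrable (by norm_num)
  have i₁ : Integrable (fun z => Y z - Y₀ z - l z) (gaussianReal 0 1) := m₁.integrable (by norm_num)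
  have il : Integrable l (gaussianReal 0 1) := ml.integrable (by norm_num)
  have iY₀ : Integrable Y₀ (gaussianReal 0 1) := 
    (i₀.add (integrable_const 1)).congr (ae_of_all _ fun z => by simp)
  have iY : Integrable Y (gaussianReal 0 1) := 
    ((m₂.integrable (by norm_num)).add (integrable_const 1)).congr (ae_of_all _ fun z => by simp)
  have e₀ : ‖∫ z, (Y₀ z - 1) ∂gaussianReal 0 1‖ ≤ (B + 1) * s ^ 4 := by
    rw [integral_sub iY₀ (integrable_const _)]
    simpa using norm_integral_stepRatio_self_sub_one_le H.D0_le H.re_D0 hK hs hs1 H.t_le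
  have e₁ : ‖∫ z, (Y z - Y₀ z - l z) ∂gaussianReal 0 1‖ ≤ C₂ * (s ^ 2 * y ^ 2 + s ^ 4 * y) := by
    have iYY : Integrable (fun z => Y z - Y₀ z) (gaussianReal 0 1) := iY.sub iY₀
    rw [integral_sub iYY il, integral_sub iY iY₀]
    exact h₂ H
  have el : ‖∫ z, l z ∂gaussianReal 0 1‖ ≤ 2 * K * (s ^ 2 * y) := by
    rw [integral_stepLin]
    refine (norm_sub_le _ _).trans ?_
    have : ‖((γ * t : ℝ) : ℂ)‖ ≤ (K * (s * y)) * s := by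
      rw [Complex.norm_real, norm_mul]
      gcongr
      · exact H.γ_le
      · exact H.t_le
    linarith [H.Δ_le]
  have e₂ : ‖∫ z, (Y z - 1) ∂gaussianReal 0 1‖ ≤
      (B + 1 + C₂ + 2 * |K|) * (s ^ 2 * (s ^ 2 + y)) := by
    have e : ∀ z, Y z - 1 = (Y z - Y₀ z - l z) + (Y₀ z - 1) + l z := fun z => by ring
    simp_rw [e]
    have i₁₀ : Integrable (fun z => Y z - Y₀ z - l z + (Y₀ z - 1)) (gaussianReal 0 1) := i₁.add i₀
    rw [integral_add i₁₀ il, integral_add i₁ i₀]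
    · have q0 : 0 ≤ s ^ 2 * y := by positivity
      have q1 : s ^ 4 ≤ s ^ 2 * (s ^ 2 + y) := by nlinarith
      have q2 : s ^ 2 * y ^ 2 + s ^ 4 * y ≤ s ^ 2 * (s ^ 2 + y) := by
        have : s ^ 2 * y ^ 2 ≤ s ^ 2 * y := by gcongr; nlinarith
        have : s ^ 4 * y ≤ s ^ 4 * 1 := by gcongr
        nlinarith
      have q3 : s ^ 2 * y ≤ s ^ 2 * (s ^ 2 + y) := by nlinarith [pow_nonneg hs 4]
      calc _ ≤ ‖∫ z, (Y z - Y₀ z - l z) ∂gaussianReal 0 1‖ + ‖∫ z, (Y₀ z - 1) ∂gaussianReal 0 1‖ +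
            ‖∫ z, l z ∂gaussianReal 0 1‖ :=
            (norm_add_le _ _).trans (add_le_add (norm_add_le _ _) le_rfl)
        _ ≤ C₂ * (s ^ 2 * (s ^ 2 + y)) + (B + 1) * (s ^ 2 * (s ^ 2 + y)) +
            2 * K * (s ^ 2 * (s ^ 2 + y)) := by
            gcongr
            · exact e₁.trans (by gcongr)
            · exact e₀.trans (by gcongr)
            · exact el.trans (by gcongr)
        _ = _ := by rw [hKabs]; ring
  have hC₄0 : 0 ≤ C₄ := by positivity
  have n1 : 0 ≤ B + 1 := by positivity
  have n2 : 0 ≤ C₃ ^ 2 * G := by positivity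
  have n3 : 0 ≤ B + 1 + C₂ + 2 * |K| := by positivity
  have n4 : 0 ≤ C₄ ^ 2 * G := by positivity
  have n5 : 0 ≤ C₁ ^ 2 * G := by positivity
  set Ct := (B + 1) + C₃ ^ 2 * G + (B + 1 + C₂ + 2 * |K|) + C₄ ^ 2 * G + C₂ + C₁ ^ 2 * G with hCt
  have hk : ∀ {c x : ℝ}, c ≤ Ct → 0 ≤ x → c * x ≤ Ct * x := fun h hx =>
    mul_le_mul_of_nonneg_right h hx
  refine ⟨m₀, m₂, m₁, e₀.trans (hk (by linarith) (by positivity)),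
    (integral_norm_sq_gaussianReal_le b₀).trans ?_, e₂.trans (hk (by linarith) (by positivity)),
    (integral_norm_sq_gaussianReal_le b₂).trans ?_, e₁.trans (hk (by linarith) (by positivity)),
    (integral_norm_sq_gaussianReal_le b₁).trans ?_⟩
  · refine le_trans (le_of_eq ?_) (hk (c := C₃ ^ 2 * G) (by linarith) (by positivity)); ring
  · refine le_trans (le_of_eq ?_) (hk (c := C₄ ^ 2 * G) (by linarith) (by positivity)); ring
  · refine le_trans (le_of_eq ?_) (hk (c := C₁ ^ 2 * G) (by linarith) (by positivity)); ring

section IID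

variable {Ω : Type*} [MeasurableSpace Ω] {P : Measure Ω}
  {Z : ℕ → Ω → ℝ} {w : ℝ → ℂ}

/-- A sequence of independent standard normal random variables. -/
structure IsStdNormalSeq (Z : ℕ → Ω → ℝ) (P : Measure Ω) : Prop where
  measurable : ∀ n, Measurable (Z n)
  indep : iIndepFun Z P
  law : ∀ n, P.map (Z n) = gaussianReal 0 1

/-- `prodRem` and the partial sum are both functions of this pair, so one independence statement
covers every term in the recursion for `prodRem`. -/
lemma IsStdNormalSeq.indepFun_prod_sum (hZ : IsStdNormalSeq Z P) (hw : Measurable w) (n : ℕ) :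
    IndepFun (fun ω => (∏ m ∈ Finset.range n, (1 + w (Z m ω)), ∑ m ∈ Finset.range n, w (Z m ω)))
      (Z n) P := by
  have h := hZ.indep.indepFun_finset (Finset.range n) {n} (by simp) hZ.measurable
  let φ : ((Finset.range n) → ℝ) → ℂ × ℂ := fun v => (∏ m, (1 + w (v m)), ∑ m, w (v m))
  let ψ : (({n} : Finset ℕ) → ℝ) → ℝ := fun v => v ⟨n, by simp⟩
  have hφ : Measurable φ := by
    refine Measurable.prodMk ?_ ?_
    · exact Finset.measurable_prod _ fun i _ => by fun_prop
    · exact Finset.measurable_sum _ fun i _ => by fun_prop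
  have hψ : Measurable ψ := measurable_pi_apply _
  have := h.comp hφ hψ
  convert this using 1
  ext ω
  · simp only [φ, Function.comp]
    exact (Finset.prod_coe_sort (Finset.range n) (fun m => 1 + w (Z m ω))).symm
  · simp only [φ, Function.comp]
    exact (Finset.sum_coe_sort (Finset.range n) (fun m => w (Z m ω))).symm
  · rfl

lemma IsStdNormalSeq.integral_comp (hZ : IsStdNormalSeq Z P) {E : Type*} [NormedAddCommGroup E]
    [NormedSpace ℝ E] {f : ℝ → E} (hf : AEStronglyMeasurable f (gaussianReal 0 1)) (n : ℕ) :
    ∫ ω, f (Z n ω) ∂P = ∫ z, f z ∂gaussianReal 0 1 := by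
  rw [← hZ.law n, integral_map (hZ.measurable n).aemeasurable (by rwa [hZ.law n])]

lemma IsStdNormalSeq.memLp_comp (hZ : IsStdNormalSeq Z P) (hw : MemLp w 2 (gaussianReal 0 1))
    (n : ℕ) : MemLp (fun ω => w (Z n ω)) 2 P := by
  rw [← hZ.law n] at hw
  exact (memLp_map_measure_iff hw.1 (hZ.measurable n).aemeasurable).1 hw

lemma norm_add_sq_complex (u v : ℂ) :
    ‖u + v‖ ^ 2 = ‖u‖ ^ 2 + ‖v‖ ^ 2 + 2 * (u * conj v).re := by
  rw [← Complex.normSq_eq_norm_sq, ← Complex.normSq_eq_norm_sq, ← Complex.normSq_eq_norm_sq,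
    Complex.normSq_add]

lemma integral_norm_add_sq {u v : Ω → ℂ} (hu : MemLp u 2 P) (hv : MemLp v 2 P) :
    ∫ ω, ‖u ω + v ω‖ ^ 2 ∂P = ∫ ω, ‖u ω‖ ^ 2 ∂P + ∫ ω, ‖v ω‖ ^ 2 ∂P +
      2 * (∫ ω, u ω * conj (v ω) ∂P).re := by
  have iu := (memLp_two_iff_integrable_sq_norm hu.1).1 hu
  have iv := (memLp_two_iff_integrable_sq_norm hv.1).1 hv
  have iuv : Integrable (fun ω => u ω * conj (v ω)) P := hu.integrable_mul hv.star
  have e : (∫ ω, u ω * conj (v ω) ∂P).re = ∫ ω, (u ω * conj (v ω)).re ∂P :=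
    (integral_re iuv).symm
  have i3 : Integrable (fun ω => 2 * (u ω * conj (v ω)).re) P := iuv.re.const_mul 2
  simp_rw [norm_add_sq_complex]
  have iuv' : Integrable (fun ω => ‖u ω‖ ^ 2 + ‖v ω‖ ^ 2) P := iu.add iv
  rw [integral_add iuv' i3, integral_add iu iv, integral_const_mul, e]

lemma IsStdNormalSeq.memLp_sum (hZ : IsStdNormalSeq Z P) (hw : MemLp w 2 (gaussianReal 0 1))
    (n : ℕ) : MemLp (fun ω => ∑ m ∈ Finset.range n, w (Z m ω)) 2 P :=
  memLp_finsetSum _ fun m _ => hZ.memLp_comp hw m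

lemma IsStdNormalSeq.integral_sum (hZ : IsStdNormalSeq Z P) (hw : MemLp w 2 (gaussianReal 0 1))
    (n : ℕ) : ∫ ω, ∑ m ∈ Finset.range n, w (Z m ω) ∂P = n * ∫ z, w z ∂gaussianReal 0 1 := by
  have := hZ.indep.isProbabilityMeasure
  rw [integral_finsetSum _ fun m _ => (hZ.memLp_comp hw m).integrable (by norm_num)]
  simp_rw [hZ.integral_comp hw.1]
  simp

/-- Only the diagonal terms see the second moment; by independence each off-diagonal term is the
squared modulus of the mean. -/
lemma IsStdNormalSeq.integral_norm_sum_sq_le (hZ : IsStdNormalSeq Z P) (hwm : Measurable w)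
    (hw : MemLp w 2 (gaussianReal 0 1)) (n : ℕ) :
    ∫ ω, ‖∑ m ∈ Finset.range n, w (Z m ω)‖ ^ 2 ∂P ≤
      n * ∫ z, ‖w z‖ ^ 2 ∂gaussianReal 0 1 + n ^ 2 * ‖∫ z, w z ∂gaussianReal 0 1‖ ^ 2 := by
  have := hZ.indep.isProbabilityMeasure
  set d := ∫ z, w z ∂gaussianReal 0 1 with hd
  set q := ∫ z, ‖w z‖ ^ 2 ∂gaussianReal 0 1 with hq
  induction n with
  | zero => simp
  | succ n ih =>
    simp_rw [Finset.sum_range_succ]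
    rw [integral_norm_add_sq (hZ.memLp_sum hw n) (hZ.memLp_comp hw n)]
    have h1 : ∫ ω, ‖w (Z n ω)‖ ^ 2 ∂P = q :=
      hZ.integral_comp (f := fun z => ‖w z‖ ^ 2) (hw.1.norm.pow 2) n
    have hind : IndepFun (fun ω => ∑ m ∈ Finset.range n, w (Z m ω)) (fun ω => conj (w (Z n ω))) P :=
      (hZ.indepFun_prod_sum hwm n).comp measurable_snd
        ((Complex.continuous_conj.measurable.comp hwm))
    have h2 : ∫ ω, (∑ m ∈ Finset.range n, w (Z m ω)) * conj (w (Z n ω)) ∂P = n * d * conj d := by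
      rw [hind.integral_fun_mul_eq_mul_integral (hZ.memLp_sum hw n).1 (hZ.memLp_comp hw n).star.1,
        hZ.integral_sum hw, integral_conj, hZ.integral_comp hw.1]
    have h3 : ((n : ℂ) * d * conj d).re = n * ‖d‖ ^ 2 := by
      rw [mul_assoc, Complex.mul_conj, Complex.normSq_eq_norm_sq]
      norm_cast
    rw [h1, h2, h3]
    push_cast
    nlinarith [sq_nonneg ‖d‖]

/-- Second order remainder of a product of independent factors close to one. -/
noncomputable def prodRem (w : ℝ → ℂ) (z : ℕ → ℝ) (n : ℕ) : ℂ :=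
  ∏ m ∈ Finset.range n, (1 + w (z m)) - 1 - ∑ m ∈ Finset.range n, w (z m)

lemma prodRem_succ (w : ℝ → ℂ) (z : ℕ → ℝ) (n : ℕ) :
    prodRem w z (n + 1) =
      prodRem w z n * (1 + w (z n)) + (∑ m ∈ Finset.range n, w (z m)) * w (z n) := by
  simp only [prodRem, Finset.prod_range_succ, Finset.sum_range_succ]
  ring

lemma memLp_two_mul_of_indepFun {u v : Ω → ℂ} (hu : MemLp u 2 P) (hv : MemLp v 2 P)
    (h : IndepFun u v P) : MemLp (fun ω => u ω * v ω) 2 P := by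
  refine (memLp_two_iff_integrable_sq_norm (hu.1.mul hv.1)).2 ?_
  have iu := (memLp_two_iff_integrable_sq_norm hu.1).1 hu
  have iv := (memLp_two_iff_integrable_sq_norm hv.1).1 hv
  have := (h.comp (measurable_norm.pow_const 2) (measurable_norm.pow_const 2)).integrable_mul iu iv
  refine this.congr (ae_of_all _ fun ω => ?_)
  simp [mul_pow]

lemma integral_norm_mul_sq_of_indepFun {u v : Ω → ℂ} (hu : AEStronglyMeasurable u P)
    (hv : AEStronglyMeasurable v P) (h : IndepFun u v P) :
    ∫ ω, ‖u ω * v ω‖ ^ 2 ∂P = (∫ ω, ‖u ω‖ ^ 2 ∂P) * ∫ ω, ‖v ω‖ ^ 2 ∂P := by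
  have h2 : IndepFun (fun ω => ‖u ω‖ ^ 2) (fun ω => ‖v ω‖ ^ 2) P :=
    h.comp (measurable_norm.pow_const 2) (measurable_norm.pow_const 2)
  rw [← h2.integral_fun_mul_eq_mul_integral (hu.norm.pow 2) (hv.norm.pow 2)]
  simp [mul_pow]

set_option maxHeartbeats 1000000 in
-- Write R_{n+1} = R_n(1 + w) + S_n w with w independent of the past and S_n the partial sum.
-- Expanding the square gives E|R_{n+1}|² ≤ (1 + 3τ)E|R_n|² + 2τE|S_n|², and a discrete Gronwall
-- argument concludes.
lemma IsStdNormalSeq.integral_norm_prodRem_sq_le (hZ : IsStdNormalSeq Z P) (hwm : Measurable w)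
    (hw : MemLp w 2 (gaussianReal 0 1)) {d q τ : ℝ} (hd : ‖∫ z, w z ∂gaussianReal 0 1‖ ≤ d)
    (hq : ∫ z, ‖w z‖ ^ 2 ∂gaussianReal 0 1 ≤ q) (hτ : d + q ≤ τ) (N n : ℕ) (hn : n ≤ N) :
    MemLp (fun ω => prodRem w (fun m => Z m ω) n) 2 P ∧
    ∫ ω, ‖prodRem w (fun m => Z m ω) n‖ ^ 2 ∂P ≤
      n * (2 * τ * (N * q + N ^ 2 * d ^ 2)) * Real.exp (3 * τ * n) := by
  have := hZ.indep.isProbabilityMeasure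
  have hd0 : 0 ≤ d := (norm_nonneg _).trans hd
  have hq0 : 0 ≤ q := (integral_nonneg fun z => by positivity).trans hq
  have hτ0 : 0 ≤ τ := by linarith
  induction n with
  | zero => simp [prodRem]
  | succ n ih =>
    obtain ⟨mR, ihR⟩ := ih (by omega)
    set R : Ω → ℂ := fun ω => prodRem w (fun m => Z m ω) n with hR
    set S : Ω → ℂ := fun ω => ∑ m ∈ Finset.range n, w (Z m ω) with hS
    have mS : MemLp S 2 P := hZ.memLp_sum hw n
    have hc1 : MemLp (fun _ : ℝ => (1 : ℂ)) 2 (gaussianReal 0 1) := memLp_const 1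
    have hw1 : MemLp (fun z => 1 + w z) 2 (gaussianReal 0 1) := hc1.add hw
    have hind := hZ.indepFun_prod_sum hwm n
    have hφ : Measurable fun x : ℂ × ℂ => (x.1 - 1 - x.2, x.2) :=
      ((measurable_fst.sub_const 1).sub measurable_snd).prodMk measurable_snd
    have hRS : IndepFun (fun ω => (R ω, S ω)) (Z n) P := hind.comp hφ measurable_id
    have hRi : IndepFun R (fun ω => 1 + w (Z n ω)) P :=
      hRS.comp measurable_fst (hwm.const_add 1)
    have hSi : IndepFun S (fun ω => w (Z n ω)) P := hRS.comp measurable_snd hwm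
    have hconj : Measurable (fun z : ℂ => conj z) := Complex.continuous_conj.measurable
    have hφ' : Measurable fun x : ℂ × ℂ => x.1 * conj x.2 :=
      measurable_fst.mul (hconj.comp measurable_snd)
    have hψ' : Measurable fun z => (1 + w z) * conj (w z) :=
      (hwm.const_add 1).mul (hconj.comp hwm)
    have hcross : IndepFun (fun ω => R ω * conj (S ω))
        (fun ω => (1 + w (Z n ω)) * conj (w (Z n ω))) P := hRS.comp hφ' hψ'
    have m1 := memLp_two_mul_of_indepFun mR (hZ.memLp_comp hw1 n) hRi
    have m2 := memLp_two_mul_of_indepFun mS (hZ.memLp_comp hw n) hSi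
    simp_rw [prodRem_succ]
    refine ⟨m1.add m2, ?_⟩
    change ∫ ω, ‖R ω * (1 + w (Z n ω)) + S ω * w (Z n ω)‖ ^ 2 ∂P ≤ _
    rw [integral_norm_add_sq m1 m2]
    have e1 : ∫ ω, ‖R ω * (1 + w (Z n ω))‖ ^ 2 ∂P =
        (∫ ω, ‖R ω‖ ^ 2 ∂P) * ∫ z, ‖1 + w z‖ ^ 2 ∂gaussianReal 0 1 := by
      rw [integral_norm_mul_sq_of_indepFun mR.1 (hZ.memLp_comp hw1 n).1 hRi,
        hZ.integral_comp (f := fun z => ‖1 + w z‖ ^ 2) (hw1.1.norm.pow 2) n]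
    have e2 : ∫ ω, ‖S ω * w (Z n ω)‖ ^ 2 ∂P =
        (∫ ω, ‖S ω‖ ^ 2 ∂P) * ∫ z, ‖w z‖ ^ 2 ∂gaussianReal 0 1 := by
      rw [integral_norm_mul_sq_of_indepFun mS.1 (hZ.memLp_comp hw n).1 hSi,
        hZ.integral_comp (f := fun z => ‖w z‖ ^ 2) (hw.1.norm.pow 2) n]
    have i1 : Integrable w (gaussianReal 0 1) := hw.integrable (by norm_num)
    have i2 := (memLp_two_iff_integrable_sq_norm hw.1).1 hw
    have e3 : ∫ ω, R ω * (1 + w (Z n ω)) * conj (S ω * w (Z n ω)) ∂P =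
        (∫ ω, R ω * conj (S ω) ∂P) * ∫ z, (1 + w z) * conj (w z) ∂gaussianReal 0 1 := by
      rw [← hZ.integral_comp (f := fun z => (1 + w z) * conj (w z)) (hw1.1.mul hw.star.1) n,
        ← hcross.integral_fun_mul_eq_mul_integral (mR.1.mul mS.star.1)
          ((hZ.memLp_comp hw1 n).1.mul (hZ.memLp_comp hw n).star.1)]
      congr 1; ext ω; rw [map_mul]; ring
    have f1 : ∫ z, ‖1 + w z‖ ^ 2 ∂gaussianReal 0 1 ≤ 1 + 2 * τ := by
      rw [integral_norm_add_sq hc1 hw]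
      have : (∫ z, (1 : ℂ) * conj (w z) ∂gaussianReal 0 1).re ≤ d := by
        simp_rw [one_mul]
        rw [integral_conj]
        refine (Complex.re_le_norm _).trans ?_
        rwa [Complex.norm_conj]
      simp only [norm_one, one_pow, integral_const, probReal_univ, one_smul]
      linarith
    have f3 : ‖∫ z, (1 + w z) * conj (w z) ∂gaussianReal 0 1‖ ≤ τ := by
      have : ∀ z, (1 + w z) * conj (w z) = conj (w z) + ((‖w z‖ ^ 2 : ℝ) : ℂ) := fun z => by
        rw [add_mul, one_mul, Complex.mul_conj, Complex.normSq_eq_norm_sq]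
      simp_rw [this]
      have i3 : Integrable (fun z => conj (w z)) (gaussianReal 0 1) :=
        hw.star.integrable (by norm_num)
      have i4 : Integrable (fun z => ((‖w z‖ ^ 2 : ℝ) : ℂ)) (gaussianReal 0 1) := i2.ofReal
      rw [integral_add i3 i4, integral_conj,
        integral_complex_ofReal]
      refine (norm_add_le _ _).trans ?_
      rw [Complex.norm_conj, Complex.norm_real,
        Real.norm_of_nonneg (integral_nonneg fun z => by positivity)]
      linarith
    have iR := (memLp_two_iff_integrable_sq_norm mR.1).1 mR
    have iS := (memLp_two_iff_integrable_sq_norm mS.1).1 mS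
    -- This crude treatment of the cross term leads to (k + h²)³ for the second moment, which is
    -- still o((k + h²)²).
    have f4 : 2 * ‖∫ ω, R ω * conj (S ω) ∂P‖ ≤ ∫ ω, ‖R ω‖ ^ 2 ∂P + ∫ ω, ‖S ω‖ ^ 2 ∂P := by
      rw [← integral_add iR iS]
      refine (mul_le_mul_of_nonneg_left (norm_integral_le_integral_norm _) zero_le_two).trans ?_
      rw [← integral_const_mul]
      refine integral_mono_of_nonneg (ae_of_all _ fun ω => by positivity) (iR.add iS)
        (ae_of_all _ fun ω => ?_)
      simp only [norm_mul, Complex.norm_conj]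
      nlinarith [sq_nonneg (‖R ω‖ - ‖S ω‖)]
    set ρ := ∫ ω, ‖R ω‖ ^ 2 ∂P with hρ
    set σ := ∫ ω, ‖S ω‖ ^ 2 ∂P with hσ
    have hρ0 : 0 ≤ ρ := integral_nonneg fun ω => by positivity
    have hσ0 : 0 ≤ σ := integral_nonneg fun ω => by positivity
    have hσ1 : σ ≤ N * q + N ^ 2 * d ^ 2 := by
      refine (hZ.integral_norm_sum_sq_le hwm hw n).trans ?_
      have : (n : ℝ) ≤ N := by exact_mod_cast (by omega : n ≤ N)
      have : (0 : ℝ) ≤ ∫ z, ‖w z‖ ^ 2 ∂gaussianReal 0 1 := integral_nonneg fun z => by positivity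
      gcongr
    set W := N * q + N ^ 2 * d ^ 2 with hW
    have hW0 : 0 ≤ W := by positivity
    have key : ∫ ω, ‖R ω * (1 + w (Z n ω))‖ ^ 2 ∂P + ∫ ω, ‖S ω * w (Z n ω)‖ ^ 2 ∂P +
        2 * (∫ ω, R ω * (1 + w (Z n ω)) * conj (S ω * w (Z n ω)) ∂P).re ≤
        ρ * (1 + 3 * τ) + 2 * τ * W := by
      rw [e1, e2, e3]
      have g1 : 2 * ((∫ ω, R ω * conj (S ω) ∂P) *
          ∫ z, (1 + w z) * conj (w z) ∂gaussianReal 0 1).re ≤ (ρ + σ) * τ := by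
        calc _ ≤ 2 * (‖∫ ω, R ω * conj (S ω) ∂P‖ *
            ‖∫ z, (1 + w z) * conj (w z) ∂gaussianReal 0 1‖) := by
              gcongr; rw [← norm_mul]; exact Complex.re_le_norm _
          _ = (2 * ‖∫ ω, R ω * conj (S ω) ∂P‖) *
            ‖∫ z, (1 + w z) * conj (w z) ∂gaussianReal 0 1‖ := by ring
          _ ≤ _ := by gcongr
      have g2 : ρ * ∫ z, ‖1 + w z‖ ^ 2 ∂gaussianReal 0 1 ≤ ρ * (1 + 2 * τ) := by gcongr
      have g3 : σ * ∫ z, ‖w z‖ ^ 2 ∂gaussianReal 0 1 ≤ σ * τ := by gcongr; linarith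
      have g4 : σ * τ ≤ W * τ := by gcongr
      linarith
    refine key.trans ?_
    have hexp : 1 + 3 * τ ≤ Real.exp (3 * τ) := by linarith [Real.add_one_le_exp (3 * τ)]
    have hA0 : 0 ≤ 2 * τ * W := by positivity
    have he : Real.exp (3 * τ * ((n + 1 : ℕ) : ℝ)) = Real.exp (3 * τ * n) * Real.exp (3 * τ) := by
      rw [← Real.exp_add]; congr 1; push_cast; ring
    have h1e : 1 ≤ Real.exp (3 * τ * ((n + 1 : ℕ) : ℝ)) := Real.one_le_exp (by positivity)
    calc ρ * (1 + 3 * τ) + 2 * τ * W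
        ≤ (n * (2 * τ * W) * Real.exp (3 * τ * n)) * Real.exp (3 * τ) +
          2 * τ * W * Real.exp (3 * τ * ((n + 1 : ℕ) : ℝ)) := by
          refine add_le_add ?_ (le_mul_of_one_le_right hA0 h1e)
          gcongr
      _ = _ := by rw [he]; push_cast; ring

lemma IsStdNormalSeq.lintegral_prod_enorm_sq (hZ : IsStdNormalSeq Z P) {g : ℝ → ℂ}
    (hg : Measurable g) (N : ℕ) :
    ∫⁻ ω, ‖∏ m ∈ Finset.range N, g (Z m ω)‖ₑ ^ 2 ∂P =
      (∫⁻ z, ‖g z‖ₑ ^ 2 ∂gaussianReal 0 1) ^ N := by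
  have hm : Measurable fun z => ‖g z‖ₑ ^ 2 := hg.enorm.pow_const 2
  have h := lintegral_prod_eq_prod_lintegral_of_indepFun (μ := P) (Finset.range N)
    (fun m ω => ‖g (Z m ω)‖ₑ ^ 2) (hZ.indep.comp (fun _ z => ‖g z‖ₑ ^ 2) fun _ => hm)
    (fun m => hm.comp (hZ.measurable m))
  have e : ∀ ω, ‖∏ m ∈ Finset.range N, g (Z m ω)‖ₑ ^ 2 = ∏ m ∈ Finset.range N, ‖g (Z m ω)‖ₑ ^ 2 :=
    fun ω => by
      rw [Finset.prod_pow]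
      congr 1
      simp [← ofReal_norm, norm_prod, ENNReal.ofReal_prod_of_nonneg]
  simp_rw [e]
  rw [h, Finset.prod_congr rfl (fun m _ => ?_), Finset.prod_const, Finset.card_range]
  rw [← hZ.law m, lintegral_map hm (hZ.measurable m)]

end IID

end

/-! ### Moments of random Fourier integrals. -/

section

lemma sq_lintegral_le {α : Type*} [MeasurableSpace α] {ν : Measure α} {f : α → ℂ} {κ : α → ℝ≥0∞}
    (hf : AEMeasurable f ν) (hκ : AEMeasurable κ ν) (h0 : ∀ x, κ x ≠ 0) (htop : ∀ x, κ x ≠ ∞) :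
    (∫⁻ x, ‖f x‖ₑ ∂ν) ^ 2 ≤ (∫⁻ x, κ x ∂ν) * ∫⁻ x, (κ x)⁻¹ * ‖f x‖ₑ ^ 2 ∂ν := by
  have h := ENNReal.lintegral_mul_norm_pow_le (μ := ν) (f := κ)
    (g := fun x => (κ x)⁻¹ * ‖f x‖ₑ ^ 2) hκ
    (hκ.inv.mul (hf.enorm.pow_const 2)) (p := 1 / 2) (q := 1 / 2) (by norm_num) (by norm_num)
    (by norm_num)
  have e : ∀ x, κ x ^ (1 / 2 : ℝ) * ((κ x)⁻¹ * ‖f x‖ₑ ^ 2) ^ (1 / 2 : ℝ) = ‖f x‖ₑ := fun x => by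
    rw [← ENNReal.mul_rpow_of_nonneg _ _ (by norm_num), ← mul_assoc,
      ENNReal.mul_inv_cancel (h0 x) (htop x), one_mul, ← ENNReal.rpow_natCast,
      ← ENNReal.rpow_mul]
    norm_num
  simp_rw [e] at h
  calc _ ≤ ((∫⁻ x, κ x ∂ν) ^ (1 / 2 : ℝ) * (∫⁻ x, (κ x)⁻¹ * ‖f x‖ₑ ^ 2 ∂ν) ^ (1 / 2 : ℝ)) ^ 2 := by
        gcongr
    _ = _ := by
      rw [← ENNReal.mul_rpow_of_nonneg _ _ (by norm_num), ← ENNReal.rpow_natCast,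
        ← ENNReal.rpow_mul]
      norm_num

variable {Ω : Type*} [MeasurableSpace Ω] {P : Measure Ω} [IsProbabilityMeasure P]

/-- Weighted Cauchy–Schwarz in ξ, then Tonelli: second moments at each single ξ suffice, and no
cancellation between wave numbers is used. -/
lemma lintegral_sq_integral_le {F : ℝ → Ω → ℂ} (hF : Measurable (Function.uncurry F))
    {κ : ℝ → ℝ≥0∞} (hκ : Measurable κ) (h0 : ∀ x, κ x ≠ 0) (htop : ∀ x, κ x ≠ ∞)
    {G : ℝ → ℝ≥0∞} (hG : ∀ ξ, ∫⁻ ω, ‖F ξ ω‖ₑ ^ 2 ∂P ≤ G ξ) :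
    ∫⁻ ω, ‖∫ ξ, F ξ ω‖ₑ ^ 2 ∂P ≤ (∫⁻ ξ, κ ξ) * ∫⁻ ξ, (κ ξ)⁻¹ * G ξ := by
  have hm : Measurable fun p : Ω × ℝ => (κ p.2)⁻¹ * ‖F p.2 p.1‖ₑ ^ 2 :=
    (hκ.comp measurable_snd).inv.mul ((hF.comp measurable_swap).enorm.pow_const 2)
  have hm2 : Measurable fun ω => ∫⁻ ξ, (κ ξ)⁻¹ * ‖F ξ ω‖ₑ ^ 2 := hm.lintegral_prod_right'
  calc _ ≤ ∫⁻ ω, ((∫⁻ ξ, κ ξ) * (∫⁻ ξ, (κ ξ)⁻¹ * ‖F ξ ω‖ₑ ^ 2)) ∂P := by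
        refine lintegral_mono fun ω => ?_
        refine le_trans ?_ (sq_lintegral_le (f := fun ξ => F ξ ω) ?_ hκ.aemeasurable h0 htop)
        · gcongr
          exact enorm_integral_le_lintegral_enorm _
        · exact (hF.comp measurable_prodMk_right).aemeasurable
    _ = (∫⁻ ξ, κ ξ) * ∫⁻ ω, (∫⁻ ξ, (κ ξ)⁻¹ * ‖F ξ ω‖ₑ ^ 2) ∂P := lintegral_const_mul _ hm2
    _ = (∫⁻ ξ, κ ξ) * ∫⁻ ξ, (∫⁻ ω, (κ ξ)⁻¹ * ‖F ξ ω‖ₑ ^ 2 ∂P) := by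
        rw [lintegral_lintegral_swap hm.aemeasurable]
    _ ≤ _ := by
        gcongr with ξ
        have hFm : Measurable fun ω => ‖F ξ ω‖ₑ ^ 2 :=
          (hF.comp measurable_prodMk_left).enorm.pow_const 2
        rw [lintegral_const_mul _ hFm]
        gcongr
        exact hG ξ

/-- Uniform moment bounds for random Fourier integrals. -/
lemma hasBoundedMoments_of_fourier {ι : Type*} {E : ι → Ω → ℝ} {F : ι → ℝ → Ω → ℂ}
    (hE : ∀ i ω, E i ω = 1 / (2 * Real.pi) * (∫ ξ, F i ξ ω).re)
    (hF : ∀ i, Measurable (Function.uncurry (F i))) {κ : ι → ℝ → ℝ≥0∞}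
    (hκ : ∀ i, Measurable (κ i)) (h0 : ∀ i x, κ i x ≠ 0) (htop : ∀ i x, κ i x ≠ ∞)
    {G : ι → ℝ → ℝ≥0∞} (hG : ∀ i ξ, ∫⁻ ω, ‖F i ξ ω‖ₑ ^ 2 ∂P ≤ G i ξ) {B : ℝ≥0∞} (hB : B ≠ ∞)
    (hb : ∀ i, (∫⁻ ξ, κ i ξ) * ∫⁻ ξ, (κ i ξ)⁻¹ * G i ξ ≤ B) : HasBoundedMoments P E := by
  refine ⟨B.toReal + 1, fun i => ?_⟩
  have hm : StronglyMeasurable fun ω => ∫ ξ, F i ξ ω := by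
    have : StronglyMeasurable (Function.uncurry fun (ω : Ω) (ξ : ℝ) => F i ξ ω) :=
      ((hF i).comp measurable_swap).stronglyMeasurable
    exact this.integral_prod_right
  have hEm : Measurable (E i) := by
    rw [funext (hE i)]
    exact (Complex.measurable_re.comp hm.measurable).const_mul _
  have hle : ∀ ω, ‖E i ω‖ₑ ≤ ‖∫ ξ, F i ξ ω‖ₑ := fun ω => by
    rw [hE, enorm_le_iff_norm_le, norm_mul]
    have h1 : ‖1 / (2 * Real.pi)‖ ≤ 1 := by
      rw [Real.norm_of_nonneg (by positivity), div_le_one (by positivity)]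
      linarith [Real.pi_gt_three]
    calc _ ≤ 1 * ‖∫ ξ, F i ξ ω‖ := by
          gcongr
          exact Complex.abs_re_le_norm _
      _ = _ := one_mul _
  have hbound : ∫⁻ ω, ‖E i ω‖ₑ ^ 2 ∂P ≤ B :=
    (lintegral_mono fun ω => pow_le_pow_left' (hle ω) 2).trans
      ((lintegral_sq_integral_le (hF i) (hκ i) (h0 i) (htop i) (hG i)).trans (hb i))
  have hL : MemLp (E i) 2 P := by
    refine ⟨hEm.aestronglyMeasurable, ?_⟩
    rw [eLpNorm_lt_top_iff_lintegral_rpow_enorm_lt_top two_ne_zero ENNReal.ofNat_ne_top]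
    refine lt_of_le_of_lt ?_ (lt_of_le_of_lt hbound hB.lt_top)
    simp
  have hsq : ∫ ω, E i ω ^ 2 ∂P ≤ B.toReal := by
    rw [integral_eq_lintegral_of_nonneg_ae (ae_of_all _ fun ω => sq_nonneg _)
      (hEm.pow_const 2).aestronglyMeasurable]
    refine ENNReal.toReal_mono hB (le_trans (le_of_eq ?_) hbound)
    refine lintegral_congr fun ω => ?_
    rw [← ofReal_norm, ← ENNReal.ofReal_pow (norm_nonneg _), Real.norm_eq_abs, sq_abs]
  refine ⟨hL, ?_, hsq.trans (by linarith)⟩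
  have i2 := hL.integrable_sq
  calc |∫ ω, E i ω ∂P| ≤ ∫ ω, |E i ω| ∂P := abs_integral_le_integral_abs
    _ ≤ ∫ ω, (E i ω ^ 2 + 1) ∂P := by
        refine integral_mono_of_nonneg (ae_of_all _ fun ω => abs_nonneg _)
          (i2.add (integrable_const 1)) (ae_of_all _ fun ω => ?_)
        simp only
        nlinarith [sq_nonneg (|E i ω| - 1), sq_abs (E i ω), abs_nonneg (E i ω)]
    _ = ∫ ω, E i ω ^ 2 ∂P + 1 := by
        rw [integral_add i2 (integrable_const 1)]; simp
    _ ≤ _ := by linarith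

/-- Polynomially weighted Gaussian. -/
noncomputable def polyGauss (n : ℕ) (c ξ : ℝ) : ℝ := (1 + |ξ|) ^ n * Real.exp (-c * ξ ^ 2)

lemma polyGauss_nonneg (n : ℕ) (c ξ : ℝ) : 0 ≤ polyGauss n c ξ := by
  unfold polyGauss; positivity

lemma continuous_polyGauss (n : ℕ) (c : ℝ) : Continuous (polyGauss n c) := by
  unfold polyGauss; fun_prop

lemma integrable_polyGauss (n : ℕ) {c : ℝ} (hc : 0 < c) : Integrable (polyGauss n c) := by
  have hi := (integrable_exp_neg_mul_sq (half_pos hc)).const_mul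
    (n.factorial * Real.exp (1 + 1 / (2 * c)))
  refine hi.mono' (continuous_polyGauss n c).aestronglyMeasurable (ae_of_all _ fun ξ => ?_)
  rw [Real.norm_of_nonneg (polyGauss_nonneg n c ξ)]
  have h1 := Real.pow_div_factorial_le_exp (x := 1 + |ξ|) (by positivity) n
  rw [div_le_iff₀ (by positivity)] at h1
  -- By completing the square, half of the Gaussian decay pays for the polynomial weight.
  have h2 : 1 + |ξ| ≤ 1 + 1 / (2 * c) + c / 2 * ξ ^ 2 := by
    have : 0 ≤ (c * |ξ| - 1) ^ 2 / (2 * c) := by positivity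
    have e : (c * |ξ| - 1) ^ 2 / (2 * c) = c / 2 * ξ ^ 2 - |ξ| + 1 / (2 * c) := by
      rw [← sq_abs ξ]; field_simp; ring
    linarith
  calc polyGauss n c ξ ≤ Real.exp (1 + |ξ|) * n.factorial * Real.exp (-c * ξ ^ 2) := by
        unfold polyGauss; gcongr
    _ ≤ Real.exp (1 + 1 / (2 * c) + c / 2 * ξ ^ 2) * n.factorial * Real.exp (-c * ξ ^ 2) := by
        gcongr
    _ = n.factorial * Real.exp (1 + 1 / (2 * c)) * Real.exp (-(c / 2) * ξ ^ 2) := by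
        rw [Real.exp_add]
        have : Real.exp (c / 2 * ξ ^ 2) * Real.exp (-c * ξ ^ 2) = Real.exp (-(c / 2) * ξ ^ 2) := by
          rw [← Real.exp_add]; congr 1; ring
        rw [← this]; ring

/-- Moment bounds for random Fourier integrals with a Gaussian envelope. -/
lemma hasBoundedMoments_of_polyGauss {ι : Type*} {E : ι → Ω → ℝ} {F : ι → ℝ → Ω → ℂ}
    (hE : ∀ i ω, E i ω = 1 / (2 * Real.pi) * (∫ ξ, F i ξ ω).re)
    (hF : ∀ i, Measurable (Function.uncurry (F i))) {C c : ℝ} {n : ℕ} (hc : 0 < c)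
    (hG : ∀ i ξ, ∫⁻ ω, ‖F i ξ ω‖ₑ ^ 2 ∂P ≤ ENNReal.ofReal (C * polyGauss n c ξ)) :
    HasBoundedMoments P E := by
  refine hasBoundedMoments_of_fourier hE hF
    -- An integrable weight whose inverse grows only polynomially, so that the inverse is absorbed
    -- by two more powers of 1 + |ξ|.
    (κ := fun _ ξ => ENNReal.ofReal (1 + ξ ^ 2)⁻¹) (fun _ => by fun_prop)
    (fun _ x => by rw [ne_eq, ENNReal.ofReal_eq_zero, not_le]; positivity)
    (fun _ x => ENNReal.ofReal_ne_top)
    hG (B := (∫⁻ ξ : ℝ, ENNReal.ofReal (1 + ξ ^ 2)⁻¹) *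
      ∫⁻ ξ : ℝ, (ENNReal.ofReal (1 + ξ ^ 2)⁻¹)⁻¹ * ENNReal.ofReal (C * polyGauss n c ξ)) ?_
    fun _ => le_rfl
  refine ENNReal.mul_ne_top ?_ ?_
  · rw [← ofReal_integral_eq_lintegral_ofReal integrable_inv_one_add_sq
      (ae_of_all _ fun x => by positivity)]
    exact ENNReal.ofReal_ne_top
  · have hle : ∀ ξ : ℝ, (ENNReal.ofReal (1 + ξ ^ 2)⁻¹)⁻¹ * ENNReal.ofReal (C * polyGauss n c ξ) ≤
        ENNReal.ofReal (|C| * polyGauss (n + 2) c ξ) := fun ξ => by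
      rw [← ENNReal.ofReal_inv_of_pos (by positivity), inv_inv,
        ← ENNReal.ofReal_mul (by positivity)]
      refine ENNReal.ofReal_le_ofReal ?_
      have h1 : 1 + ξ ^ 2 ≤ (1 + |ξ|) ^ 2 := by nlinarith [abs_nonneg ξ, sq_abs ξ]
      have h2 : C * polyGauss n c ξ ≤ |C| * polyGauss n c ξ :=
        mul_le_mul_of_nonneg_right (le_abs_self C) (polyGauss_nonneg _ _ _)
      have h3 := polyGauss_nonneg n c ξ
      calc (1 + ξ ^ 2) * (C * polyGauss n c ξ) ≤ (1 + |ξ|) ^ 2 * (|C| * polyGauss n c ξ) := by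
            refine (mul_le_mul_of_nonneg_left h2 (by positivity)).trans ?_
            gcongr
        _ = _ := by unfold polyGauss; ring
    refine ne_top_of_le_ne_top ?_ (lintegral_mono hle)
    rw [← ofReal_integral_eq_lintegral_ofReal ((integrable_polyGauss (n + 2) hc).const_mul _)
      (ae_of_all _ fun x => mul_nonneg (abs_nonneg _) (polyGauss_nonneg _ _ _))]
    exact ENNReal.ofReal_ne_top

end

/-! ### Fourier representation of the solution of the scheme. -/

/-- Symbol of the first central difference quotient. -/
noncomputable def symA (h ξ : ℝ) : ℝ := Real.sin (h * ξ) / h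

/-- Half the symbol of the negative second central difference quotient. -/
noncomputable def symB (h ξ : ℝ) : ℝ := (1 - Real.cos (h * ξ)) / h ^ 2

/-- Negative symbol of the Milstein correction. -/
noncomputable def Scheme.symC : Scheme → ℝ → ℝ → ℝ
  | .spaceFirst, h, ξ => symA h ξ ^ 2 / 2
  | .timeFirst, h, ξ => symB h ξ

/-- Symbol of the implicit part of the scheme. -/
noncomputable def symD (μ k h ξ : ℝ) : ℂ := ⟨k * symB h ξ, k * (μ * symA h ξ)⟩

/-- Amplification factor of one step at wave number `ξ`. -/
noncomputable def ampl (s : Scheme) (μ ρ h k ξ z : ℝ) : ℂ :=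
  stepNum (√(ρ * k) * symA h ξ) (ρ * k * s.symC h ξ) z / (1 + symD μ k h ξ)

lemma continuous_symA (h : ℝ) : Continuous (symA h) := by unfold symA; fun_prop

lemma continuous_symB (h : ℝ) : Continuous (symB h) := by unfold symB; fun_prop

lemma Scheme.continuous_symC (s : Scheme) (h : ℝ) : Continuous (s.symC h) := by
  cases s
  · exact ((continuous_symA h).pow 2).div_const 2
  · exact continuous_symB h

lemma symD_eq (μ k h ξ : ℝ) :
    symD μ k h ξ = ((k * symB h ξ : ℝ) : ℂ) + ((k * (μ * symA h ξ) : ℝ) : ℂ) * Complex.I :=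
  Complex.mk_eq_add_mul_I _ _

lemma continuous_symD (μ k h : ℝ) : Continuous (symD μ k h) := by
  have := continuous_symA h
  have := continuous_symB h
  simp_rw [funext (symD_eq μ k h)]
  fun_prop

lemma symB_nonneg (h ξ : ℝ) : 0 ≤ symB h ξ :=
  div_nonneg (sub_nonneg.2 (Real.cos_le_one _)) (sq_nonneg h)

lemma one_add_symD_ne_zero {k : ℝ} (hk : 0 ≤ k) (μ h ξ : ℝ) : 1 + symD μ k h ξ ≠ 0 := by
  have := one_le_norm_one_add (D := symD μ k h ξ) (mul_nonneg hk (symB_nonneg h ξ))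
  exact norm_pos_iff.1 (by linarith)

lemma continuous_ampl_prod (s : Scheme) (μ ρ h : ℝ) {k : ℝ} (hk : 0 ≤ k) :
    Continuous fun p : ℝ × ℝ => ampl s μ ρ h k p.1 p.2 := by
  have h1 := (continuous_symA h).comp continuous_fst (Y := ℝ) (X := ℝ × ℝ)
  have h2 := (s.continuous_symC h).comp continuous_fst (Y := ℝ) (X := ℝ × ℝ)
  have h3 := (continuous_symD μ k h).comp continuous_fst (Y := ℝ) (X := ℝ × ℝ)
  unfold ampl stepNum
  simp only [Function.comp_def] at h1 h2 h3
  refine Continuous.div ?_ ?_ fun p => one_add_symD_ne_zero hk μ h p.1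
  · fun_prop
  · fun_prop

lemma continuous_ampl (s : Scheme) (μ ρ h : ℝ) {k : ℝ} (hk : 0 ≤ k) (z : ℝ) :
    Continuous fun ξ => ampl s μ ρ h k ξ z := by
  have h2 := continuous_ampl_prod s μ ρ h hk
  generalize ampl s μ ρ h k = f at h2 ⊢
  fun_prop

/-- Product of the first `n` amplification factors. -/
noncomputable def amplProd (s : Scheme) (μ ρ h k : ℝ) (z : ℕ → ℝ) (n : ℕ) (ξ : ℝ) : ℂ :=
  ∏ m ∈ Finset.range n, ampl s μ ρ h k ξ (z m)

lemma continuous_amplProd (s : Scheme) (μ ρ h : ℝ) {k : ℝ} (hk : 0 ≤ k) (z : ℕ → ℝ) (n : ℕ) :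
    Continuous (amplProd s μ ρ h k z n) :=
  continuous_finsetProd _ fun m _ => continuous_ampl s μ ρ h hk (z m)

/-- Inverse Fourier integral over the band of resolved wave numbers. -/
noncomputable def bandIntegral (h : ℝ) : C(ℝ, ℂ) →ₗ[ℝ] ℝ where
  toFun f := 1 / (2 * Real.pi) * (∫ ξ in (-(Real.pi / h))..(Real.pi / h), f ξ).re
  map_add' f g := by
    simp only [ContinuousMap.coe_add, Pi.add_apply]
    rw [intervalIntegral.integral_add (f.continuous.intervalIntegrable _ _)
      (g.continuous.intervalIntegrable _ _), Complex.add_re, mul_add]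
  map_smul' c f := by
    simp only [ContinuousMap.coe_smul, Pi.smul_apply]
    rw [intervalIntegral.integral_smul, Complex.real_smul, Complex.re_ofReal_mul]
    simp only [RingHom.id_apply, smul_eq_mul]
    ring

lemma bandIntegral_apply (h : ℝ) (f : C(ℝ, ℂ)) :
    bandIntegral h f = 1 / (2 * Real.pi) * (∫ ξ in (-(Real.pi / h))..(Real.pi / h), f ξ).re := rfl

/-- Integrand of the Fourier representation of the numerical solution. -/
noncomputable def solIntegrand (s : Scheme) (μ ρ x₀ h k : ℝ) (hk : 0 ≤ k) (z : ℕ → ℝ) (n : ℕ)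
    (x : ℝ) : C(ℝ, ℂ) where
  toFun ξ := amplProd s μ ρ h k z n ξ * Complex.exp (Complex.I * (ξ * (x - x₀) : ℝ))
  continuous_toFun := by
    have := continuous_amplProd s μ ρ h hk z n
    fun_prop

/-- Fourier representation of the numerical solution, interpolated to the whole line. -/
noncomputable def numSol (s : Scheme) (μ ρ x₀ h k : ℝ) (hk : 0 ≤ k) (z : ℕ → ℝ) (n : ℕ)
    (x : ℝ) : ℝ :=
  bandIntegral h (solIntegrand s μ ρ x₀ h k hk z n x)

lemma exp_shift (ξ x x₀ d : ℝ) :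
    Complex.exp (Complex.I * (ξ * (x + d - x₀) : ℝ)) =
      Complex.exp (Complex.I * (ξ * (x - x₀) : ℝ)) *
        (Real.cos (d * ξ) + Real.sin (d * ξ) * Complex.I) := by
  rw [Complex.ofReal_cos, Complex.ofReal_sin, ← Complex.exp_mul_I, ← Complex.exp_add]
  congr 1
  push_cast
  ring

lemma solIntegrand_shift (s : Scheme) (μ ρ x₀ h k : ℝ) (hk : 0 ≤ k) (z : ℕ → ℝ) (n : ℕ)
    (x d ξ : ℝ) :
    solIntegrand s μ ρ x₀ h k hk z n (x + d) ξ = solIntegrand s μ ρ x₀ h k hk z n x ξ *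
      (Real.cos (d * ξ) + Real.sin (d * ξ) * Complex.I) := by
  simp only [solIntegrand, ContinuousMap.coe_mk, exp_shift]
  ring

lemma solIntegrand_succ_mul (s : Scheme) (μ ρ x₀ h k : ℝ) (hk : 0 ≤ k) (z : ℕ → ℝ) (n : ℕ)
    (x ξ : ℝ) :
    solIntegrand s μ ρ x₀ h k hk z (n + 1) x ξ * (1 + symD μ k h ξ) =
      solIntegrand s μ ρ x₀ h k hk z n x ξ *
        stepNum (√(ρ * k) * symA h ξ) (ρ * k * s.symC h ξ) (z n) := by
  have := one_add_symD_ne_zero hk μ h ξ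
  simp only [solIntegrand, ContinuousMap.coe_mk, amplProd, Finset.prod_range_succ, ampl]
  field_simp

/-- A shift by ±h multiplies the integrand by exp(±ihξ), so the recursion holds between integrands,
for every ξ; the linear map `bandIntegral` carries it over to the values. -/
lemma numSol_step (s : Scheme) (μ ρ x₀ h k : ℝ) (hk : 0 ≤ k) (hh : h ≠ 0) (z : ℕ → ℝ) (n : ℕ)
    (j : ℤ) :
    numSol s μ ρ x₀ h k hk z (n + 1) (j * h) = numSol s μ ρ x₀ h k hk z n (j * h)
      - μ * k / (2 * h) * D1 (fun j : ℤ => numSol s μ ρ x₀ h k hk z (n + 1) (j * h)) j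
      + k / (2 * h ^ 2) * D2 (fun j : ℤ => numSol s μ ρ x₀ h k hk z (n + 1) (j * h)) j
      - √(ρ * k) * z n / (2 * h) * D1 (fun j : ℤ => numSol s μ ρ x₀ h k hk z n (j * h)) j
      + ρ * k * (z n ^ 2 - 1) *
        s.correction h (fun j : ℤ => numSol s μ ρ x₀ h k hk z n (j * h)) j := by
  have e1 : (((j + 1 : ℤ) : ℝ)) * h = j * h + h := by push_cast; ring
  have e2 : (((j - 1 : ℤ) : ℝ)) * h = j * h + -h := by push_cast; ring
  have e3 : (((j + 1 + 1 : ℤ) : ℝ)) * h = j * h + h + h := by push_cast; ring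
  have e4 : (((j - 1 - 1 : ℤ) : ℝ)) * h = j * h + -h + -h := by push_cast; ring
  have e5 : (((j + 1 - 1 : ℤ) : ℝ)) * h = j * h := by push_cast; ring
  have e6 : (((j - 1 + 1 : ℤ) : ℝ)) * h = j * h := by push_cast; ring
  have hC : (h : ℂ) ≠ 0 := by exact_mod_cast hh
  set f := solIntegrand s μ ρ x₀ h k hk z n with hf
  set g := solIntegrand s μ ρ x₀ h k hk z (n + 1) with hg
  have key : ∀ ξ, g (j * h) ξ * (1 + symD μ k h ξ) = f (j * h) ξ *
      stepNum (√(ρ * k) * symA h ξ) (ρ * k * s.symC h ξ) (z n) := fun ξ =>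
    solIntegrand_succ_mul s μ ρ x₀ h k hk z n (j * h) ξ
  have sf : ∀ x d ξ, f (x + d) ξ = f x ξ * (Real.cos (d * ξ) + Real.sin (d * ξ) * Complex.I) :=
    fun x d ξ => solIntegrand_shift s μ ρ x₀ h k hk z n x d ξ
  have sg : ∀ x d ξ, g (x + d) ξ = g x ξ * (Real.cos (d * ξ) + Real.sin (d * ξ) * Complex.I) :=
    fun x d ξ => solIntegrand_shift s μ ρ x₀ h k hk z (n + 1) x d ξ
  have cmap : g (j * h) = f (j * h) - (μ * k / (2 * h)) • (g (j * h + h) - g (j * h + -h))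
      + (k / (2 * h ^ 2)) • (g (j * h + h) - (2 : ℝ) • g (j * h) + g (j * h + -h))
      - (√(ρ * k) * z n / (2 * h)) • (f (j * h + h) - f (j * h + -h))
      + (ρ * k * (z n ^ 2 - 1)) • (match s with
        | .spaceFirst => (1 / (8 * h ^ 2)) • ((f (j * h + h + h) - f (j * h))
            - (f (j * h) - f (j * h + -h + -h)))
        | .timeFirst => (1 / (2 * h ^ 2)) • (f (j * h + h) - (2 : ℝ) • f (j * h)
            + f (j * h + -h))) := by
    ext ξ
    have hk1 := key ξ
    -- `D1` applied twice involves shifts by ±2h; cos² + sin² = 1 turns its symbol into -4 sin²(hξ).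
    have hsc := Complex.cos_sq' (h * ξ)
    rw [symD_eq] at hk1
    set F := f (j * h) ξ
    set G := g (j * h) ξ
    cases s
    · simp only [ContinuousMap.add_apply, ContinuousMap.sub_apply, ContinuousMap.smul_apply, sf, sg,
        neg_mul, Real.cos_neg, Real.sin_neg, Complex.real_smul, stepNum, Scheme.symC, symA, symB]
        at hk1 ⊢
      push_cast at hk1 ⊢
      linear_combination hk1 - ρ * k * (z n ^ 2 - 1) * F / (4 * h ^ 2) * hsc -
        ρ * k * (z n ^ 2 - 1) * F / (4 * h ^ 2) * Complex.sin (h * ξ) ^ 2 * Complex.I_sq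
    · simp only [ContinuousMap.add_apply, ContinuousMap.sub_apply, ContinuousMap.smul_apply, sf, sg,
        neg_mul, Real.cos_neg, Real.sin_neg, Complex.real_smul, stepNum, Scheme.symC, symA, symB]
        at hk1 ⊢
      push_cast at hk1 ⊢
      linear_combination hk1
  unfold numSol
  have := congrArg (bandIntegral h) cmap
  cases s <;>
  · simp only [map_add, map_sub, map_smul, smul_eq_mul] at this
    simp only [D1, D2, Scheme.correction, e1, e2, e3, e4, e5, e6, ← hf, ← hg]
    linear_combination this

/-- Orthogonality of the exponentials exp(i(j - m)hξ) over a full period of length 2π/h. As x₀ is a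
grid point, the rounding in `diracGrid` is exact. -/
lemma numSol_zero (s : Scheme) (μ ρ x₀ h k : ℝ) (hk : 0 ≤ k) (hh : 0 < h) (z : ℕ → ℝ) {m : ℤ}
    (hm : x₀ = m * h) :
    (fun j : ℤ => numSol s μ ρ x₀ h k hk z 0 (j * h)) = diracGrid h x₀ := by
  ext j
  have hr : round (x₀ / h) = m := by
    rw [hm, mul_div_assoc, div_self hh.ne', mul_one, round_intCast]
  rw [diracGrid, hr, numSol, bandIntegral_apply]
  have e : ∀ ξ : ℝ, solIntegrand s μ ρ x₀ h k hk z 0 (j * h) ξ =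
      Complex.exp ((Complex.I * ((j - m : ℤ) * h : ℝ)) * ξ) := fun ξ => by
    simp only [solIntegrand, amplProd, Finset.range_zero, Finset.prod_empty, one_mul,
      ContinuousMap.coe_mk, hm]
    congr 1
    push_cast
    ring
  simp_rw [e]
  have hpi := Real.pi_pos
  split_ifs with hj
  · subst hj
    simp
    field_simp
    norm_num
  · have hne : ((j - m : ℤ) : ℝ) ≠ 0 := by exact_mod_cast sub_ne_zero.2 hj
    have hc : Complex.I * (((j - m : ℤ) * h : ℝ) : ℂ) ≠ 0 :=
      mul_ne_zero Complex.I_ne_zero (by exact_mod_cast mul_ne_zero hne hh.ne')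
    rw [integral_exp_mul_complex hc]
    have h1 : Complex.exp (Complex.I * (((j - m : ℤ) * h : ℝ) : ℂ) * ((Real.pi / h : ℝ) : ℂ)) =
        Complex.exp (Complex.I * (((j - m : ℤ) * h : ℝ) : ℂ) * ((-(Real.pi / h) : ℝ) : ℂ)) := by
      rw [Complex.exp_eq_exp_iff_exists_int]
      refine ⟨j - m, ?_⟩
      have : (h : ℂ) ≠ 0 := by exact_mod_cast hh.ne'
      push_cast
      field_simp
      ring
    rw [h1]
    simp

/-- Up to the factor 1/h and the sign of the index, the grid values are real parts of the Fourier
coefficients of a function in L²; Parseval gives summability. -/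
lemma summable_numSol_sq (s : Scheme) (μ ρ x₀ h k : ℝ) (hk : 0 ≤ k) (hh : 0 < h) (z : ℕ → ℝ)
    (n : ℕ) : Summable fun j : ℤ => numSol s μ ρ x₀ h k hk z n (j * h) ^ 2 := by
  have hpi := Real.pi_pos
  have hab : -(Real.pi / h) < Real.pi / h := by
    have : 0 < Real.pi / h := by positivity
    linarith
  have hf := (solIntegrand s μ ρ x₀ h k hk z n 0).continuous
  have hL2 : MemLp (solIntegrand s μ ρ x₀ h k hk z n 0) 2
      (volume.restrict (Set.Ioc (-(Real.pi / h)) (Real.pi / h))) :=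
    (memLp_two_iff_integrable_sq_norm hf.aestronglyMeasurable).2
      (hf.norm.pow 2).integrableOn_Ioc
  have hs := (hasSum_sq_fourierCoeffOn hab hL2).summable
  have hs2 := ((Equiv.neg ℤ).summable_iff.2 hs).mul_left ((1 / h) ^ 2)
  refine Summable.of_nonneg_of_le (fun j => sq_nonneg _) (fun j => ?_) hs2
  have e : numSol s μ ρ x₀ h k hk z n (j * h) = 1 / h *
      (fourierCoeffOn hab (solIntegrand s μ ρ x₀ h k hk z n 0) (-j)).re := by
    rw [numSol, bandIntegral_apply, fourierCoeffOn_eq_integral, neg_neg, Complex.real_smul,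
      Complex.re_ofReal_mul, ← mul_assoc]
    congr 1
    · field_simp
      ring
    · congr 1
      refine intervalIntegral.integral_congr fun ξ _ => ?_
      have := solIntegrand_shift s μ ρ x₀ h k hk z n 0 (j * h) ξ
      rw [zero_add] at this
      simp only [this, fourier_coe_apply, smul_eq_mul]
      rw [mul_comm, Complex.ofReal_cos, Complex.ofReal_sin, ← Complex.exp_mul_I]
      congr 2
      have : (h : ℂ) ≠ 0 := by exact_mod_cast hh.ne'
      have : (Real.pi : ℂ) ≠ 0 := by exact_mod_cast hpi.ne'
      push_cast
      field_simp
      ring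
  rw [e, mul_pow]
  gcongr
  simp only [Function.comp, Equiv.neg_apply]
  rw [← sq_abs]
  gcongr
  exact Complex.abs_re_le_norm _

lemma isMilsteinSolution_numSol (s : Scheme) (μ ρ x₀ h k : ℝ) (hk : 0 ≤ k) (hh : 0 < h) {m : ℤ}
    (hm : x₀ = m * h) (z : ℕ → ℝ) (N : ℕ) :
    IsMilsteinSolution s μ ρ x₀ h k N z (fun n j => numSol s μ ρ x₀ h k hk z n (j * h)) where
  initial := numSol_zero s μ ρ x₀ h k hk hh z hm
  summable_sq n _ := summable_numSol_sq s μ ρ x₀ h k hk hh z n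
  step n _ j := numSol_step s μ ρ x₀ h k hk hh.ne' z n j

/-! ### Uniqueness of the square-summable solution. -/

/-- Energy argument: multiply by W_j and sum. The drift term cancels by shift invariance, and the
diffusion term is 2β(S₁ - S₀) ≤ 0, because S₁ = ΣW_jW_{j+1} is at most S₀ = ΣW_j². -/
lemma eq_zero_of_implicit_step {α β : ℝ} (hβ : 0 ≤ β) {W : ℤ → ℝ}
    (hs : Summable fun j => W j ^ 2) (hW : ∀ j, W j = -α * D1 W j + β * D2 W j) : W = 0 := by
  have hs1 : Summable fun j => W (j + 1) ^ 2 := (Equiv.addRight (1 : ℤ)).summable_iff.2 hs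
  have hp : Summable fun j => W j * W (j + 1) :=
    Summable.of_norm_bounded ((hs.add hs1)) fun j => by
      rw [Real.norm_eq_abs, abs_le]
      constructor <;> nlinarith [sq_nonneg (W j + W (j + 1)), sq_nonneg (W j - W (j + 1)),
        sq_nonneg (W j), sq_nonneg (W (j + 1))]
  have hm : HasSum (fun j => W j * W (j - 1)) (∑' j, W j * W (j + 1)) := by
    have := ((Equiv.subRight (1 : ℤ)).hasSum_iff (f := fun j => W j * W (j + 1))).2 hp.hasSum
    convert this using 1
    ext j
    simp [mul_comm]
  have e : ∀ j, W j ^ 2 = -α * (W j * W (j + 1) - W j * W (j - 1)) +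
      β * (W j * W (j + 1) - 2 * W j ^ 2 + W j * W (j - 1)) := fun j => by
    have := hW j
    simp only [D1, D2] at this
    linear_combination W j * this
  set S0 := ∑' j, W j ^ 2 with hS0
  set S1 := ∑' j, W j * W (j + 1) with hS1
  have h1 := ((hp.hasSum.sub hm).mul_left (-α)).add
    (((hp.hasSum.sub (hs.hasSum.mul_left 2)).add hm).mul_left β)
  have h2 : S0 = -α * (S1 - S1) + β * (S1 - 2 * S0 + S1) := by
    refine HasSum.unique hs.hasSum ?_
    rw [funext e]
    exact h1
  have h3 : S1 ≤ S0 := by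
    have h4 : ∑' j, W (j + 1) ^ 2 = S0 := (Equiv.addRight (1 : ℤ)).tsum_eq fun j => W j ^ 2
    have h5 : S1 ≤ ∑' j, (W j ^ 2 + W (j + 1) ^ 2) / 2 :=
      hp.tsum_le_tsum (fun j => by nlinarith [sq_nonneg (W j - W (j + 1))])
        ((hs.add hs1).div_const 2)
    rw [tsum_div_const, hs.tsum_add hs1, h4] at h5
    linarith
  have h6 : S0 ≤ 0 := by nlinarith
  have h7 : S0 = 0 := le_antisymm h6 (tsum_nonneg fun j => sq_nonneg _)
  have h8 := (hs.hasSum_iff.2 h7)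
  rw [hasSum_zero_iff_of_nonneg fun j => sq_nonneg _] at h8
  ext j
  exact pow_eq_zero_iff two_ne_zero |>.1 (congrFun h8 j)

lemma IsMilsteinSolution.unique {s : Scheme} {μ ρ x₀ h k : ℝ} {N : ℕ} {z : ℕ → ℝ}
    {V V' : ℕ → ℤ → ℝ} (hk : 0 ≤ k) (hV : IsMilsteinSolution s μ ρ x₀ h k N z V)
    (hV' : IsMilsteinSolution s μ ρ x₀ h k N z V') {n : ℕ} (hn : n ≤ N) : V n = V' n := by
  induction n with
  | zero => rw [hV.initial, hV'.initial]
  | succ n ih =>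
    have ih := ih (by omega)
    have h1 := hV.summable_sq (n + 1) hn
    have h2 := hV'.summable_sq (n + 1) hn
    have h3 : Summable fun j => (V (n + 1) j - V' (n + 1) j) ^ 2 :=
      Summable.of_nonneg_of_le (fun j => sq_nonneg _)
        (fun j => by nlinarith [sq_nonneg (V (n + 1) j + V' (n + 1) j)])
        ((h1.add h2).mul_left 2)
    have h4 := eq_zero_of_implicit_step (α := μ * k / (2 * h)) (β := k / (2 * h ^ 2))
      (by positivity) h3 (fun j => by
        have e1 := hV.step n (by omega) j
        have e2 := hV'.step n (by omega) j
        rw [← ih] at e2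
        simp only [D1, D2] at e1 e2 ⊢
        linear_combination e1 - e2)
    ext j
    have := congrFun h4 j
    simpa [sub_eq_zero] using this

/-! ### Exact solution in Fourier space and normalised Brownian increments. -/

section

/-- Fourier transform in `x` of the exact solution at a path with terminal value `m`. -/
noncomputable def exactFourier (μ ρ T m ξ : ℝ) : ℂ :=
  Complex.exp (((-((1 - ρ) * T / 2) * ξ ^ 2 : ℝ) : ℂ) - Complex.I * ((μ * T + √ρ * m) * ξ : ℝ))

lemma norm_exactFourier (μ ρ T m ξ : ℝ) :
    ‖exactFourier μ ρ T m ξ‖ = Real.exp (-((1 - ρ) * T / 2) * ξ ^ 2) := by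
  rw [exactFourier, Complex.norm_exp]
  congr 1
  rw [Complex.sub_re, Complex.ofReal_re, Complex.re_mul_ofReal, Complex.I_re, zero_mul, sub_zero]

lemma continuous_exactFourier (μ ρ T : ℝ) :
    Continuous fun p : ℝ × ℝ => exactFourier μ ρ T p.1 p.2 := by
  unfold exactFourier; fun_prop

lemma exactSolution_eq_fourier {μ ρ x₀ T m x : ℝ} (hρ : ρ < 1) (hT : 0 < T) :
    exactSolution μ ρ x₀ T m x = 1 / (2 * Real.pi) *
      (∫ ξ, exactFourier μ ρ T m ξ * Complex.exp (Complex.I * (ξ * (x - x₀) : ℝ))).re := by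
  set b : ℝ := (1 - ρ) * T / 2 with hb
  have hb0 : 0 < b := by have := sub_pos.2 hρ; positivity
  set y : ℝ := x - x₀ - μ * T - √ρ * m with hy
  have hpi := Real.pi_pos
  have h := fourierIntegral_gaussian (b := (b : ℂ)) (by simpa using hb0) (y : ℂ)
  have e : ∀ ξ : ℝ, exactFourier μ ρ T m ξ * Complex.exp (Complex.I * (ξ * (x - x₀) : ℝ)) =
      Complex.exp (Complex.I * y * ξ) * Complex.exp (-(b : ℂ) * ξ ^ 2) := fun ξ => by
    rw [exactFourier, ← Complex.exp_add, ← Complex.exp_add]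
    congr 1
    rw [hy]
    push_cast
    rw [hb]
    push_cast
    ring
  simp_rw [e]
  rw [h]
  have e2 : (Real.pi / b : ℂ) ^ (1 / 2 : ℂ) * Complex.exp (-(y : ℂ) ^ 2 / (4 * b)) =
      ((√(Real.pi / b) * Real.exp (-y ^ 2 / (4 * b)) : ℝ) : ℂ) := by
    rw [Real.sqrt_eq_rpow, Complex.ofReal_mul, Complex.ofReal_cpow (by positivity)]
    push_cast
    rfl
  rw [e2, Complex.ofReal_re, exactSolution, ← mul_assoc]
  congr 1
  · rw [show 2 * Real.pi * (1 - ρ) * T = (2 * Real.pi) ^ 2 / (Real.pi / b) by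
      rw [hb]; field_simp, Real.sqrt_div (by positivity), Real.sqrt_sq (by positivity)]
    field_simp
  · congr 1
    rw [hb, hy]
    ring_nf

variable {Ω : Type*} [MeasurableSpace Ω] {P : Measure Ω} {M : ℝ≥0 → Ω → ℝ}

/-- The law of an increment gives measurability only almost everywhere. Passing to measurable
modifications makes the Fourier integrands jointly measurable in (ξ, ω). The terminal value is
recovered by telescoping, since M₀ = 0 almost surely. -/
lemma exists_isStdNormalSeq_noise (hM : IsBrownianReal M P) {k : ℝ≥0} (hk : 0 < k) :
    ∃ Z : ℕ → Ω → ℝ, IsStdNormalSeq Z P ∧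
      ∀ᵐ ω ∂P, (∀ n, noise M k ω n = Z n ω) ∧
        ∀ N : ℕ, M (N * k) ω = √(k : ℝ) * ∑ n ∈ Finset.range N, Z n ω := by
  have hB := hM.toIsPreBrownianReal
  have hk' : (0 : ℝ) < k := hk
  have hsk : 0 < √(k : ℝ) := Real.sqrt_pos.2 hk'
  have hlaw : ∀ n, HasLaw (fun ω => noise M k ω n) (gaussianReal 0 1) P := fun n => by
    have h1 := hB.hasLaw_sub ((n + 1) * k) (n * k)
    have h2 := gaussianReal_div_const h1 (√(k : ℝ))
    have e : (gaussianReal (0 / √(k : ℝ)) (nndist ((((n + 1) * k : ℝ≥0)) : ℝ) ((n * k : ℝ≥0) : ℝ) /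
        NNReal.mk ((√(k : ℝ)) ^ 2) (sq_nonneg _))) = gaussianReal 0 1 := by
      congr 1
      · simp
      · ext
        rw [NNReal.coe_div, coe_nndist, NNReal.coe_mk, Real.dist_eq, Real.sq_sqrt hk'.le]
        push_cast
        rw [show ((n : ℝ) + 1) * k - n * k = k by ring, abs_of_pos hk', div_self hk'.ne']
    rw [← e]
    exact h2
  have hmono : Monotone fun n : ℕ => (n : ℝ≥0) * k := fun a b hab => by
    have : (a : ℝ≥0) ≤ b := by exact_mod_cast hab
    simp only
    gcongr
  have hind : iIndepFun (fun n ω => noise M k ω n) P := by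
    have h1 := hB.hasIndepIncrements.nat hmono
    have h2 := h1.comp (fun _ x => x / √(k : ℝ)) (fun _ => by fun_prop)
    convert h2 using 1
    ext n ω
    simp [noise, Function.comp]
  have hmk : ∀ n, (fun ω => noise M k ω n) =ᵐ[P] (hlaw n).aemeasurable.mk _ := fun n =>
    (hlaw n).aemeasurable.ae_eq_mk
  refine ⟨fun n => (hlaw n).aemeasurable.mk _, ⟨fun n => (hlaw n).aemeasurable.measurable_mk,
    hind.congr hmk, fun n => ?_⟩, ?_⟩
  · rw [← Measure.map_congr (hmk n)]
    exact (hlaw n).map_eq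
  · filter_upwards [ae_all_iff.2 hmk, hB.eval_zero_ae_eq_zero] with ω h1 h2
    refine ⟨h1, fun N => ?_⟩
    induction N with
    | zero => simp [h2]
    | succ N ih =>
      rw [Finset.sum_range_succ, mul_add, ← ih, ← h1 N, noise]
      push_cast
      field_simp
      ring

end

/-! ### Expansion of the symbols at small hξ. -/

section

section Symbols

variable {h ξ L : ℝ}

lemma abs_symA_sub_add_le (hh : 0 < h) (hL : 1 ≤ L) (hξ : |ξ| ≤ L) (hhL : h * L ≤ 1) :
    |symA h ξ - ξ + h ^ 2 * ξ ^ 3 / 6| ≤ h ^ 4 * L ^ 5 := by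
  have hx : |h * ξ| ≤ h * L := by rw [abs_mul, abs_of_pos hh]; gcongr
  have hb := Real.sin_bound (hx.trans hhL)
  have e : symA h ξ - ξ + h ^ 2 * ξ ^ 3 / 6 =
      (Real.sin (h * ξ) - (h * ξ - (h * ξ) ^ 3 / 6)) / h := by
    rw [symA]; field_simp; ring
  rw [e, abs_div, abs_of_pos hh, div_le_iff₀ hh]
  calc _ ≤ |h * ξ| ^ 5 / 100 := hb
    _ ≤ (h * L) ^ 5 / 100 := by gcongr
    _ ≤ (h * L) ^ 5 := div_le_self (by positivity) (by norm_num)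
    _ = _ := by ring

lemma abs_symA_le (hh : 0 < h) : |symA h ξ| ≤ |ξ| := by
  rw [symA, abs_div, abs_of_pos hh, div_le_iff₀ hh]
  calc _ ≤ |h * ξ| := Real.abs_sin_le_abs
    _ = _ := by rw [abs_mul, abs_of_pos hh, mul_comm]

lemma abs_symA_sub_le (hh : 0 < h) (hL : 1 ≤ L) (hξ : |ξ| ≤ L) (hhL : h * L ≤ 1) :
    |symA h ξ - ξ| ≤ h ^ 2 * L ^ 3 := by
  have hx : |h * ξ| ≤ h * L := by rw [abs_mul, abs_of_pos hh]; gcongr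
  have hb := Real.sin_bound (hx.trans hhL)
  have e : symA h ξ - ξ = (Real.sin (h * ξ) - (h * ξ - (h * ξ) ^ 3 / 6) - (h * ξ) ^ 3 / 6) / h := by
    rw [symA]; field_simp; ring
  rw [e, abs_div, abs_of_pos hh, div_le_iff₀ hh]
  have h3 : |(h * ξ) ^ 3 / 6| ≤ (h * L) ^ 3 / 6 := by
    rw [abs_div, abs_pow, abs_of_pos (by norm_num : (0 : ℝ) < 6)]; gcongr
  have h5 : |h * ξ| ^ 5 ≤ (h * L) ^ 3 := by
    calc |h * ξ| ^ 5 ≤ (h * L) ^ 5 := by gcongr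
      _ ≤ _ := pow_le_pow_of_le_one (by positivity) hhL (by norm_num)
  have h0 : 0 ≤ (h * L) ^ 3 := by positivity
  calc _ ≤ |h * ξ| ^ 5 / 100 + (h * L) ^ 3 / 6 := (abs_sub _ _).trans (add_le_add hb h3)
    _ ≤ (h * L) ^ 3 := by linarith
    _ = _ := by ring

lemma abs_symB_sub_add_le (hh : 0 < h) (hL : 1 ≤ L) (hξ : |ξ| ≤ L) (hhL : h * L ≤ 1) :
    |symB h ξ - ξ ^ 2 / 2 + h ^ 2 * ξ ^ 4 / 24| ≤ h ^ 4 * L ^ 6 := by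
  have hx : |h * ξ| ≤ h * L := by rw [abs_mul, abs_of_pos hh]; gcongr
  set u := h * ξ / 2 with hu
  have hul : |u| ≤ h * L := by
    rw [hu, abs_div, abs_of_pos (by norm_num : (0 : ℝ) < 2)]
    have := abs_nonneg (h * ξ)
    linarith
  have hb := Real.sin_bound (hul.trans hhL)
  set r := Real.sin u - (u - u ^ 3 / 6) with hr
  -- The half-angle formula reduces the expansion of the cosine to the fifth-order bound for the
  -- sine.
  have hcos : Real.cos (h * ξ) = 1 - 2 * Real.sin u ^ 2 := by
    rw [show h * ξ = 2 * u by rw [hu]; ring, Real.cos_two_mul, Real.sin_sq]; ring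
  have hsin : Real.sin u = u - u ^ 3 / 6 + r := by rw [hr]; ring
  have e : symB h ξ - ξ ^ 2 / 2 + h ^ 2 * ξ ^ 4 / 24 =
      (u ^ 6 / 18 + 4 * r * u - 2 / 3 * r * u ^ 3 + 2 * r ^ 2) / h ^ 2 := by
    rw [symB, hcos, hsin]
    rw [show ξ = 2 * u / h by rw [hu]; field_simp]
    field_simp
    ring
  have h2 : 0 < h ^ 2 := by positivity
  rw [e, abs_div, abs_of_pos h2, div_le_iff₀ h2]
  set X := h * L with hX
  have hX0 : 0 ≤ X := by positivity
  have hr1 : |r| ≤ X ^ 5 / 100 := hb.trans (by gcongr)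
  have hX6 : 0 ≤ X ^ 6 := by positivity
  have t1 : |u ^ 6 / 18| ≤ X ^ 6 / 18 := by
    rw [abs_div, abs_pow, abs_of_pos (by norm_num : (0 : ℝ) < 18)]; gcongr
  have t2 : |4 * r * u| ≤ 4 * (X ^ 5 / 100) * X := by
    rw [abs_mul, abs_mul, abs_of_pos (by norm_num : (0 : ℝ) < 4)]; gcongr
  have t3 : |2 / 3 * r * u ^ 3| ≤ 2 / 3 * (X ^ 5 / 100) * X := by
    rw [abs_mul, abs_mul, abs_of_pos (by norm_num : (0 : ℝ) < 2 / 3), abs_pow]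
    gcongr
    calc |u| ^ 3 ≤ X ^ 3 := by gcongr
      _ ≤ X ^ 1 := pow_le_pow_of_le_one hX0 hhL (by norm_num)
      _ = X := pow_one X
  have t4 : |2 * r ^ 2| ≤ 2 * X ^ 6 / 100 := by
    rw [abs_mul, abs_of_pos (by norm_num : (0 : ℝ) < 2), abs_pow]
    have : |r| ≤ X := by
      have : X ^ 5 ≤ X ^ 1 := pow_le_pow_of_le_one hX0 hhL (by norm_num)
      rw [pow_one] at this
      linarith
    calc 2 * |r| ^ 2 = 2 * (|r| * |r|) := by ring
      _ ≤ 2 * ((X ^ 5 / 100) * X) := by gcongr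
      _ = _ := by ring
  calc _ ≤ |u ^ 6 / 18| + |4 * r * u| + |2 / 3 * r * u ^ 3| + |2 * r ^ 2| :=
        (abs_add_le _ _).trans (add_le_add ((abs_sub _ _).trans (add_le_add (abs_add_le _ _)
          le_rfl)) le_rfl)
    _ ≤ X ^ 6 := by
        have : X ^ 5 * X = X ^ 6 := by ring
        nlinarith
    _ = _ := by rw [hX]; ring

lemma abs_symB_sub_le (hh : 0 < h) (hL : 1 ≤ L) (hξ : |ξ| ≤ L) (hhL : h * L ≤ 1) :
    |symB h ξ - ξ ^ 2 / 2| ≤ 2 * (h ^ 2 * L ^ 4) := by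
  have h1 := abs_symB_sub_add_le hh hL hξ hhL
  have h2 : |h ^ 2 * ξ ^ 4 / 24| ≤ h ^ 2 * L ^ 4 := by
    rw [abs_div, abs_mul, abs_pow, abs_pow, abs_of_pos hh, abs_of_pos (by norm_num : (0 : ℝ) < 24)]
    exact (div_le_self (by positivity) (by norm_num)).trans (by gcongr)
  have h3 : h ^ 4 * L ^ 6 ≤ h ^ 2 * L ^ 4 := by
    calc h ^ 4 * L ^ 6 = (h ^ 2 * L ^ 4) * (h * L) ^ 2 := by ring
      _ ≤ (h ^ 2 * L ^ 4) * 1 := by gcongr; exact pow_le_one₀ (by positivity) hhL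
      _ = _ := mul_one _
  have e : symB h ξ - ξ ^ 2 / 2 = (symB h ξ - ξ ^ 2 / 2 + h ^ 2 * ξ ^ 4 / 24) -
      h ^ 2 * ξ ^ 4 / 24 := by ring
  rw [e]
  exact (abs_sub _ _).trans (by linarith)

lemma Scheme.abs_symC_sub_le (s : Scheme) (hh : 0 < h) (hL : 1 ≤ L) (hξ : |ξ| ≤ L)
    (hhL : h * L ≤ 1) : |s.symC h ξ - ξ ^ 2 / 2| ≤ 2 * (h ^ 2 * L ^ 4) := by
  cases s
  · have h1 := abs_symA_sub_le hh hL hξ hhL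
    have h2 : |symA h ξ + ξ| ≤ 2 * L := (abs_add_le _ _).trans (by
      have := abs_symA_le (ξ := ξ) hh
      linarith)
    have e : Scheme.spaceFirst.symC h ξ - ξ ^ 2 / 2 = (symA h ξ - ξ) * (symA h ξ + ξ) / 2 := by
      simp only [Scheme.symC]; ring
    rw [e, abs_div, abs_mul, abs_of_pos (by norm_num : (0 : ℝ) < 2)]
    have h0 : 0 ≤ h ^ 2 * L ^ 4 := by positivity
    have : |symA h ξ - ξ| * |symA h ξ + ξ| ≤ (h ^ 2 * L ^ 3) * (2 * L) := by gcongr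
    have e2 : (h ^ 2 * L ^ 3) * (2 * L) = 2 * (h ^ 2 * L ^ 4) := by ring
    linarith
  · exact abs_symB_sub_le hh hL hξ hhL

/-- Here sin² = (1 - cos)(1 + cos) ≤ 2(1 - cos). This lets the implicit diffusion control the noise
term at every wave number. -/
lemma symA_sq_le (hh : 0 < h) : symA h ξ ^ 2 ≤ 2 * symB h ξ := by
  have h1 : Real.sin (h * ξ) ^ 2 ≤ 2 * (1 - Real.cos (h * ξ)) := by
    rw [Real.sin_sq]
    nlinarith [Real.cos_le_one (h * ξ), Real.neg_one_le_cos (h * ξ), sq_nonneg (1 - Real.cos (h * ξ))]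
  rw [symA, symB, div_pow, ← mul_div_assoc]
  gcongr

lemma Scheme.symC_nonneg (s : Scheme) : 0 ≤ s.symC h ξ := by
  cases s
  · exact div_nonneg (sq_nonneg _) zero_le_two
  · exact symB_nonneg h ξ

lemma Scheme.symC_le (s : Scheme) (hh : 0 < h) : s.symC h ξ ≤ symB h ξ := by
  cases s
  · have := symA_sq_le (ξ := ξ) hh
    simp only [Scheme.symC]
    linarith
  · exact le_rfl

/-- Quadratic coercivity up to the edge of the band; this is what produces Gaussian decay of the
numerical product. -/
lemma le_symB (hh : 0 < h) (hξ : |h * ξ| ≤ Real.pi) : 2 / Real.pi ^ 2 * ξ ^ 2 ≤ symB h ξ := by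
  have := Real.cos_le_one_sub_mul_cos_sq hξ
  rw [symB, le_div_iff₀ (by positivity)]
  calc _ = 2 / Real.pi ^ 2 * (h * ξ) ^ 2 := by ring
    _ ≤ _ := by linarith

end Symbols

/-- Symbol of the implicit part of the time discretisation without space discretisation. -/
noncomputable def baseD (μ k ξ : ℝ) : ℂ := ⟨k * (ξ ^ 2 / 2), k * (μ * ξ)⟩

/-- Leading spatial discretisation error of the symbol of the implicit part. -/
noncomputable def linD (μ k h ξ : ℝ) : ℂ :=
  ⟨k * (h ^ 2 * ξ ^ 4 / 24), k * (μ * (h ^ 2 * ξ ^ 3 / 6))⟩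

/-- Here s = √k L and y = h²L². The arguments γ and Δ are the next Taylor terms of the symbols, of
relative order h²; the factor 1 + |μ| in the constant comes from the drift. -/
lemma stepBounds_symbols (s : Scheme) {μ ρ k h ξ L : ℝ} (hρ0 : 0 ≤ ρ) (hρ1 : ρ ≤ 1) (hk : 0 ≤ k)
    (hh : 0 < h) (hL : 1 ≤ L) (hξ : |ξ| ≤ L) (hkL : k * L ^ 2 ≤ 1) (hhL : h ^ 2 * L ^ 2 ≤ 1) :
    StepBounds (2 * (1 + |μ|)) (√k * L) (h ^ 2 * L ^ 2) (√(ρ * k) * ξ) (√(ρ * k) * symA h ξ)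
      (ρ * k * s.symC h ξ) (h ^ 2 * ξ ^ 2 * (√(ρ * k) * ξ) / 6) (symD μ k h ξ) (baseD μ k ξ)
      (linD μ k h ξ) := by
  have hhL' : h * L ≤ 1 := by
    have : (h * L) ^ 2 ≤ 1 := by rw [mul_pow]; exact hhL
    exact (sq_le_one_iff₀ (by positivity)).1 this
  have hs2 : (√k * L) ^ 2 = k * L ^ 2 := by rw [mul_pow, Real.sq_sqrt hk]
  have hσ : √(ρ * k) ≤ √k := Real.sqrt_le_sqrt (by nlinarith)
  have hσ0 := Real.sqrt_nonneg (ρ * k)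
  have hμ := abs_nonneg μ
  have hL0 : 0 ≤ L := by linarith
  have hLL : L ≤ L ^ 2 := by nlinarith
  have hξ2 : |ξ| ^ 2 ≤ L ^ 2 := by gcongr
  have hA1 := abs_symA_sub_le hh hL hξ hhL'
  have hA2 := abs_symA_sub_add_le hh hL hξ hhL'
  have hB1 := abs_symB_sub_le hh hL hξ hhL'
  have hB2 := abs_symB_sub_add_le hh hL hξ hhL'
  have hC := s.abs_symC_sub_le hh hL hξ hhL'
  have norm_le : ∀ z : ℂ, ‖z‖ ≤ |z.re| + |z.im| := Complex.norm_le_abs_re_add_abs_im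
  have hL34 : L ^ 3 ≤ L ^ 4 := pow_le_pow_right₀ hL (by norm_num)
  have hL56 : L ^ 5 ≤ L ^ 6 := pow_le_pow_right₀ hL (by norm_num)
  have hX : 0 ≤ k * (h ^ 2 * L ^ 4) := by positivity
  have hY : 0 ≤ k * (h ^ 4 * L ^ 6) := by positivity
  refine ⟨by linarith, by positivity, ?_, by positivity, hhL, ?_, ?_, ?_, ?_, ?_, ?_, ?_, ?_, ?_, ?_⟩
  · exact (sq_le_one_iff₀ (by positivity)).1 (by rw [hs2]; exact hkL)
  · rw [abs_mul, abs_of_nonneg hσ0]; gcongr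
  · rw [hs2]
    refine (norm_le _).trans ?_
    simp only [baseD]
    rw [abs_mul, abs_mul, abs_mul, abs_of_nonneg hk, abs_div, abs_pow,
      abs_of_pos (by norm_num : (0 : ℝ) < 2)]
    have h1 : k * (|ξ| ^ 2 / 2) ≤ k * L ^ 2 := by gcongr; nlinarith [sq_nonneg (|ξ|)]
    have h2 : k * (|μ| * |ξ|) ≤ k * (|μ| * L ^ 2) := by gcongr; linarith
    have h3 : 0 ≤ k * L ^ 2 := by positivity
    nlinarith [mul_nonneg hμ h3]
  · simp only [baseD]; positivity
  · exact mul_nonneg hk (symB_nonneg h ξ)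
  · rw [hs2]
    refine (norm_le _).trans ?_
    simp only [symD, baseD, Complex.sub_re, Complex.sub_im]
    rw [← mul_sub, ← mul_sub, ← mul_sub, abs_mul, abs_mul, abs_mul, abs_of_nonneg hk]
    have h1 : k * |symB h ξ - ξ ^ 2 / 2| ≤ k * (2 * (h ^ 2 * L ^ 4)) := by gcongr
    have h2 : k * (|μ| * |symA h ξ - ξ|) ≤ k * (|μ| * (h ^ 2 * L ^ 4)) := by
      gcongr
      exact hA1.trans (by gcongr)
    calc _ ≤ k * (2 * (h ^ 2 * L ^ 4)) + k * (|μ| * (h ^ 2 * L ^ 4)) := add_le_add h1 h2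
      _ ≤ 2 * (1 + |μ|) * (k * (h ^ 2 * L ^ 4)) := by nlinarith [mul_nonneg hμ hX]
      _ = _ := by ring
  · rw [hs2]
    refine (norm_le _).trans ?_
    simp only [linD]
    rw [abs_mul, abs_mul, abs_mul, abs_of_nonneg hk, abs_div, abs_div, abs_mul, abs_mul, abs_pow,
      abs_pow, abs_pow, abs_of_pos hh, abs_of_pos (by norm_num : (0 : ℝ) < 24),
      abs_of_pos (by norm_num : (0 : ℝ) < 6)]
    have h1 : k * (h ^ 2 * |ξ| ^ 4 / 24) ≤ k * (h ^ 2 * L ^ 4) := by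
      gcongr
      exact (div_le_self (by positivity) (by norm_num)).trans (by gcongr)
    have h2 : k * (|μ| * (h ^ 2 * |ξ| ^ 3 / 6)) ≤ k * (|μ| * (h ^ 2 * L ^ 4)) := by
      gcongr
      refine (div_le_self (by positivity) (by norm_num)).trans ?_
      gcongr
      exact (pow_le_pow_left₀ (abs_nonneg _) hξ 3).trans hL34
    calc _ ≤ k * (h ^ 2 * L ^ 4) + k * (|μ| * (h ^ 2 * L ^ 4)) := add_le_add h1 h2
      _ ≤ 2 * (1 + |μ|) * (k * (h ^ 2 * L ^ 4)) := by nlinarith [mul_nonneg hμ hX]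
      _ = _ := by ring
  · rw [hs2]
    refine (norm_le _).trans ?_
    simp only [symD, baseD, linD, Complex.sub_re, Complex.sub_im, Complex.add_re, Complex.add_im]
    rw [← mul_sub, ← mul_sub, ← mul_sub, ← mul_add, ← mul_add, ← mul_add, abs_mul, abs_mul,
      abs_mul, abs_of_nonneg hk]
    have h1 : k * |symB h ξ - ξ ^ 2 / 2 + h ^ 2 * ξ ^ 4 / 24| ≤ k * (h ^ 4 * L ^ 6) := by gcongr
    have h2 : k * (|μ| * |symA h ξ - ξ + h ^ 2 * ξ ^ 3 / 6|) ≤ k * (|μ| * (h ^ 4 * L ^ 6)) := by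
      gcongr
      exact hA2.trans (by gcongr)
    calc _ ≤ k * (h ^ 4 * L ^ 6) + k * (|μ| * (h ^ 4 * L ^ 6)) := add_le_add h1 h2
      _ ≤ 2 * (1 + |μ|) * (k * (h ^ 4 * L ^ 6)) := by nlinarith [mul_nonneg hμ hY]
      _ = _ := by ring
  · rw [abs_div, abs_mul, abs_mul, abs_mul, abs_pow, abs_pow, abs_of_pos hh, abs_of_nonneg hσ0,
      abs_of_pos (by norm_num : (0 : ℝ) < 6)]
    calc _ ≤ h ^ 2 * |ξ| ^ 2 * (√(ρ * k) * |ξ|) := div_le_self (by positivity) (by norm_num)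
      _ ≤ h ^ 2 * L ^ 2 * (√k * L) := by gcongr
      _ = 1 * (√k * L * (h ^ 2 * L ^ 2)) := by ring
      _ ≤ _ := by gcongr; linarith
  · have e : √(ρ * k) * symA h ξ - √(ρ * k) * ξ + h ^ 2 * ξ ^ 2 * (√(ρ * k) * ξ) / 6 =
        √(ρ * k) * (symA h ξ - ξ + h ^ 2 * ξ ^ 3 / 6) := by ring
    rw [e, abs_mul, abs_of_nonneg hσ0]
    calc _ ≤ √k * (h ^ 4 * L ^ 5) := by gcongr
      _ = 1 * (√k * L * (h ^ 2 * L ^ 2) ^ 2) := by ring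
      _ ≤ _ := by gcongr; linarith
  · rw [hs2]
    have e : ρ * k * s.symC h ξ - (√(ρ * k) * ξ) ^ 2 / 2 =
        ρ * k * (s.symC h ξ - ξ ^ 2 / 2) := by
      rw [mul_pow, Real.sq_sqrt (by positivity)]; ring
    rw [e, abs_mul, abs_of_nonneg (by positivity : 0 ≤ ρ * k)]
    calc _ ≤ (1 * k) * (2 * (h ^ 2 * L ^ 4)) := by gcongr
      _ = 2 * (k * L ^ 2 * (h ^ 2 * L ^ 2)) := by ring
      _ ≤ _ := by gcongr; linarith

/-! ### Mean-square stability of one step. -/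

section Stability

variable {ρ k h ξ : ℝ}

lemma continuous_ampl_right (s : Scheme) (μ ρ h k ξ : ℝ) : Continuous (ampl s μ ρ h k ξ) := by
  have := continuous_stepNum (√(ρ * k) * symA h ξ) (ρ * k * s.symC h ξ)
  exact this.div_const _

/-- With x = k `symB`, the second moment 1 + a² + 2c² of the numerator is bounded through a² ≤ 2ρx
and c ≤ ρx, and the denominator has modulus at least 1 + x. -/
lemma integral_norm_ampl_sq_le (s : Scheme) (μ : ℝ) (hρ0 : 0 ≤ ρ) (hk : 0 ≤ k) (hh : 0 < h) :
    ∫ z, ‖ampl s μ ρ h k ξ z‖ ^ 2 ∂gaussianReal 0 1 ≤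
      (1 + 2 * ρ * (k * symB h ξ) + 2 * ρ ^ 2 * (k * symB h ξ) ^ 2) / (1 + k * symB h ξ) ^ 2 := by
  have hB := symB_nonneg h ξ
  have hx : 0 ≤ k * symB h ξ := mul_nonneg hk hB
  have hden : (1 + k * symB h ξ) ^ 2 ≤ ‖1 + symD μ k h ξ‖ ^ 2 := by
    rw [← Complex.normSq_eq_norm_sq, Complex.normSq_apply]
    simp only [symD, Complex.add_re, Complex.one_re, Complex.add_im, Complex.one_im, zero_add]
    nlinarith [mul_self_nonneg (k * (μ * symA h ξ))]
  have e : ∀ z, ‖ampl s μ ρ h k ξ z‖ ^ 2 =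
      ‖stepNum (√(ρ * k) * symA h ξ) (ρ * k * s.symC h ξ) z‖ ^ 2 / ‖1 + symD μ k h ξ‖ ^ 2 :=
    fun z => by rw [ampl, norm_div, div_pow]
  simp_rw [e]
  rw [integral_div, integral_norm_stepNum_sq, mul_pow, Real.sq_sqrt (by positivity)]
  have hA := symA_sq_le (ξ := ξ) hh
  have hC0 := s.symC_nonneg (h := h) (ξ := ξ)
  have hC := s.symC_le (ξ := ξ) hh
  have h1 : ρ * k * symA h ξ ^ 2 ≤ 2 * ρ * (k * symB h ξ) := by
    calc _ ≤ ρ * k * (2 * symB h ξ) := by gcongr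
      _ = _ := by ring
  have h2 : 2 * (ρ * k * s.symC h ξ) ^ 2 ≤ 2 * ρ ^ 2 * (k * symB h ξ) ^ 2 := by
    calc _ ≤ 2 * (ρ * k * symB h ξ) ^ 2 := by gcongr
      _ = _ := by ring
  gcongr

lemma lintegral_enorm_ampl_sq (s : Scheme) (μ : ℝ) :
    ∫⁻ z, ‖ampl s μ ρ h k ξ z‖ₑ ^ 2 ∂gaussianReal 0 1 =
      ENNReal.ofReal (∫ z, ‖ampl s μ ρ h k ξ z‖ ^ 2 ∂gaussianReal 0 1) := by
  have hc := continuous_ampl_right s μ ρ h k ξ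
  have hint : Integrable (fun z => ‖ampl s μ ρ h k ξ z‖ ^ 2) (gaussianReal 0 1) := by
    by_contra hn
    have h0 := integral_norm_stepNum_sq (√(ρ * k) * symA h ξ) (ρ * k * s.symC h ξ)
    have hi : Integrable (fun z => ‖stepNum (√(ρ * k) * symA h ξ) (ρ * k * s.symC h ξ) z‖ ^ 2)
        (gaussianReal 0 1) := by
      -- A non-integrable function has Bochner integral 0, whereas the computed value is at least 1.
      by_contra hn'
      rw [integral_undef hn'] at h0
      nlinarith [sq_nonneg (√(ρ * k) * symA h ξ), sq_nonneg (ρ * k * s.symC h ξ)]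
    refine hn ((hi.div_const (‖1 + symD μ k h ξ‖ ^ 2)).congr (ae_of_all _ fun z => ?_))
    simp only [ampl, norm_div, div_pow]
  rw [ofReal_integral_eq_lintegral_ofReal hint (ae_of_all _ fun z => by positivity)]
  refine lintegral_congr fun z => ?_
  rw [ENNReal.ofReal_pow (norm_nonneg _), ofReal_norm]

/-- One minus the quotient is (2(1 - ρ)x + (1 - 2ρ²)x²)/(1 + x)². The first term suffices here, with
(1 + x)² ≤ 9. -/
lemma stability_small {x : ℝ} (hρ : ρ < 1) (hρ2 : 2 * ρ ^ 2 ≤ 1) (hx0 : 0 ≤ x) (hx : x ≤ 2) :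
    (1 + 2 * ρ * x + 2 * ρ ^ 2 * x ^ 2) / (1 + x) ^ 2 ≤ Real.exp (-(2 * (1 - ρ) / 9 * x)) := by
  have h1 := Real.add_one_le_exp (-(2 * (1 - ρ) / 9 * x))
  refine le_trans ?_ h1
  rw [div_le_iff₀ (by positivity)]
  have h2 : (1 + x) ^ 2 ≤ 9 := by nlinarith
  have h3 : 0 ≤ (1 - ρ) * x := mul_nonneg (by linarith) hx0
  nlinarith [mul_nonneg h3 (sub_nonneg.2 h2), mul_nonneg (sub_nonneg.2 hρ2) (sq_nonneg x)]

/-- Now the second term of the same identity is used, with x/(1 + x) ≥ 2/3. -/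
lemma stability_large {x : ℝ} (hρ : ρ < 1) (hρ2 : 2 * ρ ^ 2 ≤ 1) (hx : 2 ≤ x) :
    (1 + 2 * ρ * x + 2 * ρ ^ 2 * x ^ 2) / (1 + x) ^ 2 ≤ 1 - 4 * (1 - 2 * ρ ^ 2) / 9 := by
  have hx0 : 0 ≤ x := by linarith
  rw [div_le_iff₀ (by positivity)]
  have h2 : 4 * (1 + x) ^ 2 ≤ 9 * x ^ 2 := by nlinarith
  have h3 : 0 ≤ (1 - ρ) * x := mul_nonneg (by linarith) hx0
  nlinarith [mul_nonneg (sub_nonneg.2 hρ2) (sub_nonneg.2 h2)]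

end Stability

end

/-! ### Second moments of the leading error terms and of the numerical product. -/

section

variable {Ω : Type*} [MeasurableSpace Ω] {P : Measure Ω}

/-- The second absolute moment of `f` is at most `A`. -/
def SqMomentLE (P : Measure Ω) (f : Ω → ℂ) (A : ℝ) : Prop :=
  ∫⁻ ω, ‖f ω‖ₑ ^ 2 ∂P ≤ ENNReal.ofReal A

lemma SqMomentLE.mono {f : Ω → ℂ} {A B : ℝ} (h : SqMomentLE P f A) (hAB : A ≤ B) :
    SqMomentLE P f B := h.trans (ENNReal.ofReal_le_ofReal hAB)

lemma sqMomentLE_zero {A : ℝ} : SqMomentLE P (fun _ => 0) A := by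
  simp [SqMomentLE]

lemma sqMomentLE_of_memLp {f : Ω → ℂ} {A : ℝ} (hf : MemLp f 2 P) (h : ∫ ω, ‖f ω‖ ^ 2 ∂P ≤ A) :
    SqMomentLE P f A := by
  refine le_trans (le_of_eq ?_) (ENNReal.ofReal_le_ofReal h)
  rw [ofReal_integral_eq_lintegral_ofReal ((memLp_two_iff_integrable_sq_norm hf.1).1 hf)
    (ae_of_all _ fun _ => by positivity)]
  refine lintegral_congr fun ω => ?_
  rw [ENNReal.ofReal_pow (norm_nonneg _), ofReal_norm]

lemma SqMomentLE.mul_left {f g : Ω → ℂ} {A K : ℝ} (h : SqMomentLE P f A)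
    (hg : ∀ ω, ‖g ω‖ ≤ K) : SqMomentLE P (fun ω => g ω * f ω) (K ^ 2 * A) := by
  unfold SqMomentLE at *
  calc ∫⁻ ω, ‖g ω * f ω‖ₑ ^ 2 ∂P ≤ ∫⁻ ω, ENNReal.ofReal (K ^ 2) * ‖f ω‖ₑ ^ 2 ∂P := by
        refine lintegral_mono fun ω => ?_
        rw [enorm_mul, mul_pow]
        gcongr
        rw [← ofReal_norm, ← ENNReal.ofReal_pow (norm_nonneg _)]
        exact ENNReal.ofReal_le_ofReal (pow_le_pow_left₀ (norm_nonneg _) (hg ω) 2)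
    _ = ENNReal.ofReal (K ^ 2) * ∫⁻ ω, ‖f ω‖ₑ ^ 2 ∂P :=
        lintegral_const_mul' _ _ ENNReal.ofReal_ne_top
    _ ≤ ENNReal.ofReal (K ^ 2) * ENNReal.ofReal A := by gcongr
    _ = _ := (ENNReal.ofReal_mul (sq_nonneg K)).symm

lemma sqMomentLE_of_norm_le [IsProbabilityMeasure P] {f : Ω → ℂ} {K : ℝ}
    (h : ∀ ω, ‖f ω‖ ≤ K) : SqMomentLE P f (K ^ 2) := by
  have h1 : SqMomentLE P (fun _ => (1 : ℂ)) 1 := by simp [SqMomentLE]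
  simpa using h1.mul_left h

lemma SqMomentLE.add {f g : Ω → ℂ} {A B : ℝ} (hf : SqMomentLE P f A) (hg : SqMomentLE P g B)
    (hA : 0 ≤ A) (hB : 0 ≤ B) (hm : Measurable f) :
    SqMomentLE P (fun ω => f ω + g ω) (2 * (A + B)) := by
  unfold SqMomentLE at *
  have key : ∀ ω, ‖f ω + g ω‖ₑ ^ 2 ≤ 2 * ‖f ω‖ₑ ^ 2 + 2 * ‖g ω‖ₑ ^ 2 := fun ω => by
    rw [← ofReal_norm, ← ofReal_norm, ← ofReal_norm, ← ENNReal.ofReal_pow (norm_nonneg _),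
      ← ENNReal.ofReal_pow (norm_nonneg _), ← ENNReal.ofReal_pow (norm_nonneg _),
      ← ENNReal.ofReal_ofNat 2, ← ENNReal.ofReal_mul (by norm_num),
      ← ENNReal.ofReal_mul (by norm_num), ← ENNReal.ofReal_add (by positivity) (by positivity)]
    refine ENNReal.ofReal_le_ofReal ?_
    have h1 := pow_le_pow_left₀ (norm_nonneg _) (norm_add_le (f ω) (g ω)) 2
    nlinarith [sq_nonneg (‖f ω‖ - ‖g ω‖)]
  calc ∫⁻ ω, ‖f ω + g ω‖ₑ ^ 2 ∂P ≤ ∫⁻ ω, (2 * ‖f ω‖ₑ ^ 2 + 2 * ‖g ω‖ₑ ^ 2) ∂P :=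
        lintegral_mono key
    _ = 2 * ∫⁻ ω, ‖f ω‖ₑ ^ 2 ∂P + 2 * ∫⁻ ω, ‖g ω‖ₑ ^ 2 ∂P := by
        rw [lintegral_add_left ((hm.enorm.pow_const 2).const_mul 2),
          lintegral_const_mul' _ _ (by norm_num), lintegral_const_mul' _ _ (by norm_num)]
    _ ≤ 2 * ENNReal.ofReal A + 2 * ENNReal.ofReal B := by gcongr
    _ = _ := by
        rw [← mul_add, ← ENNReal.ofReal_add hA hB, ← ENNReal.ofReal_ofNat 2,
          ← ENNReal.ofReal_mul (by norm_num)]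

lemma SqMomentLE.sub {f g : Ω → ℂ} {A B : ℝ} (hf : SqMomentLE P f A) (hg : SqMomentLE P g B)
    (hA : 0 ≤ A) (hB : 0 ≤ B) (hm : Measurable f) :
    SqMomentLE P (fun ω => f ω - g ω) (2 * (A + B)) := by
  have hg' : SqMomentLE P (fun ω => -g ω) B := by simpa [SqMomentLE] using hg
  simpa only [sub_eq_add_neg] using hf.add hg' hA hB hm

/-- Ratio of the amplification factors of one step of the time discretisation without space
discretisation and of the exact solution. -/
noncomputable def baseRatio (μ ρ k ξ z : ℝ) : ℂ :=
  stepRatio (√(ρ * k) * ξ) (√(ρ * k) * ξ) ((√(ρ * k) * ξ) ^ 2 / 2) (baseD μ k ξ) (baseD μ k ξ) z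

lemma one_add_baseD_ne_zero {k : ℝ} (hk : 0 ≤ k) (μ ξ : ℝ) : 1 + baseD μ k ξ ≠ 0 := by
  have := one_le_norm_one_add (D := baseD μ k ξ) (by simp only [baseD]; positivity)
  exact norm_pos_iff.1 (by linarith)

lemma continuous_baseRatio (μ ρ : ℝ) {k : ℝ} (hk : 0 ≤ k) :
    Continuous fun p : ℝ × ℝ => baseRatio μ ρ k p.1 p.2 := by
  have h : Continuous fun p : ℝ × ℝ => baseD μ k p.1 := by
    simp only [baseD, Complex.mk_eq_add_mul_I]
    fun_prop
  unfold baseRatio stepRatio stepNum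
  refine Continuous.mul (Continuous.div (by fun_prop) (by fun_prop)
    fun p => one_add_baseD_ne_zero hk μ p.1) (by fun_prop)

/-- Sum of the relative one-step time discretisation errors. -/
noncomputable def baseErr (μ ρ k : ℝ) (z : ℕ → ℝ) (N : ℕ) (ξ : ℝ) : ℂ :=
  ∑ n ∈ Finset.range N, (baseRatio μ ρ k ξ (z n) - 1)

/-- Leading time discretisation error in Fourier space. -/
noncomputable def timeErr (μ ρ k T m : ℝ) (z : ℕ → ℝ) (N : ℕ) (ξ : ℝ) : ℂ :=
  if k * (1 + |ξ|) ^ 2 ≤ 1 then exactFourier μ ρ T m ξ * baseErr μ ρ k z N ξ else 0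

/-- Relative leading space discretisation error in Fourier space. -/
noncomputable def spaceRel (μ ρ T m ξ : ℝ) : ℂ :=
  ⟨(ξ ^ 4 / 24 - ρ * ξ ^ 4 / 6) * T, μ * ξ ^ 3 / 6 * T + √ρ * ξ ^ 3 / 6 * m⟩

/-- Leading space discretisation error in Fourier space. -/
noncomputable def spaceErr (μ ρ T m ξ : ℝ) : ℂ := exactFourier μ ρ T m ξ * spaceRel μ ρ T m ξ

/-- The wave numbers resolved by the mesh at which a time step is not strongly damped. -/
def goodBand (h k : ℝ) : Set ℝ :=
  {ξ | ξ ∈ Set.Ioc (-(Real.pi / h)) (Real.pi / h) ∧ k * symB h ξ ≤ 2}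

/-- The wave numbers resolved by the mesh at which a time step is strongly damped. -/
def badBand (h k : ℝ) : Set ℝ :=
  {ξ | ξ ∈ Set.Ioc (-(Real.pi / h)) (Real.pi / h) ∧ 2 < k * symB h ξ}

lemma measurableSet_goodBand (h k : ℝ) : MeasurableSet (goodBand h k) :=
  measurableSet_Ioc.inter (measurableSet_le ((continuous_symB h).measurable.const_mul k)
    measurable_const)

lemma measurableSet_badBand (h k : ℝ) : MeasurableSet (badBand h k) :=
  measurableSet_Ioc.inter (measurableSet_lt measurable_const
    ((continuous_symB h).measurable.const_mul k))

lemma goodBand_union_badBand (h k : ℝ) :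
    goodBand h k ∪ badBand h k = Set.Ioc (-(Real.pi / h)) (Real.pi / h) := by
  ext ξ
  simp only [goodBand, badBand, Set.mem_union, Set.mem_ofPred_eq, ← and_or_left]
  simp [le_or_gt]

lemma disjoint_goodBand_badBand (h k : ℝ) : Disjoint (goodBand h k) (badBand h k) :=
  Set.disjoint_left.2 fun _ h1 h2 => absurd h1.2 (not_le.2 h2.2)

lemma abs_mul_le_pi {h ξ : ℝ} (hh : 0 < h) (hξ : ξ ∈ Set.Ioc (-(Real.pi / h)) (Real.pi / h)) :
    |h * ξ| ≤ Real.pi := by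
  have h1 := hξ.1
  have h2 := hξ.2
  rw [abs_mul, abs_of_pos hh, mul_comm, ← le_div_iff₀ hh]
  exact abs_le.2 ⟨h1.le, h2⟩

lemma symB_le (h ξ : ℝ) (hh : 0 < h) : symB h ξ ≤ ξ ^ 2 / 2 := by
  have := Real.one_sub_sq_div_two_le_cos (x := h * ξ)
  rw [symB, div_le_iff₀ (by positivity)]
  nlinarith

lemma symB_le_two_div {h : ℝ} (hh : 0 < h) (ξ : ℝ) : symB h ξ ≤ 2 / h ^ 2 := by
  rw [symB]
  gcongr
  linarith [Real.neg_one_le_cos (h * ξ)]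

/-- This explains the threshold 2 in the two bands: the symbol never exceeds 2/h². -/
lemma badBand_eq_empty {h k : ℝ} (hh : 0 < h) (hkh : k ≤ h ^ 2) :
    badBand h k = ∅ := by
  refine Set.eq_empty_of_forall_notMem fun ξ hξ => absurd hξ.2 (not_lt.2 ?_)
  calc k * symB h ξ ≤ h ^ 2 * (2 / h ^ 2) := by
        gcongr
        · exact symB_nonneg h ξ
        · exact symB_le_two_div hh ξ
    _ = 2 := by field_simp

variable {Z : ℕ → Ω → ℝ}

lemma sqMomentLE_exactFourier [IsProbabilityMeasure P] (μ ρ T : ℝ) (m : Ω → ℝ) (ξ : ℝ) :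
    SqMomentLE P (fun ω => exactFourier μ ρ T (m ω) ξ) (polyGauss 0 ((1 - ρ) * T) ξ) := by
  refine (sqMomentLE_of_norm_le fun ω => (norm_exactFourier μ ρ T (m ω) ξ).le).mono (le_of_eq ?_)
  rw [polyGauss, pow_zero, one_mul, ← Real.exp_nat_mul]
  congr 1
  push_cast
  ring

/-- The modulus of `exactFourier` does not depend on the path, so it comes out of the expectation
although its phase is correlated with `f`. -/
lemma SqMomentLE.exactFourier_mul {f : Ω → ℂ} {A : ℝ} {ξ : ℝ} {n : ℕ} (μ ρ T : ℝ) (m : Ω → ℝ)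
    (hf : SqMomentLE P f (A * (1 + |ξ|) ^ n)) :
    SqMomentLE P (fun ω => exactFourier μ ρ T (m ω) ξ * f ω) (A * polyGauss n ((1 - ρ) * T) ξ) := by
  refine (hf.mul_left fun ω => (norm_exactFourier μ ρ T (m ω) ξ).le).mono (le_of_eq ?_)
  rw [polyGauss, ← Real.exp_nat_mul, show ((2 : ℕ) : ℝ) * (-((1 - ρ) * T / 2) * ξ ^ 2) =
    -((1 - ρ) * T) * ξ ^ 2 by push_cast; ring]
  ring

/-- The ratio bounds need k(1 + |ξ|)² ≤ 1, so `timeErr` is cut off elsewhere and the discrepancy is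
left to `remErr`. The cutoff involves k only, which keeps E₁ independent of h. -/
lemma exists_sqMomentLE_timeErr (μ : ℝ) {ρ T : ℝ} (hρ0 : 0 ≤ ρ) (hρ1 : ρ ≤ 1) (hT : 0 ≤ T) :
    ∃ C, 0 ≤ C ∧ ∀ {Z : ℕ → Ω → ℝ}, IsStdNormalSeq Z P → ∀ (m : Ω → ℝ) (N : ℕ) {k : ℝ}, 0 ≤ k →
      N * k = T → ∀ ξ, SqMomentLE P (fun ω => timeErr μ ρ k T (m ω) (fun n => Z n ω) N ξ)
        (k ^ 2 * C * polyGauss 8 ((1 - ρ) * T) ξ) := by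
  obtain ⟨C, hC, hM⟩ := exists_stepMoments (2 * (1 + |μ|))
  refine ⟨T * C + T ^ 2 * C ^ 2, by positivity, fun {Z} hZ m N k hk hN ξ => ?_⟩
  unfold timeErr
  split_ifs with hcut
  swap
  · exact sqMomentLE_zero
  refine SqMomentLE.exactFourier_mul μ ρ T m ?_
  have hL1 : 1 ≤ 1 + |ξ| := by linarith [abs_nonneg ξ]
  set L := 1 + |ξ| with hL
  -- The scheme and the mesh 1/L are auxiliary: the moments of `baseRatio` involve neither, and 1/L
  -- just meets the smallness condition.
  have hSM := hM (stepBounds_symbols .timeFirst (h := 1 / L) hρ0 hρ1 hk (by positivity) hL1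
    (by rw [hL]; linarith) hcut (by field_simp; rfl))
  have hmeas : Measurable fun z => baseRatio μ ρ k ξ z - 1 :=
    ((continuous_stepRatio _ _ _ _ _).measurable).sub_const 1
  have hmem : MemLp (fun z => baseRatio μ ρ k ξ z - 1) 2 (gaussianReal 0 1) := hSM.memLp_base
  refine sqMomentLE_of_memLp (hZ.memLp_sum hmem N) ?_
  refine (hZ.integral_norm_sum_sq_le hmeas hmem N).trans ?_
  have h1 : ‖∫ z, (baseRatio μ ρ k ξ z - 1) ∂gaussianReal 0 1‖ ≤ C * (√k * L) ^ 4 := hSM.mean_base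
  have h2 : ∫ z, ‖baseRatio μ ρ k ξ z - 1‖ ^ 2 ∂gaussianReal 0 1 ≤ C * (√k * L) ^ 6 := hSM.sq_base
  have hk2 : √k ^ 2 = k := Real.sq_sqrt hk
  have e4 : (√k * L) ^ 4 = k ^ 2 * L ^ 4 := by
    rw [mul_pow, show √k ^ 4 = (√k ^ 2) ^ 2 by ring, hk2]
  have e6 : (√k * L) ^ 6 = k ^ 3 * L ^ 6 := by
    rw [mul_pow, show √k ^ 6 = (√k ^ 2) ^ 3 by ring, hk2]
  rw [e4] at h1
  rw [e6] at h2
  have hL68 : L ^ 6 ≤ L ^ 8 := pow_le_pow_right₀ hL1 (by norm_num)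
  calc _ ≤ N * (C * (k ^ 3 * L ^ 6)) + (N : ℝ) ^ 2 * (C * (k ^ 2 * L ^ 4)) ^ 2 := by gcongr
    _ = (N * k) * C * k ^ 2 * L ^ 6 + (N * k) ^ 2 * C ^ 2 * k ^ 2 * L ^ 8 := by ring
    _ = T * C * k ^ 2 * L ^ 6 + T ^ 2 * C ^ 2 * k ^ 2 * L ^ 8 := by rw [hN]
    _ ≤ T * C * k ^ 2 * L ^ 8 + T ^ 2 * C ^ 2 * k ^ 2 * L ^ 8 := by gcongr
    _ = _ := by ring

lemma IsStdNormalSeq.integral_sq_sum_le (hZ : IsStdNormalSeq Z P) (N : ℕ) :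
    MemLp (fun ω => ((∑ n ∈ Finset.range N, Z n ω : ℝ) : ℂ)) 2 P ∧
      ∫ ω, ‖((∑ n ∈ Finset.range N, Z n ω : ℝ) : ℂ)‖ ^ 2 ∂P ≤ N := by
  have hc : Continuous fun z : ℝ => (z : ℂ) := Complex.continuous_ofReal
  have hmem : MemLp (fun z : ℝ => (z : ℂ)) 2 (gaussianReal 0 1) :=
    memLp_two_gaussianReal_of_bound (C := 1) (n := 1) hc fun z => by simp
  have h1 : ∫ z : ℝ, (z : ℂ) ∂gaussianReal 0 1 = 0 := by
    rw [integral_complex_ofReal, integral_id_gaussianReal]; rfl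
  have h2 : ∫ z : ℝ, ‖(z : ℂ)‖ ^ 2 ∂gaussianReal 0 1 = 1 := by
    simp only [Complex.norm_real, Real.norm_eq_abs, sq_abs]
    exact integral_sq_gaussianReal
  have h3 := hZ.integral_norm_sum_sq_le hc.measurable hmem N
  rw [h1, h2] at h3
  push_cast
  exact ⟨hZ.memLp_sum hmem N, by simpa using h3⟩

lemma continuous_spaceErr (μ ρ T : ℝ) : Continuous fun p : ℝ × ℝ => spaceErr μ ρ T p.1 p.2 := by
  have := continuous_exactFourier μ ρ T
  unfold spaceErr spaceRel
  simp only [Complex.mk_eq_add_mul_I]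
  fun_prop

lemma norm_spaceRel_le {ρ T : ℝ} (μ m ξ : ℝ) (hρ0 : 0 ≤ ρ) (hρ1 : ρ ≤ 1) (hT : 0 ≤ T) :
    ‖spaceRel μ ρ T m ξ‖ ≤ ((1 + |μ|) * T + |m|) * (1 + |ξ|) ^ 4 := by
  have hξ := abs_nonneg ξ
  have hμ := abs_nonneg μ
  have h34 : |ξ| ^ 3 ≤ (1 + |ξ|) ^ 4 :=
    (pow_le_pow_left₀ hξ (by linarith) 3).trans (pow_le_pow_right₀ (by linarith) (by norm_num))
  have h44 : |ξ| ^ 4 ≤ (1 + |ξ|) ^ 4 := pow_le_pow_left₀ hξ (by linarith) 4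
  refine (Complex.norm_le_abs_re_add_abs_im _).trans ?_
  simp only [spaceRel]
  set Q := (1 + |ξ|) ^ 4
  have hρs : √ρ ≤ 1 := Real.sqrt_le_one.2 hρ1
  have h1 : |(ξ ^ 4 / 24 - ρ * ξ ^ 4 / 6) * T| ≤ Q * T := by
    rw [show ξ ^ 4 / 24 - ρ * ξ ^ 4 / 6 = (1 / 24 - ρ / 6) * ξ ^ 4 by ring, abs_mul, abs_mul,
      abs_pow, abs_of_nonneg hT]
    have : |1 / 24 - ρ / 6| ≤ 1 := abs_le.2 ⟨by linarith, by linarith⟩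
    calc _ ≤ 1 * Q * T := by gcongr
      _ = _ := by ring
  have h2 : |μ * ξ ^ 3 / 6 * T| ≤ |μ| * Q * T := by
    rw [abs_mul, abs_div, abs_mul, abs_pow, abs_of_nonneg hT,
      abs_of_pos (by norm_num : (0 : ℝ) < 6)]
    gcongr
    exact (div_le_self (by positivity) (by norm_num)).trans (by gcongr)
  have h3 : |√ρ * ξ ^ 3 / 6 * m| ≤ Q * |m| := by
    rw [abs_mul, abs_div, abs_mul, abs_pow, abs_of_nonneg (Real.sqrt_nonneg ρ),
      abs_of_pos (by norm_num : (0 : ℝ) < 6)]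
    gcongr
    refine (div_le_self (by positivity) (by norm_num)).trans ?_
    calc _ ≤ 1 * Q := by gcongr
      _ = Q := one_mul Q
  calc _ ≤ Q * T + (|μ| * Q * T + Q * |m|) :=
        add_le_add h1 ((abs_add_le _ _).trans (add_le_add h2 h3))
    _ = _ := by ring

lemma exists_sqMomentLE_spaceErr (μ : ℝ) {ρ T : ℝ} (hρ0 : 0 ≤ ρ) (hρ1 : ρ ≤ 1) (hT : 0 ≤ T) :
    ∃ C, 0 ≤ C ∧ ∀ {Z : ℕ → Ω → ℝ}, IsStdNormalSeq Z P → ∀ (N : ℕ) {k : ℝ}, 0 ≤ k → N * k = T →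
      ∀ ξ, SqMomentLE P (fun ω => spaceErr μ ρ T (√k * ∑ n ∈ Finset.range N, Z n ω) ξ)
        (C * polyGauss 8 ((1 - ρ) * T) ξ) := by
  refine ⟨2 * (((1 + |μ|) * T) ^ 2 + T), by positivity, fun {Z} hZ N k hk hN ξ => ?_⟩
  have := hZ.indep.isProbabilityMeasure
  refine SqMomentLE.exactFourier_mul μ ρ T _ ?_
  obtain ⟨hm, hle⟩ := hZ.integral_sq_sum_le N
  have h1 : SqMomentLE P (fun ω => (((1 + |μ|) * T : ℝ) : ℂ)) (((1 + |μ|) * T) ^ 2) :=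
    sqMomentLE_of_norm_le fun ω => by
      rw [Complex.norm_real, Real.norm_of_nonneg (by positivity)]
  have h2 : SqMomentLE P (fun ω => ((|√k * ∑ n ∈ Finset.range N, Z n ω| : ℝ) : ℂ)) T := by
    have := (sqMomentLE_of_memLp hm hle).mul_left (g := fun _ => (√k : ℂ)) (K := √k)
      fun ω => by rw [Complex.norm_real, Real.norm_of_nonneg (Real.sqrt_nonneg k)]
    rw [Real.sq_sqrt hk, mul_comm, hN] at this
    refine le_trans (lintegral_mono fun ω => le_of_eq ?_) this
    congr 1
    rw [← ofReal_norm, ← ofReal_norm, norm_mul, Complex.norm_real, Complex.norm_real,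
      Complex.norm_real, Real.norm_eq_abs, Real.norm_eq_abs, Real.norm_eq_abs, abs_abs, abs_mul]
  have h3 := (h1.add h2 (by positivity) hT measurable_const).mul_left
    (g := fun _ => (((1 + |ξ|) ^ 4 : ℝ) : ℂ)) (K := (1 + |ξ|) ^ 4)
    fun ω => by rw [Complex.norm_real, Real.norm_of_nonneg (by positivity)]
  refine (le_trans (lintegral_mono fun ω => ?_) h3).trans
    (ENNReal.ofReal_le_ofReal (le_of_eq (by ring)))
  gcongr
  beta_reduce
  rw [← ofReal_norm, ← ofReal_norm, ← Complex.ofReal_add, ← Complex.ofReal_mul, Complex.norm_real,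
    Real.norm_of_nonneg (by positivity)]
  refine ENNReal.ofReal_le_ofReal ((norm_spaceRel_le μ _ ξ hρ0 hρ1 hT).trans_eq ?_)
  ring

lemma sqMomentLE_amplProd (hZ : IsStdNormalSeq Z P) (s : Scheme) (μ : ℝ) {ρ k h : ℝ}
    (hρ0 : 0 ≤ ρ) (hk : 0 ≤ k) (hh : 0 < h) (N : ℕ) (ξ : ℝ) :
    SqMomentLE P (fun ω => amplProd s μ ρ h k (fun n => Z n ω) N ξ)
      (((1 + 2 * ρ * (k * symB h ξ) + 2 * ρ ^ 2 * (k * symB h ξ) ^ 2) /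
        (1 + k * symB h ξ) ^ 2) ^ N) := by
  unfold SqMomentLE amplProd
  rw [hZ.lintegral_prod_enorm_sq (continuous_ampl_right s μ ρ h k ξ).measurable,
    lintegral_enorm_ampl_sq, ← ENNReal.ofReal_pow (integral_nonneg fun z => by positivity)]
  refine ENNReal.ofReal_le_ofReal ?_
  gcongr
  exact integral_norm_ampl_sq_le s μ hρ0 hk hh

/-- The N step bounds multiply to exp(-cNk `symB`); Nk = T and the quadratic lower bound for `symB`
give a Gaussian in ξ that does not depend on h and k. -/
lemma sqMomentLE_goodBand (hZ : IsStdNormalSeq Z P) (s : Scheme) (μ : ℝ) {ρ k h T : ℝ}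
    (hρ0 : 0 ≤ ρ) (hρ1 : ρ < 1) (hρ2 : 2 * ρ ^ 2 ≤ 1) (hk : 0 ≤ k) (hh : 0 < h) {N : ℕ}
    (hN : N * k = T) (ξ : ℝ) :
    SqMomentLE P (fun ω => (goodBand h k).indicator (amplProd s μ ρ h k (fun n => Z n ω) N) ξ)
      (polyGauss 0 (4 * (1 - ρ) * T / (9 * Real.pi ^ 2)) ξ) := by
  by_cases hξ : ξ ∈ goodBand h k
  swap
  · simp only [Set.indicator_of_notMem hξ]
    exact sqMomentLE_zero
  simp only [Set.indicator_of_mem hξ]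
  refine (sqMomentLE_amplProd hZ s μ hρ0 hk hh N ξ).mono ?_
  have hx0 : 0 ≤ k * symB h ξ := mul_nonneg hk (symB_nonneg h ξ)
  have hs := stability_small hρ1 hρ2 hx0 hξ.2
  have hB := le_symB hh (abs_mul_le_pi hh hξ.1)
  have hρ' : 0 ≤ 1 - ρ := by linarith
  calc _ ≤ (Real.exp (-(2 * (1 - ρ) / 9 * (k * symB h ξ)))) ^ N := by
        gcongr
    _ = Real.exp (-(2 * (1 - ρ) / 9 * (N * k * symB h ξ))) := by
        rw [← Real.exp_nat_mul]; congr 1; ring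
    _ ≤ Real.exp (-(2 * (1 - ρ) / 9 * (N * k * (2 / Real.pi ^ 2 * ξ ^ 2)))) := by
        gcongr
    _ = _ := by
        rw [polyGauss, pow_zero, one_mul, hN]
        congr 1
        have := Real.pi_pos
        field_simp
        ring

end

/-! ### The remainder in Fourier space. -/

section

variable {Ω : Type*} [MeasurableSpace Ω] {P : Measure Ω} {Z : ℕ → Ω → ℝ}

/-- Ratio of the amplification factors of one step of the scheme and of the exact solution. -/
noncomputable def fullRatio (s : Scheme) (μ ρ h k ξ z : ℝ) : ℂ :=
  stepRatio (√(ρ * k) * ξ) (√(ρ * k) * symA h ξ) (ρ * k * s.symC h ξ) (symD μ k h ξ)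
    (baseD μ k ξ) z

/-- Leading part of the difference between `fullRatio` and `baseRatio`. -/
noncomputable def ratioLin (μ ρ h k ξ z : ℝ) : ℂ :=
  stepLin (√(ρ * k) * ξ) (h ^ 2 * ξ ^ 2 * (√(ρ * k) * ξ) / 6) (linD μ k h ξ) z

/-- What remains in Fourier space of the error of the scheme after the leading terms. -/
noncomputable def remErr (s : Scheme) (μ ρ h k T m : ℝ) (z : ℕ → ℝ) (N : ℕ) (ξ : ℝ) : ℂ :=
  (goodBand h k).indicator (amplProd s μ ρ h k z N) ξ - exactFourier μ ρ T m ξ -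
    timeErr μ ρ k T m z N ξ - ((h ^ 2 : ℝ) : ℂ) * spaceErr μ ρ T m ξ

/-- The exact factors multiply up to `exactFourier` because their exponents add, using Nk = T and
the value of M_T as the sum of the increments. -/
lemma amplProd_eq_mul_prod (s : Scheme) {μ ρ h k T m ξ : ℝ} {z : ℕ → ℝ} {N : ℕ} (hρ : 0 ≤ ρ)
    (hk : 0 ≤ k) (hN : N * k = T) (hm : m = √k * ∑ n ∈ Finset.range N, z n) :
    amplProd s μ ρ h k z N ξ =
      exactFourier μ ρ T m ξ * ∏ n ∈ Finset.range N, fullRatio s μ ρ h k ξ (z n) := by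
  have e : ∀ n, fullRatio s μ ρ h k ξ (z n) = ampl s μ ρ h k ξ (z n) *
      Complex.exp (baseD μ k ξ - ((√(ρ * k) * ξ) ^ 2 / 2 : ℝ) +
        Complex.I * (√(ρ * k) * ξ * z n : ℝ)) := fun n => rfl
  simp_rw [e]
  rw [Finset.prod_mul_distrib, ← Complex.exp_sum, ← amplProd, mul_left_comm, exactFourier,
    ← Complex.exp_add]
  refine (mul_right_eq_self₀.2 (Or.inl ?_)).symm
  rw [← Complex.exp_zero]
  congr 1
  rw [Finset.sum_add_distrib, Finset.sum_const, Finset.card_range, ← Finset.mul_sum,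
    ← Complex.ofReal_sum, ← Finset.mul_sum, hm, ← hN, baseD, Complex.mk_eq_add_mul_I, mul_pow,
    Real.sq_sqrt (by positivity), Real.sqrt_mul hρ, nsmul_eq_mul]
  push_cast
  ring

/-- Each summand is affine in the increment, so the sum sees only T and M_T. This is why E₂ depends
on neither h nor k. -/
lemma sum_ratioLin {μ ρ h k T m ξ : ℝ} {z : ℕ → ℝ} {N : ℕ} (hρ : 0 ≤ ρ)
    (hk : 0 ≤ k) (hN : N * k = T) (hm : m = √k * ∑ n ∈ Finset.range N, z n) :
    ∑ n ∈ Finset.range N, ratioLin μ ρ h k ξ (z n) = ((h ^ 2 : ℝ) : ℂ) * spaceRel μ ρ T m ξ := by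
  simp only [ratioLin, stepLin]
  rw [Finset.sum_add_distrib, Finset.sum_const, Finset.card_range, ← Finset.mul_sum,
    ← Complex.ofReal_sum, ← Finset.mul_sum, hm, ← hN, linD, spaceRel, Complex.mk_eq_add_mul_I,
    Complex.mk_eq_add_mul_I, nsmul_eq_mul,
    show h ^ 2 * ξ ^ 2 * (√(ρ * k) * ξ) / 6 * (√(ρ * k) * ξ) =
      h ^ 2 * ξ ^ 4 * (√(ρ * k) ^ 2) / 6 by ring,
    Real.sq_sqrt (by positivity), Real.sqrt_mul hρ]
  push_cast
  ring

lemma remErr_eq (s : Scheme) {μ ρ h k T m ξ : ℝ} {z : ℕ → ℝ} {N : ℕ} (hρ : 0 ≤ ρ)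
    (hk : 0 ≤ k) (hN : N * k = T) (hm : m = √k * ∑ n ∈ Finset.range N, z n)
    (hg : ξ ∈ goodBand h k) (hcut : k * (1 + |ξ|) ^ 2 ≤ 1) :
    remErr s μ ρ h k T m z N ξ = exactFourier μ ρ T m ξ *
      (prodRem (fun z => fullRatio s μ ρ h k ξ z - 1) z N +
        ∑ n ∈ Finset.range N, (fullRatio s μ ρ h k ξ (z n) - baseRatio μ ρ k ξ (z n) -
          ratioLin μ ρ h k ξ (z n))) := by
  rw [remErr, Set.indicator_of_mem hg, timeErr, if_pos hcut, baseErr, spaceErr, mul_left_comm,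
    ← sum_ratioLin (h := h) hρ hk hN hm, amplProd_eq_mul_prod s hρ hk hN hm, prodRem]
  simp only [add_sub_cancel, Finset.sum_sub_distrib]
  ring

lemma mem_goodBand {h k ξ L : ℝ} (hh : 0 < h) (hk : 0 ≤ k) (hξ : |ξ| ≤ L) (hhL : h * L ≤ 1)
    (hkL : k * L ^ 2 ≤ 1) : ξ ∈ goodBand h k := by
  have h1 : L < Real.pi / h := by
    rw [lt_div_iff₀ hh]
    linarith [Real.pi_gt_three]
  have h2 := abs_le.1 hξ
  refine ⟨⟨by linarith, by linarith⟩, ?_⟩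
  have h3 : ξ ^ 2 ≤ L ^ 2 := by rw [← sq_abs ξ]; gcongr
  calc k * symB h ξ ≤ k * (L ^ 2) := by
        gcongr
        have := symB_le h ξ hh
        nlinarith [sq_nonneg ξ]
    _ ≤ 2 := by linarith

/-- Bounds for the accumulated errors in the regime `(k + h²) L⁴ ≤ 1`. -/
lemma prodRem_arith {C k h L T : ℝ} {N : ℝ} (hC : 0 ≤ C) (hk : 0 ≤ k) (hL : 1 ≤ L) (hN0 : 0 ≤ N)
    (hN : N * k = T) (hε : (k + h ^ 2) * L ^ 4 ≤ 1) :
    N * (2 * (C * (k * L ^ 2 * ((k + h ^ 2) * L ^ 2)) + C * (k * L ^ 2 * ((k + h ^ 2) * L ^ 2) ^ 2)) *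
      (N * (C * (k * L ^ 2 * ((k + h ^ 2) * L ^ 2) ^ 2)) +
        N ^ 2 * (C * (k * L ^ 2 * ((k + h ^ 2) * L ^ 2))) ^ 2)) *
      Real.exp (3 * (C * (k * L ^ 2 * ((k + h ^ 2) * L ^ 2)) +
        C * (k * L ^ 2 * ((k + h ^ 2) * L ^ 2) ^ 2)) * N) ≤
    4 * T * C * (T * C + T ^ 2 * C ^ 2) * Real.exp (6 * T * C) * (k + h ^ 2) ^ 3 * L ^ 12 := by
  have hT : 0 ≤ T := hN ▸ mul_nonneg hN0 hk
  set ε := k + h ^ 2 with hεdef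
  have hε0 : 0 ≤ ε := by positivity
  have hL24 : L ^ 2 ≤ L ^ 4 := pow_le_pow_right₀ hL (by norm_num)
  have hεL2 : ε * L ^ 2 ≤ 1 := (mul_le_mul_of_nonneg_left hL24 hε0).trans hε
  have hL68 : L ^ 6 ≤ L ^ 8 := pow_le_pow_right₀ hL (by norm_num)
  have hq : ε ^ 2 * L ^ 6 ≤ ε * L ^ 4 := by
    calc ε ^ 2 * L ^ 6 = (ε * L ^ 4) * (ε * L ^ 2) := by ring
      _ ≤ (ε * L ^ 4) * 1 := by gcongr
      _ = _ := mul_one _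
  have e1 : N * (C * (k * L ^ 2 * (ε * L ^ 2)) + C * (k * L ^ 2 * (ε * L ^ 2) ^ 2)) =
      T * C * (ε * L ^ 4 + ε ^ 2 * L ^ 6) := by rw [← hN]; ring
  have e2 : N * (C * (k * L ^ 2 * (ε * L ^ 2) ^ 2)) + N ^ 2 * (C * (k * L ^ 2 * (ε * L ^ 2))) ^ 2 =
      T * C * (ε ^ 2 * L ^ 6) + T ^ 2 * C ^ 2 * (ε ^ 2 * L ^ 8) := by rw [← hN]; ring
  have b1 : T * C * (ε * L ^ 4 + ε ^ 2 * L ^ 6) ≤ T * C * (2 * (ε * L ^ 4)) := by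
    gcongr; linarith
  have b1' : T * C * (2 * (ε * L ^ 4)) ≤ T * C * (2 * 1) := by gcongr
  have b2 : T * C * (ε ^ 2 * L ^ 6) + T ^ 2 * C ^ 2 * (ε ^ 2 * L ^ 8) ≤
      T * C * (ε ^ 2 * L ^ 8) + T ^ 2 * C ^ 2 * (ε ^ 2 * L ^ 8) := by gcongr
  set τ := C * (k * L ^ 2 * (ε * L ^ 2)) + C * (k * L ^ 2 * (ε * L ^ 2) ^ 2) with hτ
  rw [e2]
  calc _ = 2 * (N * τ) * (T * C * (ε ^ 2 * L ^ 6) + T ^ 2 * C ^ 2 * (ε ^ 2 * L ^ 8)) *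
        Real.exp (3 * (N * τ)) := by ring_nf
    _ ≤ 2 * (T * C * (2 * (ε * L ^ 4))) * (T * C * (ε ^ 2 * L ^ 8) + T ^ 2 * C ^ 2 * (ε ^ 2 * L ^ 8)) *
        Real.exp (3 * (T * C * (2 * 1))) := by
        rw [e1]
        refine mul_le_mul (mul_le_mul (by linarith) b2 (by positivity) (by positivity))
          (Real.exp_le_exp.2 (by linarith)) (by positivity) (by positivity)
    _ = _ := by ring_nf

lemma sum_diff_arith {C k h L T : ℝ} {N : ℝ} (hC : 0 ≤ C) (hk : 0 ≤ k) (hL : 1 ≤ L) (hN0 : 0 ≤ N)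
    (hN : N * k = T) (hε : (k + h ^ 2) * L ^ 4 ≤ 1) :
    N * (C * ((√k * L) ^ 2 * (h ^ 2 * L ^ 2) + √k * L * (h ^ 2 * L ^ 2) ^ 2) ^ 2) +
      N ^ 2 * (C * ((√k * L) ^ 2 * (h ^ 2 * L ^ 2) ^ 2 + (√k * L) ^ 4 * (h ^ 2 * L ^ 2))) ^ 2 ≤
    (4 * T * C + T ^ 2 * C ^ 2) * (k + h ^ 2) ^ 3 * L ^ 12 := by
  have hT : 0 ≤ T := hN ▸ mul_nonneg hN0 hk
  have hs : √k ^ 2 = k := Real.sq_sqrt hk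
  have e4 : (√k * L) ^ 4 = k ^ 2 * L ^ 4 := by
    rw [mul_pow, show √k ^ 4 = (√k ^ 2) ^ 2 by ring, hs]
  have e2 : (√k * L) ^ 2 = k * L ^ 2 := by rw [mul_pow, hs]
  set ε := k + h ^ 2 with hεdef
  have hh : 0 ≤ h ^ 2 := sq_nonneg h
  have hε0 : 0 ≤ ε := by positivity
  have hkε : k ≤ ε := by linarith
  have hhε : h ^ 2 ≤ ε := by linarith
  have hε1 : ε ≤ 1 := by
    refine le_trans ?_ hε
    exact le_mul_of_one_le_right hε0 (one_le_pow₀ hL)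
  have hL24 : L ^ 2 ≤ L ^ 4 := pow_le_pow_right₀ hL (by norm_num)
  have hhL2 : h ^ 2 * L ^ 2 ≤ 1 := by
    refine le_trans ?_ hε
    gcongr
  have hL8 : L ^ 8 ≤ L ^ 12 := pow_le_pow_right₀ hL (by norm_num)
  have b1 : ((√k * L) ^ 2 * (h ^ 2 * L ^ 2) + √k * L * (h ^ 2 * L ^ 2) ^ 2) ^ 2 ≤
      k * (2 * (k * (h ^ 2) ^ 2 * L ^ 8) + 2 * ((h ^ 2) ^ 3 * L ^ 8 * (h ^ 2 * L ^ 2))) := by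
    calc _ ≤ 2 * ((√k * L) ^ 2 * (h ^ 2 * L ^ 2)) ^ 2 + 2 * (√k * L * (h ^ 2 * L ^ 2) ^ 2) ^ 2 := by
          nlinarith [sq_nonneg ((√k * L) ^ 2 * (h ^ 2 * L ^ 2) - √k * L * (h ^ 2 * L ^ 2) ^ 2)]
      _ = 2 * ((√k * L) ^ 2 * (h ^ 2 * L ^ 2)) ^ 2 + 2 * ((√k * L) ^ 2 * (h ^ 2 * L ^ 2) ^ 4) := by
          ring
      _ = _ := by rw [e2]; ring
  have b2 : 2 * (k * (h ^ 2) ^ 2 * L ^ 8) + 2 * ((h ^ 2) ^ 3 * L ^ 8 * (h ^ 2 * L ^ 2)) ≤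
      4 * (ε ^ 3 * L ^ 12) := by
    calc _ ≤ 2 * (ε * ε ^ 2 * L ^ 12) + 2 * (ε ^ 3 * L ^ 12 * 1) := by gcongr
      _ = _ := by ring
  have e3 : (√k * L) ^ 2 * (h ^ 2 * L ^ 2) ^ 2 + (√k * L) ^ 4 * (h ^ 2 * L ^ 2) =
      k * (L ^ 6 * h ^ 2 * ε) := by rw [e2, e4, hεdef]; ring
  rw [e3]
  calc _ ≤ N * (C * (k * (4 * (ε ^ 3 * L ^ 12)))) + N ^ 2 * (C * (k * (L ^ 6 * h ^ 2 * ε))) ^ 2 := by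
        gcongr
        exact b1.trans (by gcongr)
    _ = (N * k) * C * (4 * (ε ^ 3 * L ^ 12)) + (N * k) ^ 2 * C ^ 2 * L ^ 12 * ((h ^ 2) ^ 2 * ε ^ 2) := by
        ring
    _ ≤ T * C * (4 * (ε ^ 3 * L ^ 12)) + T ^ 2 * C ^ 2 * L ^ 12 * (ε ^ 2 * (ε * 1)) := by
        rw [hN]
        refine add_le_add le_rfl (mul_le_mul_of_nonneg_left ?_ (by positivity))
        calc (h ^ 2) ^ 2 * ε ^ 2 ≤ ε ^ 2 * ε ^ 2 := by gcongr
          _ = ε ^ 2 * (ε * ε) := by ring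
          _ ≤ _ := by gcongr
    _ = _ := by ring

lemma polyGauss_le {n n' : ℕ} {c c' : ℝ} (hn : n ≤ n') (hc : c' ≤ c) (ξ : ℝ) :
    polyGauss n c ξ ≤ polyGauss n' c' ξ := by
  unfold polyGauss
  have : 1 ≤ 1 + |ξ| := by linarith [abs_nonneg ξ]
  gcongr

lemma measurable_comp_of_continuous {f : ℝ → ℝ → ℂ} (hf : Continuous fun p : ℝ × ℝ => f p.1 p.2)
    {m : Ω → ℝ} (hm : Measurable m) : Measurable fun p : ℝ × Ω => f p.1 (m p.2) :=
  hf.measurable.comp (measurable_fst.prodMk (hm.comp measurable_snd))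

lemma measurable_comp_swap_of_continuous {f : ℝ → ℝ → ℂ}
    (hf : Continuous fun p : ℝ × ℝ => f p.1 p.2) {m : Ω → ℝ} (hm : Measurable m) :
    Measurable fun p : ℝ × Ω => f (m p.2) p.1 :=
  hf.measurable.comp ((hm.comp measurable_snd).prodMk measurable_fst)

lemma measurable_uncurry_exactFourier (μ ρ T : ℝ) {m : Ω → ℝ} (hm : Measurable m) :
    Measurable (Function.uncurry fun ξ ω => exactFourier μ ρ T (m ω) ξ) :=
  measurable_comp_swap_of_continuous (continuous_exactFourier μ ρ T) hm

lemma measurable_uncurry_spaceErr (μ ρ T : ℝ) {m : Ω → ℝ} (hm : Measurable m) :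
    Measurable (Function.uncurry fun ξ ω => spaceErr μ ρ T (m ω) ξ) :=
  measurable_comp_swap_of_continuous (continuous_spaceErr μ ρ T) hm

lemma measurable_uncurry_timeErr (μ ρ T : ℝ) {k : ℝ} (hk : 0 ≤ k) {m : Ω → ℝ} (hm : Measurable m)
    (hZ : ∀ n, Measurable (Z n)) (N : ℕ) :
    Measurable (Function.uncurry fun ξ ω => timeErr μ ρ k T (m ω) (fun n => Z n ω) N ξ) := by
  have hX := measurable_uncurry_exactFourier μ ρ T hm
  have hB : Measurable fun p : ℝ × Ω => baseErr μ ρ k (fun n => Z n p.2) N p.1 :=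
    Finset.measurable_sum _ fun n _ =>
      (measurable_comp_of_continuous (continuous_baseRatio μ ρ hk) (hZ n)).sub_const 1
  refine Measurable.ite ?_ (hX.mul hB) measurable_const
  exact measurableSet_le (by fun_prop) measurable_const

lemma measurable_uncurry_indicator_amplProd (s : Scheme) (μ ρ h : ℝ) {k : ℝ} (hk : 0 ≤ k)
    (hZ : ∀ n, Measurable (Z n)) (N : ℕ) {S : Set ℝ} (hS : MeasurableSet S) :
    Measurable (Function.uncurry fun ξ ω =>
      S.indicator (amplProd s μ ρ h k (fun n => Z n ω) N) ξ) := by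
  have hA : Measurable fun p : ℝ × Ω => amplProd s μ ρ h k (fun n => Z n p.2) N p.1 :=
    Finset.measurable_prod _ fun n _ =>
      measurable_comp_of_continuous (continuous_ampl_prod s μ ρ h hk) (hZ n)
  exact hA.indicator (measurable_fst hS : MeasurableSet (Prod.fst ⁻¹' S : Set (ℝ × Ω)))

/-- In this range ξ lies in the good band and below the cutoff, so the leading terms cancel exactly;
what remains is the nonlinear part of the product and the non-linearised part of the step errors. -/
lemma sqMomentLE_remErr_low (μ : ℝ) {ρ T : ℝ} (hρ0 : 0 ≤ ρ) (hρ1 : ρ ≤ 1) (hT : 0 ≤ T) :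
    ∃ C, 0 ≤ C ∧ ∀ {Z : ℕ → Ω → ℝ}, IsStdNormalSeq Z P → ∀ (s : Scheme) (N : ℕ) {k h : ℝ},
      0 ≤ k → 0 < h → N * k = T → ∀ ξ, (k + h ^ 2) * (1 + |ξ|) ^ 4 ≤ 1 →
      SqMomentLE P (fun ω => remErr s μ ρ h k T (√k * ∑ n ∈ Finset.range N, Z n ω)
        (fun n => Z n ω) N ξ) ((k + h ^ 2) ^ 3 * C * polyGauss 12 ((1 - ρ) * T) ξ) := by
  obtain ⟨C, hC, hM⟩ := exists_stepMoments (2 * (1 + |μ|))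
  refine ⟨2 * (4 * T * C * (T * C + T ^ 2 * C ^ 2) * Real.exp (6 * T * C) +
    (4 * T * C + T ^ 2 * C ^ 2)), by positivity, fun {Z} hZ s N k h hk hh hN ξ hε => ?_⟩
  have hL1 : 1 ≤ 1 + |ξ| := by linarith [abs_nonneg ξ]
  have hξL : |ξ| ≤ 1 + |ξ| := by linarith
  set L := 1 + |ξ| with hL
  have hL24 : L ^ 2 ≤ L ^ 4 := pow_le_pow_right₀ hL1 (by norm_num)
  have hk2 : k * L ^ 2 ≤ 1 := by
    refine le_trans ?_ hε
    gcongr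
    nlinarith
  have hh2 : h ^ 2 * L ^ 2 ≤ 1 := by
    refine le_trans ?_ hε
    gcongr
    linarith
  have hhL : h * L ≤ 1 := (sq_le_one_iff₀ (by positivity)).1 (by rw [mul_pow]; exact hh2)
  have hg : ξ ∈ goodBand h k := mem_goodBand hh hk hξL hhL hk2
  have e : ∀ ω, remErr s μ ρ h k T (√k * ∑ n ∈ Finset.range N, Z n ω) (fun n => Z n ω) N ξ = _ :=
    fun ω => remErr_eq s hρ0 hk hN rfl hg hk2
  simp_rw [e]
  have hSM := hM (stepBounds_symbols s hρ0 hρ1 hk hh hL1 hξL hk2 hh2)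
  have hmf : Measurable fun z => fullRatio s μ ρ h k ξ z :=
    (continuous_stepRatio _ _ _ _ _).measurable
  have hmb : Measurable fun z => baseRatio μ ρ k ξ z :=
    (continuous_stepRatio _ _ _ _ _).measurable
  have hml : Measurable fun z => ratioLin μ ρ h k ξ z :=
    (continuous_stepLin _ _ _).measurable
  have hLf : MemLp (fun z => fullRatio s μ ρ h k ξ z - 1) 2 (gaussianReal 0 1) := hSM.memLp_full
  have hLd : MemLp (fun z => fullRatio s μ ρ h k ξ z - baseRatio μ ρ k ξ z -
    ratioLin μ ρ h k ξ z) 2 (gaussianReal 0 1) := hSM.memLp_diff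
  have hmd' : Measurable fun z => fullRatio s μ ρ h k ξ z - baseRatio μ ρ k ξ z -
    ratioLin μ ρ h k ξ z := (hmf.sub hmb).sub hml
  have hmf1 : Measurable fun z => fullRatio s μ ρ h k ξ z - 1 := hmf.sub_const 1
  have hs2 : (√k * L) ^ 2 = k * L ^ 2 := by rw [mul_pow, Real.sq_sqrt hk]
  have hd : ‖∫ z, (fullRatio s μ ρ h k ξ z - 1) ∂gaussianReal 0 1‖ ≤
      C * (k * L ^ 2 * ((k + h ^ 2) * L ^ 2)) := by
    have := hSM.mean_full
    rwa [hs2, ← add_mul] at this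
  have hq : ∫ z, ‖fullRatio s μ ρ h k ξ z - 1‖ ^ 2 ∂gaussianReal 0 1 ≤
      C * (k * L ^ 2 * ((k + h ^ 2) * L ^ 2) ^ 2) := by
    have := hSM.sq_full
    rwa [hs2, ← add_mul] at this
  have hmd : ‖∫ z, (fullRatio s μ ρ h k ξ z - baseRatio μ ρ k ξ z - ratioLin μ ρ h k ξ z)
      ∂gaussianReal 0 1‖ ≤ _ := hSM.mean_diff
  have hqd : ∫ z, ‖fullRatio s μ ρ h k ξ z - baseRatio μ ρ k ξ z - ratioLin μ ρ h k ξ z‖ ^ 2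
      ∂gaussianReal 0 1 ≤ _ := hSM.sq_diff
  obtain ⟨hR, hRle⟩ := hZ.integral_norm_prodRem_sq_le hmf1 hLf hd hq le_rfl N N le_rfl
  have h1 := sqMomentLE_of_memLp hR (hRle.trans
    (prodRem_arith hC hk hL1 (Nat.cast_nonneg N) hN hε))
  have h2 := sqMomentLE_of_memLp (hZ.memLp_sum hLd N)
    ((hZ.integral_norm_sum_sq_le hmd' hLd N).trans
      ((add_le_add (mul_le_mul_of_nonneg_left hqd (Nat.cast_nonneg N))
        (mul_le_mul_of_nonneg_left (pow_le_pow_left₀ (norm_nonneg _) hmd 2) (by positivity))).trans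
        (sum_diff_arith hC hk hL1 (Nat.cast_nonneg N) hN hε)))
  have hmR : Measurable fun ω => prodRem (fun z => fullRatio s μ ρ h k ξ z - 1)
      (fun n => Z n ω) N := by
    unfold prodRem
    refine Measurable.sub (Measurable.sub_const ?_ 1) ?_
    · exact Finset.measurable_prod _ fun n _ => (hmf1.comp (hZ.measurable n)).const_add 1
    · exact Finset.measurable_sum _ fun n _ => hmf1.comp (hZ.measurable n)
  have h3 := h1.add h2 (by positivity) (by positivity) hmR
  refine (SqMomentLE.exactFourier_mul μ ρ T (fun ω => √k * ∑ n ∈ Finset.range N, Z n ω)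
    (h3.mono (le_of_eq ?_)))
  ring

/-- At high wave numbers nothing has to cancel: each of the four terms is small by itself, being
dominated by a Gaussian where (k + h²)L⁴ > 1. -/
lemma exists_sqMomentLE_remErr (μ : ℝ) {ρ T : ℝ} (hρ0 : 0 ≤ ρ) (hρ1 : ρ < 1)
    (hρ2 : 2 * ρ ^ 2 ≤ 1) (hT : 0 ≤ T) :
    ∃ C, 0 ≤ C ∧ ∀ {Z : ℕ → Ω → ℝ}, IsStdNormalSeq Z P → ∀ (s : Scheme) (N : ℕ) {k h : ℝ},
      0 ≤ k → 0 < h → N * k = T → ∀ ξ,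
      SqMomentLE P (fun ω => remErr s μ ρ h k T (√k * ∑ n ∈ Finset.range N, Z n ω)
        (fun n => Z n ω) N ξ)
        ((k + h ^ 2) ^ 3 * C * polyGauss 20 (4 * (1 - ρ) * T / (9 * Real.pi ^ 2)) ξ) := by
  obtain ⟨C₀, hC₀, h₀⟩ := sqMomentLE_remErr_low (P := P) μ hρ0 hρ1.le hT
  obtain ⟨C₁, hC₁, h₁⟩ := exists_sqMomentLE_timeErr (P := P) μ hρ0 hρ1.le hT
  obtain ⟨C₂, hC₂, h₂⟩ := exists_sqMomentLE_spaceErr (P := P) μ hρ0 hρ1.le hT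
  refine ⟨16 + 4 * C₁ + 2 * C₂ + C₀, by positivity, fun {Z} hZ s N k h hk hh hN ξ => ?_⟩
  have := hZ.indep.isProbabilityMeasure
  have hρ' : 0 ≤ 1 - ρ := by linarith
  set c := 4 * (1 - ρ) * T / (9 * Real.pi ^ 2) with hc
  have hcκ : c ≤ (1 - ρ) * T := by
    rw [hc, div_le_iff₀ (by positivity)]
    have h3 := Real.pi_gt_three
    have : (1 - ρ) * T * 4 ≤ (1 - ρ) * T * (9 * Real.pi ^ 2) := by
      gcongr
      nlinarith
    linarith
  set ε := k + h ^ 2 with hε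
  have hε0 : 0 ≤ ε := by positivity
  have hpg := polyGauss_nonneg 20 c ξ
  rcases le_or_gt (ε * (1 + |ξ|) ^ 4) 1 with hlow | hhigh
  · refine (h₀ hZ s N hk hh hN ξ hlow).mono ?_
    have := polyGauss_nonneg 12 ((1 - ρ) * T) ξ
    refine mul_le_mul (mul_le_mul_of_nonneg_left (by linarith) (by positivity))
      (polyGauss_le (by norm_num) hcκ ξ) this (by positivity)
  have hL1 : 1 ≤ 1 + |ξ| := by linarith [abs_nonneg ξ]
  set L := 1 + |ξ| with hL
  -- The cube of (k + h²)L⁴ > 1 supplies the factor (k + h²)³ at the cost of L¹². Terms already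
  -- carrying k² or h⁴ need only one such factor.
  have g0 : polyGauss 0 c ξ ≤ ε ^ 3 * polyGauss 20 c ξ := by
    calc polyGauss 0 c ξ = 1 * polyGauss 0 c ξ := (one_mul _).symm
      _ ≤ (ε * L ^ 4) ^ 3 * polyGauss 0 c ξ := by
          gcongr
          · exact polyGauss_nonneg _ _ _
          · exact one_le_pow₀ hhigh.le
      _ = ε ^ 3 * polyGauss 12 c ξ := by unfold polyGauss; ring
      _ ≤ _ := by gcongr; exact polyGauss_le (by norm_num) le_rfl ξ
  have g8 : ∀ x, 0 ≤ x → x ≤ ε → ∀ A, 0 ≤ A →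
      x ^ 2 * A * polyGauss 8 ((1 - ρ) * T) ξ ≤ ε ^ 3 * A * polyGauss 20 c ξ := by
    intro x hx0 hx A hA
    have := polyGauss_nonneg 8 c ξ
    have := polyGauss_nonneg 8 ((1 - ρ) * T) ξ
    calc x ^ 2 * A * polyGauss 8 ((1 - ρ) * T) ξ ≤ ε ^ 2 * A * polyGauss 8 c ξ := by
          gcongr
          exact polyGauss_le le_rfl hcκ ξ
      _ ≤ ε ^ 2 * A * polyGauss 8 c ξ * (ε * L ^ 4) :=
          le_mul_of_one_le_right (by positivity) hhigh.le
      _ = ε ^ 3 * A * polyGauss 12 c ξ := by unfold polyGauss; ring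
      _ ≤ _ := by gcongr; exact polyGauss_le (by norm_num) le_rfl ξ
  set m : Ω → ℝ := fun ω => √k * ∑ n ∈ Finset.range N, Z n ω with hm
  have hmm : Measurable m := (Finset.measurable_sum _ fun n _ => hZ.measurable n).const_mul _
  have a1 := (sqMomentLE_goodBand hZ s μ hρ0 hρ1 hρ2 hk hh hN ξ).mono g0
  have a2 := (sqMomentLE_exactFourier (P := P) μ ρ T m ξ).mono
    ((polyGauss_le le_rfl hcκ ξ).trans g0)
  have a3 := (h₁ hZ m N hk hN ξ).mono (g8 k hk (by linarith [sq_nonneg h]) C₁ hC₁)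
  have a4 := ((h₂ hZ N hk hN ξ).mul_left (g := fun _ => ((h ^ 2 : ℝ) : ℂ)) (K := h ^ 2)
    fun ω => by rw [Complex.norm_real, Real.norm_of_nonneg (by positivity)]).mono
    ((mul_assoc _ _ _).symm.le.trans (g8 (h ^ 2) (by positivity) (by linarith) C₂ hC₂))
  have m1 := (measurable_uncurry_indicator_amplProd s μ ρ h hk hZ.measurable N
    (measurableSet_goodBand h k)).comp (measurable_prodMk_left (x := ξ))
  have m2 := (measurable_uncurry_exactFourier μ ρ T hmm).comp (measurable_prodMk_left (x := ξ))
  have m3 := (measurable_uncurry_timeErr μ ρ T hk hmm hZ.measurable N).comp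
    (measurable_prodMk_left (x := ξ))
  have h12 := a1.sub a2 (by positivity) (by positivity) m1
  have h123 := h12.sub a3 (by positivity) (by positivity) (m1.sub m2)
  have h1234 := h123.sub a4 (by positivity) (by positivity) ((m1.sub m2).sub m3)
  refine h1234.mono ?_
  have : 0 ≤ ε ^ 3 * C₀ * polyGauss 20 c ξ := by positivity
  linarith

end

/-! ### Inverse transforms and the splitting of the error. -/

section

variable {Ω : Type*} [MeasurableSpace Ω] {P : Measure Ω} {Z : ℕ → Ω → ℝ}

/-- Real part of the inverse Fourier transform. -/
noncomputable def invFourier (f : ℝ → ℂ) (y : ℝ) : ℝ :=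
  1 / (2 * Real.pi) * (∫ ξ, f ξ * Complex.exp (Complex.I * (ξ * y : ℝ))).re

lemma integrable_mul_phase {f : ℝ → ℂ} (hf : Integrable f) (y : ℝ) :
    Integrable fun ξ => f ξ * Complex.exp (Complex.I * (ξ * y : ℝ)) := by
  refine hf.norm.mono' (hf.1.mul (by fun_prop)) (ae_of_all _ fun ξ => ?_)
  rw [norm_mul, norm_exp_I_mul, mul_one]

lemma invFourier_add {f g : ℝ → ℂ} (hf : Integrable f) (hg : Integrable g) (y : ℝ) :
    invFourier (fun ξ => f ξ + g ξ) y = invFourier f y + invFourier g y := by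
  simp only [invFourier, add_mul]
  rw [integral_add (integrable_mul_phase hf y) (integrable_mul_phase hg y), Complex.add_re, mul_add]

lemma invFourier_const_mul (c : ℝ) (f : ℝ → ℂ) (y : ℝ) :
    invFourier (fun ξ => (c : ℂ) * f ξ) y = c * invFourier f y := by
  simp only [invFourier, mul_assoc]
  rw [integral_const_mul, Complex.re_ofReal_mul]
  ring

lemma invFourier_zero (y : ℝ) : invFourier (fun _ => 0) y = 0 := by
  simp [invFourier]

lemma SqMomentLE.const_mul_phase {f : Ω → ℂ} {A : ℝ} (hf : SqMomentLE P f A) (c y : ℝ) :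
    SqMomentLE P (fun ω => (c : ℂ) * (f ω * Complex.exp (Complex.I * y))) (c ^ 2 * A) := by
  have := hf.mul_left (g := fun _ => (c : ℂ) * Complex.exp (Complex.I * y)) (K := |c|) fun ω => by
    rw [norm_mul, norm_exp_I_mul, mul_one, Complex.norm_real, Real.norm_eq_abs]
  rw [sq_abs] at this
  refine le_trans (le_of_eq (lintegral_congr fun ω => ?_)) this
  ring_nf

lemma measurable_uncurry_const_mul_phase {f : Ω → ℝ → ℂ}
    (hf : Measurable (Function.uncurry fun ξ ω => f ω ξ)) (c y : ℝ) :
    Measurable (Function.uncurry fun ξ ω =>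
      (c : ℂ) * (f ω ξ * Complex.exp (Complex.I * (ξ * y : ℝ)))) := by
  have : Measurable fun p : ℝ × Ω => Complex.exp (Complex.I * (p.1 * y : ℝ)) := by fun_prop
  exact (hf.mul this).const_mul _

lemma mul_invFourier_eq (c : ℝ) (f : ℝ → ℂ) (y : ℝ) :
    c * invFourier f y = 1 / (2 * Real.pi) *
      (∫ ξ, (c : ℂ) * (f ξ * Complex.exp (Complex.I * (ξ * y : ℝ)))).re := by
  rw [integral_const_mul, Complex.re_ofReal_mul, invFourier]
  ring

/-- The position `y` enters through a phase of modulus 1 only, hence the uniformity in x. -/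
lemma hasBoundedMoments_invFourier [IsProbabilityMeasure P] {ι : Type*} {f : ι → Ω → ℝ → ℂ} (y a : ι → ℝ)
    (hf : ∀ i, Measurable (Function.uncurry fun ξ ω => f i ω ξ)) {A : ι → ℝ} {C c : ℝ} {n : ℕ}
    (hc : 0 < c) (hG : ∀ i ξ, SqMomentLE P (fun ω => f i ω ξ) (A i * polyGauss n c ξ))
    (hA : ∀ i, a i ^ 2 * A i ≤ C) :
    HasBoundedMoments P fun i ω => a i * invFourier (f i ω) (y i) := by
  refine hasBoundedMoments_of_polyGauss (C := C) (n := n) (fun i ω => mul_invFourier_eq _ _ _)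
    (fun i => measurable_uncurry_const_mul_phase (hf i) (a i) (y i)) hc fun i ξ => ?_
  refine ((hG i ξ).const_mul_phase (a i) (ξ * y i)).mono ?_
  rw [← mul_assoc]
  exact mul_le_mul_of_nonneg_right (hA i) (polyGauss_nonneg n c ξ)

/-- Allows the error families to be set to zero at indices that are not admissible, such as h ≤ 0 or
N = 0. -/
lemma HasBoundedMoments.of_subtype {ι : Type*} {p : ι → Prop} {E : ι → Ω → ℝ}
    (h : HasBoundedMoments P fun i : Subtype p => E i) (h0 : ∀ i, ¬ p i → E i = 0) :
    HasBoundedMoments P E := by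
  obtain ⟨C, hC⟩ := h
  refine ⟨max C 0, fun i => ?_⟩
  by_cases hi : p i
  · obtain ⟨h1, h2, h3⟩ := hC ⟨i, hi⟩
    exact ⟨h1, h2.trans (le_max_left _ _), h3.trans (le_max_left _ _)⟩
  · rw [h0 i hi]
    refine ⟨MemLp.zero, ?_, ?_⟩ <;> simp

lemma integrable_exactFourier (μ : ℝ) {ρ T : ℝ} (hρ : ρ < 1) (hT : 0 < T) (m : ℝ) :
    Integrable (exactFourier μ ρ T m) := by
  have hb : 0 < (1 - ρ) * T / 2 := by have := sub_pos.2 hρ; positivity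
  refine (integrable_exp_neg_mul_sq hb).mono' ?_ (ae_of_all _ fun ξ =>
    (norm_exactFourier μ ρ T m ξ).le)
  have h := continuous_exactFourier μ ρ T
  exact (h.comp (continuous_const.prodMk continuous_id)).aestronglyMeasurable

lemma integrable_spaceErr (μ : ℝ) {ρ T : ℝ} (hρ0 : 0 ≤ ρ) (hρ : ρ < 1) (hT : 0 < T) (m : ℝ) :
    Integrable (spaceErr μ ρ T m) := by
  have hb : 0 < (1 - ρ) * T / 2 := by have := sub_pos.2 hρ; positivity
  refine ((integrable_polyGauss 4 hb).const_mul ((1 + |μ|) * T + |m|)).mono' ?_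
    (ae_of_all _ fun ξ => ?_)
  · have h := continuous_spaceErr μ ρ T
    exact (h.comp (continuous_const.prodMk continuous_id)).aestronglyMeasurable
  · rw [spaceErr, norm_mul, norm_exactFourier, polyGauss]
    calc _ ≤ Real.exp (-((1 - ρ) * T / 2) * ξ ^ 2) *
          (((1 + |μ|) * T + |m|) * (1 + |ξ|) ^ 4) := by
          gcongr
          exact norm_spaceRel_le μ m ξ hρ0 hρ.le hT.le
      _ = _ := by ring

lemma integrable_indicator_of_continuous {f : ℝ → ℂ} (hf : Continuous f) {S : Set ℝ}
    (hS : MeasurableSet S) {a b : ℝ} (hab : S ⊆ Set.Icc a b) : Integrable (S.indicator f) :=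
  (integrable_indicator_iff hS).2 (hf.integrableOn_Icc.mono_set hab)

lemma integrable_timeErr (μ ρ T : ℝ) {k : ℝ} (hk : 0 < k) (m : ℝ) (z : ℕ → ℝ) (N : ℕ) :
    Integrable (timeErr μ ρ k T m z N) := by
  have hX : Continuous (exactFourier μ ρ T m) := by
    have h := continuous_exactFourier μ ρ T
    exact h.comp (continuous_const.prodMk continuous_id)
  have hB : Continuous (baseErr μ ρ k z N) := by
    refine continuous_finsetSum _ fun n _ => Continuous.sub ?_ continuous_const
    have h := continuous_baseRatio μ ρ hk.le
    generalize baseRatio μ ρ k = f at h ⊢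
    fun_prop
  have hS : MeasurableSet {ξ : ℝ | k * (1 + |ξ|) ^ 2 ≤ 1} :=
    measurableSet_le (by fun_prop) measurable_const
  refine integrable_indicator_of_continuous (hX.mul hB) hS (a := -(1 / k)) (b := 1 / k)
    fun ξ hξ => ?_
  rw [Set.mem_Icc, ← abs_le, le_div_iff₀ hk]
  have h1 : k * (1 + |ξ|) ^ 2 ≤ 1 := hξ
  nlinarith [abs_nonneg ξ, mul_nonneg hk.le (abs_nonneg ξ), mul_nonneg hk.le (sq_nonneg |ξ|)]

lemma numSol_eq_invFourier (s : Scheme) (μ ρ x₀ : ℝ) {h k : ℝ} (hh : 0 < h) (hk : 0 ≤ k)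
    (z : ℕ → ℝ) (n : ℕ) (x : ℝ) :
    numSol s μ ρ x₀ h k hk z n x =
      invFourier (fun ξ => (goodBand h k).indicator (amplProd s μ ρ h k z n) ξ +
        (badBand h k).indicator (amplProd s μ ρ h k z n) ξ) (x - x₀) := by
  have hle : -(Real.pi / h) ≤ Real.pi / h := by
    have : 0 < Real.pi / h := by have := Real.pi_pos; positivity
    linarith
  rw [numSol, bandIntegral_apply, invFourier, intervalIntegral.integral_of_le hle,
    ← integral_indicator measurableSet_Ioc]
  congr 3
  ext ξ
  have hu := congrFun (Set.indicator_union_of_disjoint (disjoint_goodBand_badBand h k)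
    (amplProd s μ ρ h k z n)) ξ
  rw [goodBand_union_badBand] at hu
  rw [← hu]
  by_cases hξ : ξ ∈ Set.Ioc (-(Real.pi / h)) (Real.pi / h)
  · rw [Set.indicator_of_mem hξ, Set.indicator_of_mem hξ]; rfl
  · rw [Set.indicator_of_notMem hξ, Set.indicator_of_notMem hξ, zero_mul]

lemma numSol_sub_exactSolution (s : Scheme) (μ x₀ : ℝ) {ρ h k T m : ℝ} (hρ0 : 0 ≤ ρ) (hρ : ρ < 1)
    (hT : 0 < T) (hh : 0 < h) (hk : 0 < k) (z : ℕ → ℝ) (N : ℕ) (x : ℝ) :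
    numSol s μ ρ x₀ h k hk.le z N x - exactSolution μ ρ x₀ T m x =
      invFourier (timeErr μ ρ k T m z N) (x - x₀) +
        h ^ 2 * invFourier (spaceErr μ ρ T m) (x - x₀) +
        invFourier ((badBand h k).indicator (amplProd s μ ρ h k z N)) (x - x₀) +
        invFourier (remErr s μ ρ h k T m z N) (x - x₀) := by
  have hX := integrable_exactFourier μ hρ hT m
  have hS := (integrable_spaceErr μ hρ0 hρ hT m).const_mul ((h ^ 2 : ℝ) : ℂ)
  have hE := integrable_timeErr μ ρ T hk m z N
  have hA := continuous_amplProd s μ ρ h hk.le z N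
  have hB := integrable_indicator_of_continuous hA (measurableSet_badBand h k)
    (a := -(Real.pi / h)) (b := Real.pi / h) fun ξ hξ => Set.Ioc_subset_Icc_self hξ.1
  have hG := integrable_indicator_of_continuous hA (measurableSet_goodBand h k)
    (a := -(Real.pi / h)) (b := Real.pi / h) fun ξ hξ => Set.Ioc_subset_Icc_self hξ.1
  have hR : Integrable (remErr s μ ρ h k T m z N) := ((hG.sub hX).sub hE).sub hS
  have e : (fun ξ => (goodBand h k).indicator (amplProd s μ ρ h k z N) ξ +
        (badBand h k).indicator (amplProd s μ ρ h k z N) ξ) = fun ξ =>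
      exactFourier μ ρ T m ξ + (timeErr μ ρ k T m z N ξ + (((h ^ 2 : ℝ) : ℂ) * spaceErr μ ρ T m ξ +
        ((badBand h k).indicator (amplProd s μ ρ h k z N) ξ +
          remErr s μ ρ h k T m z N ξ))) := by
    ext ξ
    rw [remErr]
    ring
  have i1 : Integrable fun ξ => (badBand h k).indicator (amplProd s μ ρ h k z N) ξ +
    remErr s μ ρ h k T m z N ξ := hB.add hR
  have i2 : Integrable fun ξ => ((h ^ 2 : ℝ) : ℂ) * spaceErr μ ρ T m ξ +
    ((badBand h k).indicator (amplProd s μ ρ h k z N) ξ + remErr s μ ρ h k T m z N ξ) := hS.add i1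
  have i3 : Integrable fun ξ => timeErr μ ρ k T m z N ξ + (((h ^ 2 : ℝ) : ℂ) * spaceErr μ ρ T m ξ +
    ((badBand h k).indicator (amplProd s μ ρ h k z N) ξ + remErr s μ ρ h k T m z N ξ)) := hE.add i2
  rw [numSol_eq_invFourier s μ ρ x₀ hh, e, invFourier_add hX i3,
    invFourier_add hE i2, invFourier_add hS i1, invFourier_add hB hR, invFourier_const_mul, exactSolution_eq_fourier hρ hT, ← invFourier]
  ring

lemma sqMomentLE_badBand (hZ : IsStdNormalSeq Z P) (s : Scheme) (μ : ℝ) {ρ k h θ : ℝ}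
    (hρ0 : 0 ≤ ρ) (hρ1 : ρ < 1) (hρ2 : 2 * ρ ^ 2 ≤ 1) (hθ : θ ^ 2 = 1 - 4 * (1 - 2 * ρ ^ 2) / 9)
    (hk : 0 ≤ k) (hh : 0 < h) (N : ℕ) (ξ : ℝ) :
    SqMomentLE P (fun ω => (badBand h k).indicator (amplProd s μ ρ h k (fun n => Z n ω) N) ξ)
      ((Set.Icc (-(Real.pi / h)) (Real.pi / h)).indicator (fun _ => (θ ^ N) ^ 2) ξ) := by
  by_cases hξ : ξ ∈ badBand h k
  swap
  · simp only [Set.indicator_of_notMem hξ]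
    exact sqMomentLE_zero
  rw [Set.indicator_of_mem (Set.Ioc_subset_Icc_self hξ.1)]
  simp only [Set.indicator_of_mem hξ]
  refine (sqMomentLE_amplProd hZ s μ hρ0 hk hh N ξ).mono ?_
  have hx0 : 0 ≤ k * symB h ξ := mul_nonneg hk (symB_nonneg h ξ)
  rw [← pow_mul, mul_comm N, pow_mul, hθ]
  gcongr
  exact stability_large hρ1 hρ2 hξ.2.le

lemma lintegral_inv_one_add_mul_sq {h : ℝ} (hh : 0 < h) :
    ∫⁻ ξ, ENNReal.ofReal (h * (1 + (h * ξ) ^ 2)⁻¹) = ENNReal.ofReal Real.pi := by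
  have hi : Integrable fun ξ : ℝ => (1 + (h * ξ) ^ 2)⁻¹ :=
    integrable_inv_one_add_sq.comp_mul_left' hh.ne'
  rw [← ofReal_integral_eq_lintegral_ofReal (hi.const_mul h) (ae_of_all _ fun ξ => by positivity),
    integral_const_mul, Measure.integral_comp_mul_left (fun y : ℝ => (1 + y ^ 2)⁻¹) h,
    integral_univ_inv_one_add_sq, abs_of_pos (by positivity), smul_eq_mul,
    mul_inv_cancel_left₀ hh.ne']

lemma hasBoundedMoments_badBand [IsProbabilityMeasure P] {ι : Type*} {Z : ι → ℕ → Ω → ℝ}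
    (hZ : ∀ i, IsStdNormalSeq (Z i) P) (s : Scheme) (μ : ℝ) {ρ θ : ℝ} (hρ0 : 0 ≤ ρ) (hρ1 : ρ < 1)
    (hρ2 : 2 * ρ ^ 2 ≤ 1) (hθ0 : 0 < θ) (hθ : θ ^ 2 = 1 - 4 * (1 - 2 * ρ ^ 2) / 9) {h k : ι → ℝ}
    (hh : ∀ i, 0 < h i) (hk : ∀ i, 0 ≤ k i) (N : ι → ℕ) (y : ι → ℝ) :
    HasBoundedMoments P fun i ω => ((θ ^ N i)⁻¹ * h i) * invFourier
      ((badBand (h i) (k i)).indicator (amplProd s μ ρ (h i) (k i) (fun n => Z i n ω) (N i)))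
        (y i) := by
  have hpi := Real.pi_pos
  refine hasBoundedMoments_of_fourier (fun i ω => mul_invFourier_eq _ _ _)
    (fun i => measurable_uncurry_const_mul_phase (measurable_uncurry_indicator_amplProd s μ ρ (h i)
      (hk i) (hZ i).measurable (N i) (measurableSet_badBand (h i) (k i))) _ (y i))
    -- The weight is rescaled to the width 1/h of the band, so its integral is π for every h; this
    -- balances the factor 1/h in front of E₃.
    (κ := fun i ξ => ENNReal.ofReal (h i * (1 + (h i * ξ) ^ 2)⁻¹)) (fun i => by fun_prop)
    (fun i ξ => by
      have := hh i
      rw [ne_eq, ENNReal.ofReal_eq_zero, not_le]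
      positivity)
    (fun i ξ => ENNReal.ofReal_ne_top)
    (G := fun i => (Set.Icc (-(Real.pi / h i)) (Real.pi / h i)).indicator
      fun _ => ENNReal.ofReal (h i ^ 2)) (fun i ξ => ?_)
    (B := ENNReal.ofReal (Real.pi * ((1 + Real.pi ^ 2) * (2 * Real.pi)))) ENNReal.ofReal_ne_top
    fun i => ?_
  · refine ((sqMomentLE_badBand (hZ i) s μ hρ0 hρ1 hρ2 hθ (hk i) (hh i) (N i) ξ).const_mul_phase
      _ (ξ * y i)).trans ?_
    by_cases hξ : ξ ∈ Set.Icc (-(Real.pi / h i)) (Real.pi / h i)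
    · rw [Set.indicator_of_mem hξ, Set.indicator_of_mem hξ]
      refine ENNReal.ofReal_le_ofReal (le_of_eq ?_)
      have : θ ^ N i ≠ 0 := by positivity
      field_simp
    · rw [Set.indicator_of_notMem hξ, Set.indicator_of_notMem hξ]
      simp
  · have hi := hh i
    rw [lintegral_inv_one_add_mul_sq hi, ENNReal.ofReal_mul hpi.le]
    gcongr
    calc _ ≤ ∫⁻ ξ, (Set.Icc (-(Real.pi / h i)) (Real.pi / h i)).indicator
          (fun _ => ENNReal.ofReal ((1 + Real.pi ^ 2) * h i)) ξ := by
          refine lintegral_mono fun ξ => ?_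
          by_cases hξ : ξ ∈ Set.Icc (-(Real.pi / h i)) (Real.pi / h i)
          swap
          · rw [Set.indicator_of_notMem hξ, Set.indicator_of_notMem hξ, mul_zero]
          rw [Set.indicator_of_mem hξ, Set.indicator_of_mem hξ,
            ← ENNReal.ofReal_inv_of_pos (by positivity), ← ENNReal.ofReal_mul (by positivity)]
          refine ENNReal.ofReal_le_ofReal ?_
          have h1 : |h i * ξ| ≤ Real.pi := by
            rw [abs_mul, abs_of_pos hi, mul_comm, ← le_div_iff₀ hi]
            exact abs_le.2 hξ
          have h2 : (h i * ξ) ^ 2 ≤ Real.pi ^ 2 := by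
            rw [← sq_abs]; gcongr
          calc _ = (1 + (h i * ξ) ^ 2) * h i := by field_simp
            _ ≤ _ := by gcongr
      _ = ENNReal.ofReal ((1 + Real.pi ^ 2) * h i) * ENNReal.ofReal (2 * (Real.pi / h i)) := by
          rw [lintegral_indicator measurableSet_Icc, lintegral_const, Measure.restrict_apply_univ,
            Real.volume_Icc]
          congr 2
          ring
      _ = ENNReal.ofReal ((1 + Real.pi ^ 2) * (2 * Real.pi)) := by
          rw [← ENNReal.ofReal_mul (by positivity)]
          congr 1
          field_simp
      _ ≤ _ := le_rfl

lemma isLittleO_mul_sqrt :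
    (fun q : ℝ × ℝ => (q.1 + q.2 ^ 2) * √(q.1 + q.2 ^ 2)) =o[𝓝[>] 0 ×ˢ 𝓝[>] 0]
      fun q : ℝ × ℝ => q.1 + q.2 ^ 2 := by
  have hc : Continuous fun q : ℝ × ℝ => √(q.1 + q.2 ^ 2) := by fun_prop
  have ht : Tendsto (fun q : ℝ × ℝ => √(q.1 + q.2 ^ 2)) (𝓝[>] 0 ×ˢ 𝓝[>] 0) (𝓝 0) := by
    have h0 := hc.tendsto (0, 0)
    rw [nhds_prod_eq] at h0
    simp only [zero_add, ne_eq, OfNat.ofNat_ne_zero, not_false_eq_true, zero_pow,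
      Real.sqrt_zero] at h0
    exact h0.mono_left (Filter.prod_mono nhdsWithin_le_nhds nhdsWithin_le_nhds)
  simpa using (isBigO_refl (fun q : ℝ × ℝ => q.1 + q.2 ^ 2) (𝓝[>] 0 ×ˢ 𝓝[>] 0)).mul_isLittleO
    ((isLittleO_one_iff ℝ).2 ht)

end

/-! ### Constants and assembly of the expansion. -/

section

variable {Ω : Type*} [MeasurableSpace Ω] {P : Measure Ω} {Z : ℕ → Ω → ℝ}

lemma measurable_uncurry_remErr (s : Scheme) (μ ρ h T : ℝ) {k : ℝ} (hk : 0 ≤ k) {m : Ω → ℝ}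
    (hm : Measurable m) (hZ : ∀ n, Measurable (Z n)) (N : ℕ) :
    Measurable (Function.uncurry fun ξ ω => remErr s μ ρ h k T (m ω) (fun n => Z n ω) N ξ) :=
  (((measurable_uncurry_indicator_amplProd s μ ρ h hk hZ N (measurableSet_goodBand h k)).sub
    (measurable_uncurry_exactFourier μ ρ T hm)).sub
    (measurable_uncurry_timeErr μ ρ T hk hm hZ N)).sub
    ((measurable_uncurry_spaceErr μ ρ T hm).const_mul _)

lemma lt_one_and_two_mul_sq_le {ρ : ℝ} (h0 : 0 < ρ) (h : ρ ≤ 1 / √2) : ρ < 1 ∧ 2 * ρ ^ 2 ≤ 1 := by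
  have h1 : 2 * ρ ^ 2 ≤ 1 := by
    have := pow_le_pow_left₀ h0.le h 2
    rw [div_pow, Real.sq_sqrt (by norm_num)] at this
    linarith
  exact ⟨by nlinarith, h1⟩

lemma two_mul_sq_lt {ρ : ℝ} (h0 : 0 < ρ) (h : ρ < 1 / √2) : 2 * ρ ^ 2 < 1 := by
  have := pow_lt_pow_left₀ h h0.le two_ne_zero
  rw [div_pow, Real.sq_sqrt (by norm_num)] at this
  linarith

lemma exists_damping (ρ : ℝ) : ∃ θ : ℝ, 0 < θ ∧ θ < 1 ∧
    (2 * ρ ^ 2 < 1 → θ ^ 2 = 1 - 4 * (1 - 2 * ρ ^ 2) / 9) := by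
  by_cases h : 2 * ρ ^ 2 < 1
  · have h0 : 0 < 1 - 4 * (1 - 2 * ρ ^ 2) / 9 := by nlinarith [sq_nonneg ρ]
    refine ⟨√(1 - 4 * (1 - 2 * ρ ^ 2) / 9), Real.sqrt_pos.2 h0, ?_, fun _ => Real.sq_sqrt h0.le⟩
    rw [Real.sqrt_lt' one_pos]
    linarith
  -- Arbitrary value: the strongly damped band is invoked only for ρ < 1/√2.
  · exact ⟨1 / 2, by norm_num, by norm_num, fun h' => absurd h' h⟩

end

end ZakaiMilstein

open ZakaiMilstein in
theorem mainTheorem2 {Ω : Type*} [MeasurableSpace Ω] (P : Measure Ω) [IsProbabilityMeasure P]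
    (M : ℝ≥0 → Ω → ℝ) (hM : IsBrownianReal M P)
    (s : ZakaiMilstein.Scheme) (μ ρ x₀ : ℝ) (T : ℝ≥0)
    (hρ_pos : 0 < ρ) (hρ_le : ρ ≤ 1 / √2) (hT : 0 < T) :
    ∃ (θ : ℝ) (E₁ : ℕ → ℝ → Ω → ℝ) (E₂ : ℝ → Ω → ℝ) (E₃ R : ℝ → ℕ → ℝ → Ω → ℝ) (r : ℝ → ℝ → ℝ),
      0 < θ ∧ θ < 1 ∧
      ZakaiMilstein.HasBoundedMoments P (fun i : ℕ × ℝ => E₁ i.1 i.2) ∧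
      ZakaiMilstein.HasBoundedMoments P E₂ ∧
      ZakaiMilstein.HasBoundedMoments P (fun i : ℝ × ℕ × ℝ => E₃ i.1 i.2.1 i.2.2) ∧
      ZakaiMilstein.HasBoundedMoments P (fun i : ℝ × ℕ × ℝ => R i.1 i.2.1 i.2.2) ∧
      ((fun q : ℝ × ℝ => r q.1 q.2) =o[𝓝[>] 0 ×ˢ 𝓝[>] 0] fun q : ℝ × ℝ => q.1 + q.2 ^ 2) ∧
      ∀ (h : ℝ) (N : ℕ) (k : ℝ≥0), 0 < h → 1 ≤ N → k = T / N → (∃ m : ℤ, x₀ = m * h) →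
        (∃ V : ℕ → ℤ → Ω → ℝ, ∀ᵐ ω ∂P,
          ZakaiMilstein.IsMilsteinSolution s μ ρ x₀ h k N (ZakaiMilstein.noise M k ω)
            (fun n j => V n j ω)) ∧
        ∀ V : ℕ → ℤ → Ω → ℝ,
          (∀ᵐ ω ∂P, ZakaiMilstein.IsMilsteinSolution s μ ρ x₀ h k N (ZakaiMilstein.noise M k ω)
            (fun n j => V n j ω)) →
          (k ≤ h ^ 2 → ∀ j : ℤ, ∀ᵐ ω ∂P,
            V N j ω - ZakaiMilstein.exactSolution μ ρ x₀ T (M T ω) (j * h) =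
              k * E₁ N (j * h) ω + h ^ 2 * E₂ (j * h) ω + r k h * R h N (j * h) ω) ∧
          (ρ < 1 / √2 → h ^ 2 < k → ∀ j : ℤ, ∀ᵐ ω ∂P,
            V N j ω - ZakaiMilstein.exactSolution μ ρ x₀ T (M T ω) (j * h) =
              k * E₁ N (j * h) ω + h ^ 2 * E₂ (j * h) ω + θ ^ N * h⁻¹ * E₃ h N (j * h) ω
                + r k h * R h N (j * h) ω) := by
  classical
  obtain ⟨hρ1, hρ2⟩ := lt_one_and_two_mul_sq_le hρ_pos hρ_le
  obtain ⟨θ, hθ0, hθ1, hθ⟩ := exists_damping ρ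
  have hT' : (0 : ℝ) < T := hT
  have hρ' : 0 < 1 - ρ := by linarith
  -- The increments depend on the time step, so a separate sequence is chosen for each N.
  have hex : ∀ N : ℕ, 1 ≤ N → ∃ Z : ℕ → Ω → ℝ, IsStdNormalSeq Z P ∧
      ∀ᵐ ω ∂P, (∀ n, noise M (T / N) ω n = Z n ω) ∧
        M T ω = √((T : ℝ) / N) * ∑ n ∈ Finset.range N, Z n ω := fun N hN => by
    have hN' : (0 : ℝ≥0) < N := by exact_mod_cast hN
    obtain ⟨Z, hZ, h⟩ := exists_isStdNormalSeq_noise hM (div_pos hT hN')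
    refine ⟨Z, hZ, h.mono fun ω hω => ⟨hω.1, ?_⟩⟩
    have := hω.2 N
    rw [mul_div_cancel₀ _ hN'.ne'] at this
    rw [this]
    push_cast
    rfl
  choose! Z hZ hZM using hex
  set κ : ℕ → ℝ := fun N => (T : ℝ) / N with hκ
  have hκ0 : ∀ N, 0 ≤ κ N := fun N => by positivity
  have hκpos : ∀ {N}, 1 ≤ N → 0 < κ N := fun {N} hN => by
    have : (0 : ℝ) < N := by exact_mod_cast hN
    positivity
  have hNκ : ∀ {N : ℕ}, 1 ≤ N → N * κ N = T := fun {N} hN => by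
    have : (0 : ℝ) < N := by exact_mod_cast hN
    simp only [hκ]
    field_simp
  set m : ℕ → Ω → ℝ := fun N ω => √(κ N) * ∑ n ∈ Finset.range N, Z N n ω with hm
  have hmm : ∀ {N}, 1 ≤ N → Measurable (m N) := fun {N} hN =>
    (Finset.measurable_sum _ fun n _ => (hZ N hN).measurable n).const_mul _
  -- The exponent 3/2 is the square root of the order of the second moment of `remErr`.
  set r : ℝ → ℝ → ℝ := fun k h => (k + h ^ 2) * √(k + h ^ 2) with hr
  set E₁ : ℕ → ℝ → Ω → ℝ := fun N x ω => if 1 ≤ N then (κ N)⁻¹ * invFourier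
    (timeErr μ ρ (κ N) T (m N ω) (fun n => Z N n ω) N) (x - x₀) else 0 with hE₁
  -- A measurable version of M_T is needed that does not depend on N; the one built from a single
  -- step serves.
  set E₂ : ℝ → Ω → ℝ := fun x ω => 1 * invFourier (spaceErr μ ρ T (m 1 ω)) (x - x₀) with hE₂
  set E₃ : ℝ → ℕ → ℝ → Ω → ℝ := fun h N x ω => if 0 < h ∧ 1 ≤ N ∧ 2 * ρ ^ 2 < 1 then
    ((θ ^ N)⁻¹ * h) * invFourier ((badBand h (κ N)).indicator
      (amplProd s μ ρ h (κ N) (fun n => Z N n ω) N)) (x - x₀) else 0 with hE₃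
  set R : ℝ → ℕ → ℝ → Ω → ℝ := fun h N x ω => if 0 < h ∧ 1 ≤ N then
    (r (κ N) h)⁻¹ * invFourier (remErr s μ ρ h (κ N) T (m N ω) (fun n => Z N n ω) N) (x - x₀)
      else 0 with hR
  refine ⟨θ, E₁, E₂, E₃, R, r, hθ0, hθ1, ?_, ?_, ?_, ?_, isLittleO_mul_sqrt, ?_⟩
  · refine HasBoundedMoments.of_subtype (p := fun i : ℕ × ℝ => 1 ≤ i.1) ?_ fun i hi => by
      ext ω; simp only [hE₁, if_neg hi, Pi.zero_apply]
    obtain ⟨C, hC, hb⟩ := exists_sqMomentLE_timeErr (P := P) μ hρ_pos.le hρ1.le hT'.le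
    have := hasBoundedMoments_invFourier (P := P)
      (f := fun (i : {i : ℕ × ℝ // 1 ≤ i.1}) ω =>
        timeErr μ ρ (κ i.1.1) T (m i.1.1 ω) (fun n => Z i.1.1 n ω) i.1.1)
      (fun i => i.1.2 - x₀) (fun i => (κ i.1.1)⁻¹)
      (fun i => measurable_uncurry_timeErr μ ρ T (hκ0 _) (hmm i.2) (hZ _ i.2).measurable _)
      (mul_pos hρ' hT') (fun i ξ => hb (hZ _ i.2) (m i.1.1) i.1.1 (hκ0 _) (hNκ i.2) ξ) (C := C)
      (fun i => le_of_eq (by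
        have := hκpos i.2
        field_simp))
    refine (iff_of_eq (congrArg (HasBoundedMoments P) ?_)).2 this
    ext i ω
    exact if_pos i.2
  · obtain ⟨C, hC, hb⟩ := exists_sqMomentLE_spaceErr (P := P) μ hρ_pos.le hρ1.le hT'.le
    exact hasBoundedMoments_invFourier (P := P) (f := fun (x : ℝ) ω => spaceErr μ ρ T (m 1 ω))
      (fun x => x - x₀) (fun _ => 1) (fun x => measurable_uncurry_spaceErr μ ρ T (hmm le_rfl))
      (mul_pos hρ' hT') (A := fun _ => C) (C := C) (fun x ξ => hb (hZ 1 le_rfl) 1 (hκ0 _) (hNκ le_rfl) ξ)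
      (fun x => by simp)
  · refine HasBoundedMoments.of_subtype
      (p := fun i : ℝ × ℕ × ℝ => 0 < i.1 ∧ 1 ≤ i.2.1 ∧ 2 * ρ ^ 2 < 1) ?_ fun i hi => by
        ext ω; simp only [hE₃, if_neg hi, Pi.zero_apply]
    by_cases hρ3 : 2 * ρ ^ 2 < 1
    · have := hasBoundedMoments_badBand (P := P)
        (Z := fun i : {i : ℝ × ℕ × ℝ // 0 < i.1 ∧ 1 ≤ i.2.1 ∧ 2 * ρ ^ 2 < 1} => Z i.1.2.1)
        (fun i => hZ _ i.2.2.1) s μ hρ_pos.le hρ1 hρ2 hθ0 (hθ hρ3) (h := fun i => i.1.1)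
        (k := fun i => κ i.1.2.1) (fun i => i.2.1) (fun i => hκ0 _) (fun i => i.1.2.1)
        (fun i => i.1.2.2 - x₀)
      refine (iff_of_eq (congrArg (HasBoundedMoments P) ?_)).2 this
      ext i ω
      exact if_pos i.2
    · exact ⟨0, fun i => absurd i.2.2.2 hρ3⟩
  · refine HasBoundedMoments.of_subtype
      (p := fun i : ℝ × ℕ × ℝ => 0 < i.1 ∧ 1 ≤ i.2.1) ?_ fun i hi => by
        ext ω; simp only [hR, if_neg hi, Pi.zero_apply]
    obtain ⟨C, hC, hb⟩ := exists_sqMomentLE_remErr (P := P) μ hρ_pos.le hρ1 hρ2 hT'.le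
    have := hasBoundedMoments_invFourier (P := P)
      (f := fun (i : {i : ℝ × ℕ × ℝ // 0 < i.1 ∧ 1 ≤ i.2.1}) ω =>
        remErr s μ ρ i.1.1 (κ i.1.2.1) T (m i.1.2.1 ω) (fun n => Z i.1.2.1 n ω) i.1.2.1)
      (fun i => i.1.2.2 - x₀) (fun i => (r (κ i.1.2.1) i.1.1)⁻¹)
      (fun i => measurable_uncurry_remErr s μ ρ i.1.1 T (hκ0 _) (hmm i.2.2)
        (hZ _ i.2.2).measurable _)
      (by have := Real.pi_pos; positivity)
      (fun i ξ => hb (hZ _ i.2.2) s i.1.2.1 (hκ0 _) i.2.1 (hNκ i.2.2) ξ) (C := C)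
      (fun i => le_of_eq (by
        have h1 := hκpos i.2.2
        have h2 : 0 < κ i.1.2.1 + i.1.1 ^ 2 := by positivity
        simp only [hr]
        rw [inv_pow, mul_pow, Real.sq_sqrt h2.le]
        field_simp))
    refine (iff_of_eq (congrArg (HasBoundedMoments P) ?_)).2 this
    ext i ω
    exact if_pos i.2
  · intro h N k hh hN hk hx
    obtain ⟨j₀, hj₀⟩ := hx
    have hkκ : (k : ℝ) = κ N := by rw [hk]; push_cast; rfl
    have hk0 : (0 : ℝ) ≤ k := k.2
    refine ⟨⟨fun n j ω => numSol s μ ρ x₀ h k hk0 (noise M k ω) n (j * h), ae_of_all _ fun ω =>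
      isMilsteinSolution_numSol s μ ρ x₀ h k hk0 hh hj₀ _ N⟩, fun V hV => ?_⟩
    have key : ∀ᵐ ω ∂P, ∀ j : ℤ, V N j ω - exactSolution μ ρ x₀ T (M T ω) (j * h) =
        k * E₁ N (j * h) ω + h ^ 2 * E₂ (j * h) ω +
        invFourier ((badBand h (κ N)).indicator (amplProd s μ ρ h (κ N) (fun n => Z N n ω) N))
          (j * h - x₀) + r k h * R h N (j * h) ω := by
      filter_upwards [hV, hZM N hN, hZM 1 le_rfl] with ω hVω hω hω1 j
      have hz : noise M k ω = fun n => Z N n ω := by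
        rw [hk]; exact funext hω.1
      have h1 : V N j ω = _ := congrFun (hVω.unique hk0
        (isMilsteinSolution_numSol s μ ρ x₀ h k hk0 hh hj₀ _ N) le_rfl) j
      -- Both are versions of M_T, so E₂ may be evaluated with the version for N.
      have hm1 : m 1 ω = m N ω := hω1.2.symm.trans hω.2
      have hmN : M T ω = m N ω := hω.2
      have h2 := numSol_sub_exactSolution s μ x₀ (m := m N ω) hρ_pos.le hρ1 hT' hh (hκpos hN)
        (fun n => Z N n ω) N (j * h)
      have hrpos : r (κ N) h ≠ 0 := by
        have := hκpos hN
        simp only [hr]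
        positivity
      have hκne : κ N ≠ 0 := (hκpos hN).ne'
      rw [h1, hmN]
      simp only [hE₁, hE₂, hR, if_pos hN, if_pos (And.intro hh hN), hm1, hz, hkκ, one_mul]
      rw [h2, mul_inv_cancel_left₀ hκne, mul_inv_cancel_left₀ hrpos]
    constructor
    · intro hkh j
      filter_upwards [key] with ω hω
      rw [hω j, badBand_eq_empty hh (hkκ ▸ hkh)]
      simp only [Set.indicator_empty]
      rw [invFourier_zero]
      ring
    · intro hρ3 _ j
      filter_upwards [key] with ω hω
      have hθN : θ ^ N ≠ 0 := by positivity
      rw [hω j]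
      simp only [hE₃, if_pos (And.intro hh (And.intro hN (two_mul_sq_lt hρ_pos hρ3)))]
      field_simp
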